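/- Let $T>0$, $\epsilon_1>0$ and $0<c\le C$. For every $\epsilon\in(0,\epsilon_1)$ let $\varepsilon(t)=\epsilon A_\epsilon(t)$ with $A_\epsilon\in C^2([0,T])$, $c\le A_\epsilon(t)\le C$ on $[0,T]$ ($c,C$ independent of $\epsilon$), and suppose that $A_\epsilon'(t)/A_\epsilon(t)\to0$ and $A_\epsilon''(t)/A_\epsilon(t)\to0$ as $\epsilon\to0$ for every $t\in[0,T]$. For every such $\epsilon$ let $(u^\varepsilon,p^\varepsilon)$ be a solution on $[0,T]\times\mathbb R^3$ of $$\partial_t u^\varepsilon+(u^\varepsilon\cdot\nabla)u^\varepsilon+\tfrac12(\nabla\cdot u^\varepsilon)u^\varepsilon+\nabla p^\varepsilon-\Delta u^\varepsilon=0,\qquad \partial_t(\varepsilon(t)p^\varepsilon)-\tfrac12\varepsilon_t(t)p^\varepsilon+\nabla\cdot u^\varepsilon=0$$ with initial data $u^\varepsilon(0)=u_0^\varepsilon\in L^2(\mathbb R^3;\mathbb R^3)$, $p^\varepsilon(0)=p_0^\varepsilon\in L^2(\mathbb R^3)$ such that, as $\epsilon\to0$, $u_0^\varepsilon\to u_0$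 strongly in $L^2$ for some $u_0\in L^2(\mathbb R^3;\mathbb R^3)$ and $\sqrt{\varepsilon(0)}\,p_0^\varepsilon\to0$ strongly in $L^2$. Here a solution satisfies $u^\varepsilon\in L^\infty(0,T;L^2)\cap L^2(0,T;\dot H^1)$ and $p^\varepsilon\in L^\infty(0,T;L^2)$, and is one of the following: (a) a strong solution, i.e. $u^\varepsilon\in H^1(0,T;L^2)\cap L^2(0,T;H^2)$, $\varepsilon p^\varepsilon\in H^1(0,T;L^2)$, $\nabla p^\varepsilon\in L^2(0,T;L^2)$, the initial values are attained in $L^2$, and the equations hold almost everywhere; or (b) a finite energy weak solution, i.e. the system with these initial values holds in the sense of distributions (test functions in $C_c^\infty([0,T)\times\mathbb R^3)$), and for almost every $t\in[0,T]$ $$\tfrac12\int_{\mathbb R^3}\big(|u^\varepsilon(t)|^2+\varepsilon(t)|p^\varepsilon(t)|^2\big)dx+\int_0^t\!\!\int_{\mathbb R^3}|\nabla u^\varepsilon|^2\,dx\,ds\le\tfrac12\int_{\mathbb R^3}\big(|u^\varepsilon_0|^2+\varepsilon(0)|p^\varepsilon_0|^2\big)dx .$$ Let $\mathbb P=I-\nabla\Delta^{-1}\nabla\cdot$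 be the Leray projection on $L^2(\mathbb R^3;\mathbb R^3)$. Then $\mathbb P u^\varepsilon$ is precompact in $L^2(0,T;L^2_{\rm loc}(\mathbb R^3))$ as $\epsilon\to0$: there is $\epsilon_0\in(0,\epsilon_1]$ such that every sequence in $\{\mathbb P u^\varepsilon: 0<\epsilon<\epsilon_0\}$ has a subsequence that converges in $L^2(0,T;L^2(B_R))$ for every $R>0$ to one common limit in $L^2(0,T;L^2_{\rm loc}(\mathbb R^3))$. -/

import Mathlib

open MeasureTheory Set Filter Topology
open scoped ContDiff ENNReal

noncomputable section

namespace AC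

/-- Euclidean three-space `ℝ³`. -/
abbrev E3 : Type := EuclideanSpace ℝ (Fin 3)

/-- The Hilbert space `L²(ℝ³; ℝ³)` of square integrable vector fields. -/
abbrev L2V : Type := Lp E3 2 (volume : Measure E3)

/-- The Hilbert space `L²(ℝ³)` of square integrable scalar fields. -/
abbrev L2S : Type := Lp ℝ 2 (volume : Measure E3)

/-- The `j`-th standard basis vector of `ℝ³`. -/
def e (j : Fin 3) : E3 := EuclideanSpace.single j (1 : ℝ)

/-- Lebesgue measure on the time interval `[0,T]`. -/
def timeMeasure (T : ℝ) : Measure ℝ := (volume : Measure ℝ).restrict (Icc 0 T)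

/-- `g` is the weak partial derivative `∂_j f` on `ℝ³`, tested against `C_c^∞(ℝ³)`. It is only
used for fields `f`, `g` that are square integrable. -/
def IsWeakPartial {F : Type*} [NormedAddCommGroup F] [NormedSpace ℝ F]
    (j : Fin 3) (f g : E3 → F) : Prop :=
  ∀ φ : E3 → ℝ, ContDiff ℝ ∞ φ → HasCompactSupport φ →
    ∫ x, (fderiv ℝ φ x (e j)) • f x = - ∫ x, φ x • g x

/-! ### The Leray projection -/

/-- The closed subspace of gradients in `L²(ℝ³; ℝ³)`: the `L²`-closure of
`{∇ψ : ψ ∈ C_c^∞(ℝ³)}`, that is `{∇q : q ∈ Ḣ¹(ℝ³)}`. -/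
def gradientSpace : Submodule ℝ L2V :=
  (Submodule.span ℝ {g : L2V | ∃ ψ : E3 → ℝ, ContDiff ℝ ∞ ψ ∧ HasCompactSupport ψ ∧
    g =ᵐ[volume] fun x => gradient ψ x}).topologicalClosure

instance : CompleteSpace gradientSpace :=
  (Submodule.isClosed_topologicalClosure _).completeSpace_coe

/-- `ℚ = ∇ Δ⁻¹ ∇·` on `L²(ℝ³; ℝ³)`: `ℚ u = ∇q`, where `q ∈ Ḣ¹(ℝ³)` is the weak solution of
`Δ q = ∇ · u`, i.e. `∇q` is a gradient with `∫ ∇q · ∇ψ = ∫ u · ∇ψ` for all `ψ ∈ C_c^∞`.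
This is the orthogonal projection onto the gradients; see `lerayQ_mem`, `lerayQ_weak`. -/
def lerayQ : L2V →L[ℝ] L2V := gradientSpace.starProjection

/-- The Leray projection `ℙ = I - ℚ`. -/
def lerayP : L2V →L[ℝ] L2V := ContinuousLinearMap.id ℝ L2V - lerayQ

theorem lerayQ_mem (u : L2V) : lerayQ u ∈ gradientSpace :=
  Submodule.starProjection_apply_mem _ _

/-- `Δ q = ∇ · u` in the weak sense, for `ℚ u = ∇q`. -/
theorem lerayQ_weak (u g : L2V) (ψ : E3 → ℝ) (hψ : ContDiff ℝ ∞ ψ) (hc : HasCompactSupport ψ)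
    (hg : g =ᵐ[volume] fun x => gradient ψ x) :
    ∫ x, inner ℝ (lerayQ u x) (gradient ψ x) = ∫ x, inner ℝ (u x) (gradient ψ x) := by
  have hgm : g ∈ gradientSpace :=
    Submodule.le_topologicalClosure _ (Submodule.subset_span ⟨ψ, hψ, hc, hg⟩)
  have h0 : inner ℝ (u - lerayQ u) g = 0 :=
    Submodule.starProjection_inner_eq_zero u g hgm
  rw [inner_sub_left, sub_eq_zero, L2.inner_def, L2.inner_def] at h0
  have key : ∀ v : L2V, ∫ x, inner ℝ (v x) (gradient ψ x) = ∫ x, inner ℝ (v x) (g x) := by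
    intro v
    apply integral_congr_ae
    filter_upwards [hg] with x hx
    rw [hx]
  rw [key, key, h0]

/-! ### The artificial compression system

`∂ₜu + (u·∇)u + ½(∇·u)u + ∇p - Δu = 0`, `∂ₜ(εp) - ½ εₜ p + ∇·u = 0` on `[0,T] × ℝ³`,
with `u(0) = u₀`, `p(0) = p₀` and a function `ε : [0,T] → (0,∞)`. -/

/-- Divergence of a field, from its partial derivatives `Du j = ∂_j u`. -/
def divOf (Du : Fin 3 → L2V) (x : E3) : ℝ := ∑ j, (Du j x) j

/-- The skew-symmetrised convection term `(u·∇)u + ½(∇·u)u`. -/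
def convection (u : L2V) (Du : Fin 3 → L2V) (x : E3) : E3 :=
  (∑ j, (u x) j • Du j x) + ((1 / 2 : ℝ) * divOf Du x) • u x

/-- `u ∈ L^∞(0,T;L²) ∩ L²(0,T;Ḣ¹)` with spatial derivatives `Du t j = ∂_j u(t)`, and
`p ∈ L^∞(0,T;L²)` (the same as `√ε p ∈ L^∞(0,T;L²)` if `ε` is bounded above and away from 0). -/
structure InEnergyClass (T : ℝ) (u : ℝ → L2V) (p : ℝ → L2S) (Du : ℝ → Fin 3 → L2V) :
    Prop where
  u_bdd : MemLp u ∞ (timeMeasure T)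
  p_bdd : MemLp p ∞ (timeMeasure T)
  grad_mem : ∀ j, MemLp (fun t => Du t j) 2 (timeMeasure T)
  grad_eq : ∀ᵐ t ∂timeMeasure T, ∀ j, IsWeakPartial j (u t) (Du t j)

/-- Test functions in `C_c^∞([0,T) × ℝ³; F)`, as restrictions of functions on `ℝ × ℝ³`. -/
def IsTest {F : Type*} [NormedAddCommGroup F] [NormedSpace ℝ F]
    (T : ℝ) (φ : ℝ × E3 → F) : Prop :=
  ContDiff ℝ ∞ φ ∧ HasCompactSupport φ ∧ tsupport φ ⊆ Iio T ×ˢ univ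

/-- Time derivative of a function on `ℝ × ℝ³`. -/
def dt {F : Type*} [NormedAddCommGroup F] [NormedSpace ℝ F]
    (φ : ℝ × E3 → F) (t : ℝ) (x : E3) : F := fderiv ℝ φ (t, x) (1, 0)

/-- `j`-th space derivative of a function on `ℝ × ℝ³`. -/
def dx {F : Type*} [NormedAddCommGroup F] [NormedSpace ℝ F]
    (j : Fin 3) (φ : ℝ × E3 → F) (t : ℝ) (x : E3) : F := fderiv ℝ φ (t, x) (0, e j)

/-- The momentum equation with initial value `u₀` in the sense of distributions. -/
def WeakMomentum (T : ℝ) (u₀ : L2V) (u : ℝ → L2V) (p : ℝ → L2S)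
    (Du : ℝ → Fin 3 → L2V) : Prop :=
  ∀ φ : ℝ × E3 → E3, IsTest T φ →
    ∫ t, (- (∫ x, inner ℝ (u t x) (dt φ t x))
        + (∫ x, inner ℝ (convection (u t) (Du t) x) (φ (t, x)))
        - (∫ x, p t x * ∑ j, (dx j φ t x) j)
        + ∑ j, ∫ x, inner ℝ (Du t j x) (dx j φ t x)) ∂timeMeasure T
      = ∫ x, inner ℝ (u₀ x) (φ (0, x))

/-- The pressure equation with initial value `p₀` in the sense of distributions. -/
def WeakPressure (T : ℝ) (ε : ℝ → ℝ) (p₀ : L2S) (p : ℝ → L2S)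
    (Du : ℝ → Fin 3 → L2V) : Prop :=
  ∀ ψ : ℝ × E3 → ℝ, IsTest T ψ →
    ∫ t, (- (∫ x, ε t * p t x * dt ψ t x)
        - (∫ x, (1 / 2 : ℝ) * derivWithin ε (Icc 0 T) t * p t x * ψ (t, x))
        + (∫ x, divOf (Du t) x * ψ (t, x))) ∂timeMeasure T
      = ∫ x, ε 0 * p₀ x * ψ (0, x)

/-- The energy `½ ∫ (|u|² + ε |p|²) dx`. -/
def energy (ε : ℝ) (u : L2V) (p : L2S) : ℝ := (1 / 2 : ℝ) * (‖u‖ ^ 2 + ε * ‖p‖ ^ 2)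

/-- Finite energy weak solutions in the sense of Leray: in the energy class, satisfying the
system in the sense of distributions, with the energy inequality. -/
def IsFiniteEnergyWeakSolution (T : ℝ) (ε : ℝ → ℝ) (u₀ : L2V) (p₀ : L2S)
    (u : ℝ → L2V) (p : ℝ → L2S) : Prop :=
  ∃ Du : ℝ → Fin 3 → L2V, InEnergyClass T u p Du ∧
    WeakMomentum T u₀ u p Du ∧ WeakPressure T ε p₀ p Du ∧
    ∀ᵐ t ∂timeMeasure T,
      energy (ε t) (u t) (p t) + (∫ s in Icc 0 t, ∑ j, ‖Du s j‖ ^ 2) ≤ energy (ε 0) u₀ p₀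

/-- Strong solutions: `u ∈ H¹(0,T;L²) ∩ L²(0,T;H²)`, `εp ∈ H¹(0,T;L²)`, `∇p ∈ L²(0,T;L²)`,
the initial values are attained in `L²`, and both equations hold almost everywhere. Here `ut`,
`πt`, `Dp`, `D2u t i j` are `∂ₜu`, `∂ₜ(εp)`, `∇p` and `∂_i ∂_j u(t)`. No energy estimate is
required. -/
def IsStrongSolution (T : ℝ) (ε : ℝ → ℝ) (u₀ : L2V) (p₀ : L2S)
    (u : ℝ → L2V) (p : ℝ → L2S) : Prop :=
  ∃ (Du : ℝ → Fin 3 → L2V) (D2u : ℝ → Fin 3 → Fin 3 → L2V) (ut : ℝ → L2V)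
    (πt : ℝ → L2S) (Dp : ℝ → L2V),
    InEnergyClass T u p Du ∧
    (∀ i j, MemLp (fun t => D2u t i j) 2 (timeMeasure T)) ∧
    (∀ᵐ t ∂timeMeasure T, ∀ i j, IsWeakPartial i (Du t j) (D2u t i j)) ∧
    MemLp Dp 2 (timeMeasure T) ∧
    (∀ᵐ t ∂timeMeasure T, ∀ j, IsWeakPartial j (p t) (fun x => (Dp t x) j)) ∧
    MemLp ut 2 (timeMeasure T) ∧
    (∀ t ∈ Icc 0 T, u t = u₀ + ∫ s in Icc 0 t, ut s) ∧
    MemLp πt 2 (timeMeasure T) ∧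
    (∀ t ∈ Icc 0 T, ε t • p t = ε 0 • p₀ + ∫ s in Icc 0 t, πt s) ∧
    (∀ᵐ t ∂timeMeasure T, ∀ᵐ x : E3,
      ut t x + convection (u t) (Du t) x + Dp t x - ∑ j, D2u t j j x = 0) ∧
    (∀ᵐ t ∂timeMeasure T, ∀ᵐ x : E3,
      πt t x - (1 / 2 : ℝ) * derivWithin ε (Icc 0 T) t * p t x + divOf (Du t) x = 0)

/-- Solutions of the Cauchy problem: strong solutions and finite energy weak solutions. -/
def IsSolution (T : ℝ) (ε : ℝ → ℝ) (u₀ : L2V) (p₀ : L2S)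
    (u : ℝ → L2V) (p : ℝ → L2S) : Prop :=
  IsStrongSolution T ε u₀ p₀ u p ∨ IsFiniteEnergyWeakSolution T ε u₀ p₀ u p

/-! ### Compactness in `L²(0,T; L²_loc)` -/

/-- `w ∈ L²(0,T; L²_loc(ℝ³; ℝ³))`: on every ball of radius `R`, `w` is represented by an element
of the Bochner space `L²(0,T; L²(B_R))`. -/
def MemL2L2loc (T : ℝ) (w : ℝ → E3 → E3) : Prop :=
  ∀ R : ℝ, 0 < R →
    ∃ W : ℝ → Lp E3 2 ((volume : Measure E3).restrict (Metric.ball 0 R)),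
      MemLp W 2 (timeMeasure T) ∧
      ∀ᵐ t ∂timeMeasure T, W t =ᵐ[(volume : Measure E3).restrict (Metric.ball 0 R)] w t

/-- `S` is a precompact subset of `L²(0,T; L²_loc(ℝ³; ℝ³))`: every sequence in `S` has a
subsequence that converges in this (metrizable) space, i.e. in `L²(0,T; L²(B_R))` for all `R`. -/
def IsPrecompactL2L2loc (T : ℝ) (S : Set (ℝ → E3 → E3)) : Prop :=
  (∀ v ∈ S, MemL2L2loc T v) ∧
  ∀ v : ℕ → ℝ → E3 → E3, (∀ n, v n ∈ S) →
    ∃ (k : ℕ → ℕ) (w : ℝ → E3 → E3), StrictMono k ∧ MemL2L2loc T w ∧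
      ∀ R : ℝ, 0 < R →
        Tendsto (fun n => ∫⁻ t, (∫⁻ x in Metric.ball (0 : E3) R,
          ‖v (k n) t x - w t x‖ₑ ^ 2) ∂timeMeasure T) atTop (𝓝 0)

end AC

end

/-! Compactness is of Aubin–Lions type, carried out by hand. Testing the momentum equation with
solenoidal fields removes the pressure, the only unknown that is not uniformly controlled. What
remains are the energy bounds for `u` in `L^∞(0,T;L²)` and for its gradient in `L²(0,T;L²)`. They
are uniform because the initial energies are bounded for small `ϵ` (`exists_bounds_of_isSolution`).
A strong solution satisfies the energy identity: the convection term is orthogonal to `u`, and the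
term `½ εₜ p` is exactly what makes the pressure energy balance.

Space: `ℙ` commutes with translations, so `ℙu` inherits the `H¹` translation modulus of `u`.
Averaging over small cubes then approximates `(1+|x|²)⁻¹ ℙu` by a finite rank expression in moments
of `ℙu`, with an error controlled by the `H¹` norm; the weight makes finitely many cubes suffice. By
self-adjointness these are moments of `u` against projected fields, and solenoidal test functions
are dense in the range of `ℙ`. Hence moments of `u` against solenoidal test fields are enough
(`exists_solenoidal_finite_rank_approx`).

Time: each such moment is a primitive of the momentum flux, which is bounded by a multiple of the
gradient norm. The moments are therefore uniformly bounded and equicontinuous, and precompact in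
`L²(0,T)` (`exists_moment_bounds`, `totallyBounded_of_equicontinuous`). The weighted family thus
lies within any `η` of a compact set, so it is totally bounded (`totallyBounded_weight_lerayP`), and
on each ball the weight can be divided out.

Both density statements rest on one Liouville theorem: an `L²` function with `Δa = λa` weakly and `λ
≥ 0` vanishes (`eq_zero_of_weak_lap_eq`). The case `λ = 1` gives density of test functions in `H¹`,
which justifies the integrations by parts; `λ = 0` gives density of solenoidal test fields. -/

noncomputable section

namespace AC

/-! ### Partial derivatives and test functions on `ℝ³` -/

section Basic

variable {F : Type*} [NormedAddCommGroup F] [NormedSpace ℝ F]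

/-- The `j`-th partial derivative on `ℝ³`. -/
def pd (j : Fin 3) (φ : E3 → F) (x : E3) : F := fderiv ℝ φ x (e j)

/-- The Laplacian on `ℝ³`. -/
def lap (φ : E3 → F) (x : E3) : F := ∑ j, pd j (pd j φ) x

/-- Smooth functions with compact support. -/
structure IsTestFn (φ : E3 → F) : Prop where
  smooth : ContDiff ℝ ∞ φ
  cpt : HasCompactSupport φ

theorem contDiff_pd {φ : E3 → F} (h : ContDiff ℝ ∞ φ) (j : Fin 3) : ContDiff ℝ ∞ (pd j φ) :=
  (h.fderiv_right (m := ∞) (by simp)).clm_apply contDiff_const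

theorem IsTestFn.pd {φ : E3 → F} (h : IsTestFn φ) (j : Fin 3) : IsTestFn (pd j φ) :=
  ⟨contDiff_pd h.smooth j, h.cpt.fderiv_apply ℝ (e j)⟩

theorem IsTestFn.continuous {φ : E3 → F} (h : IsTestFn φ) : Continuous φ := h.smooth.continuous

theorem IsTestFn.differentiable {φ : E3 → F} (h : IsTestFn φ) : Differentiable ℝ φ :=
  h.smooth.differentiable (by simp)

theorem IsTestFn.memLp {φ : E3 → F} (h : IsTestFn φ) (p : ℝ≥0∞) :
    MemLp φ p (volume : Measure E3) :=
  h.continuous.memLp_of_hasCompactSupport h.cpt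

theorem IsTestFn.integrable {φ : E3 → F} (h : IsTestFn φ) : Integrable φ :=
  memLp_one_iff_integrable.1 (h.memLp 1)

theorem IsTestFn.add {φ ψ : E3 → F} (h : IsTestFn φ) (h' : IsTestFn ψ) :
    IsTestFn (fun x => φ x + ψ x) :=
  ⟨h.smooth.add h'.smooth, h.cpt.add h'.cpt⟩

theorem IsTestFn.zero : IsTestFn (fun _ : E3 => (0 : F)) :=
  ⟨contDiff_const, HasCompactSupport.zero⟩

theorem IsTestFn.sum {ι : Type*} (s : Finset ι) {φ : ι → E3 → F} (h : ∀ i, IsTestFn (φ i)) :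
    IsTestFn (fun x => ∑ i ∈ s, φ i x) := by
  classical
  induction s using Finset.induction_on with
  | empty => simpa using IsTestFn.zero
  | insert i s hi ih => simpa [Finset.sum_insert hi] using (h i).add ih

theorem IsTestFn.clm_comp {G : Type*} [NormedAddCommGroup G] [NormedSpace ℝ G]
    {φ : E3 → F} (h : IsTestFn φ) (L : F →L[ℝ] G) : IsTestFn (fun x => L (φ x)) :=
  ⟨L.contDiff.comp h.smooth, h.cpt.comp_left (map_zero L)⟩

theorem IsTestFn.const_smul {φ : E3 → F} (h : IsTestFn φ) (c : ℝ) :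
    IsTestFn (fun x => c • φ x) :=
  h.clm_comp (c • ContinuousLinearMap.id ℝ F)

theorem IsTestFn.neg {φ : E3 → F} (h : IsTestFn φ) : IsTestFn (fun x => - φ x) :=
  h.clm_comp (- ContinuousLinearMap.id ℝ F)

theorem IsTestFn.sub {φ ψ : E3 → F} (h : IsTestFn φ) (h' : IsTestFn ψ) :
    IsTestFn (fun x => φ x - ψ x) := by
  simpa [sub_eq_add_neg] using h.add h'.neg

theorem IsTestFn.smul {η : E3 → ℝ} {φ : E3 → F} (h' : IsTestFn η) (h : IsTestFn φ) :
    IsTestFn (fun x => η x • φ x) :=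
  ⟨h'.smooth.smul h.smooth, h.cpt.smul_left (f := η)⟩

theorem IsTestFn.comp_sub {φ : E3 → F} (h : IsTestFn φ) (a : E3) :
    IsTestFn (fun x => φ (x - a)) := by
  refine ⟨h.smooth.comp (contDiff_id.sub contDiff_const), ?_⟩
  exact h.cpt.comp_homeomorph (Homeomorph.subRight a)

theorem IsTestFn.comp_const_sub {φ : E3 → F} (h : IsTestFn φ) (a : E3) :
    IsTestFn (fun x => φ (a - x)) := by
  refine ⟨h.smooth.comp (contDiff_const.sub contDiff_id), ?_⟩
  exact h.cpt.comp_homeomorph (Homeomorph.subLeft a)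

theorem pd_comp_const_sub {φ : E3 → F} (hφ : Differentiable ℝ φ) (a : E3) (j : Fin 3) :
    pd j (fun x => φ (a - x)) = fun x => - pd j φ (a - x) := by
  funext x
  simp only [pd]
  have h : HasFDerivAt (fun x : E3 => a - x) (-ContinuousLinearMap.id ℝ E3) x :=
    (hasFDerivAt_id x).const_sub a
  have hd : HasFDerivAt φ (fderiv ℝ φ (a - x)) (a - x) := (hφ (a - x)).hasFDerivAt
  rw [show (fun x => φ (a - x)) = φ ∘ fun x => a - x from rfl, (hd.comp x h).fderiv]
  simp

theorem pd_neg (φ : E3 → F) (j : Fin 3) : pd j (fun x => - φ x) = fun x => - pd j φ x := by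
  funext x
  simp [pd, fderiv_fun_neg]

theorem lap_comp_const_sub {φ : E3 → F} (hφ : IsTestFn φ) (a x : E3) :
    lap (fun x => φ (a - x)) x = lap φ (a - x) := by
  simp only [lap]
  refine Finset.sum_congr rfl fun j _ => ?_
  rw [pd_comp_const_sub hφ.differentiable, pd_neg, pd_comp_const_sub (hφ.pd j).differentiable]
  simp

end Basic

/-! ### Uniqueness for `Δ a = λ a` in `L²(ℝ³)` -/

/-- If the second derivative were positive, the point would also be a local minimum; the function
would then be locally constant, with vanishing second derivative. -/
theorem deriv_deriv_nonpos_of_isLocalMax {g : ℝ → ℝ} {t : ℝ} (h : IsLocalMax g t)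
    (hc : ContinuousAt g t) : deriv (deriv g) t ≤ 0 := by
  by_contra hpos
  push Not at hpos
  have hmin := isLocalMin_of_deriv_deriv_pos hpos h.deriv_eq_zero hc
  have hconst : g =ᶠ[𝓝 t] fun _ => g t := by
    filter_upwards [h, hmin] with s h1 h2 using le_antisymm h1 h2
  have h1 : deriv g =ᶠ[𝓝 t] fun _ => 0 := by
    have := hconst.deriv
    simpa using this
  have h2 := h1.deriv_eq
  simp at h2
  linarith

theorem hasDerivAt_line {F : Type*} [NormedAddCommGroup F] [NormedSpace ℝ F]
    {f : E3 → F} (hf : Differentiable ℝ f) (x : E3) (j : Fin 3) (t : ℝ) :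
    HasDerivAt (fun s : ℝ => f (x + s • e j)) (pd j f (x + t • e j)) t := by
  have h1 : HasDerivAt (fun s : ℝ => x + s • e j) (e j) t := by
    simpa using ((hasDerivAt_id t).smul_const (e j)).const_add x
  exact (hf (x + t • e j)).hasFDerivAt.comp_hasDerivAt t h1

theorem e_norm (j : Fin 3) : ‖e j‖ = 1 := by simp [e]

theorem inner_e (x : E3) (j : Fin 3) : inner ℝ x (e j) = x j := by
  simp [e, EuclideanSpace.inner_single_right]

/-- The maximum principle on `ℝ³` for functions vanishing at infinity. -/
theorem nonpos_of_lap_eq {F : E3 → ℝ} (hF : ContDiff ℝ ∞ F) {lam : ℝ} (hl : 0 ≤ lam)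
    (hlap : ∀ x, lap F x = lam * F x) (hlim : Tendsto F (cocompact E3) (𝓝 0)) (y : E3) :
    F y ≤ 0 := by
  by_contra hpos
  push Not at hpos
  set s := F y / 2 with hs
  have hs0 : 0 < s := by positivity
  have hev : ∀ᶠ x in cocompact E3, F x < s := hlim.eventually_lt_const hs0
  obtain ⟨K, hK, hKs⟩ := mem_cocompact.1 hev
  obtain ⟨R₀, hR₀⟩ := hK.isBounded.subset_closedBall y
  set R := max R₀ 0 + 1 with hR
  have hRpos : 0 < R := by positivity
  have hout : ∀ x, R ≤ ‖x - y‖ → F x < s := by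
    intro x hx
    apply hKs
    intro hxK
    have := hR₀ hxK
    rw [Metric.mem_closedBall, dist_eq_norm] at this
    have := le_max_left R₀ 0
    linarith
  -- The quadratic perturbation `η|x - y|²` turns `∂_j² F ≤ 0` at the maximum into the strict `∂_j²
  -- F ≤ -2η`, which is needed when `lam = 0`. It is at most `s/2` on the ball, so the maximum of
  -- `G`, at least `G y = 2s`, cannot lie on the sphere, where `F < s`.
  set η := s / (2 * R ^ 2) with hη
  have hη0 : 0 < η := by positivity
  have hηR : η * R ^ 2 = s / 2 := by rw [hη]; field_simp
  set G : E3 → ℝ := fun x => F x + η * ‖x - y‖ ^ 2 with hG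
  have hGc : Continuous G := by
    have := hF.continuous
    fun_prop
  obtain ⟨x₀, hx₀, hmax⟩ := (isCompact_closedBall y R).exists_isMaxOn
    ⟨y, Metric.mem_closedBall_self hRpos.le⟩ hGc.continuousOn
  have hGy : 2 * s ≤ G x₀ := by
    have := hmax (Metric.mem_closedBall_self hRpos.le)
    simp only [hG, mem_ofPred_eq, sub_self, norm_zero] at this
    simp only [hG]
    linarith
  have hle : ‖x₀ - y‖ ≤ R := by rwa [Metric.mem_closedBall, dist_eq_norm] at hx₀
  have hsq : η * ‖x₀ - y‖ ^ 2 ≤ s / 2 := by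
    rw [← hηR]; gcongr
  have hlt : ‖x₀ - y‖ < R := by
    by_contra h
    push Not at h
    have := hout x₀ h
    simp only [hG] at hGy
    linarith
  have hFx : 0 < F x₀ := by simp only [hG] at hGy; linarith
  have hloc : IsLocalMax G x₀ :=
    hmax.isLocalMax (mem_of_superset (Metric.ball_mem_nhds _ (by linarith : 0 < R - ‖x₀ - y‖))
      (by
        intro z hz
        rw [Metric.mem_ball, dist_eq_norm] at hz
        rw [Metric.mem_closedBall, dist_eq_norm]
        have : z - y = (z - x₀) + (x₀ - y) := by abel
        rw [this]
        have := norm_add_le (z - x₀) (x₀ - y)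
        linarith))
  have hFd : Differentiable ℝ F := hF.differentiable (by simp)
  have key : ∀ j, pd j (pd j F) x₀ + 2 * η ≤ 0 := by
    intro j
    set g : ℝ → ℝ := fun t => G (x₀ + t • e j) with hg
    have hnorm : ∀ t : ℝ, ‖x₀ + t • e j - y‖ ^ 2
        = ‖x₀ - y‖ ^ 2 + 2 * t * (x₀ - y) j + t ^ 2 := by
      intro t
      have : x₀ + t • e j - y = (x₀ - y) + t • e j := by abel
      rw [this, norm_add_sq_real, inner_smul_right, inner_e, norm_smul, e_norm]
      simp
      ring
    have hg1 : ∀ t, HasDerivAt g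
        (pd j F (x₀ + t • e j) + η * (2 * (x₀ - y) j + 2 * t)) t := by
      intro t
      have h2 : HasDerivAt (fun t : ℝ => η * (‖x₀ - y‖ ^ 2 + 2 * t * (x₀ - y) j + t ^ 2))
          (η * (2 * (x₀ - y) j + 2 * t)) t := by
        have h3 : HasDerivAt (fun t : ℝ => ‖x₀ - y‖ ^ 2 + 2 * t * (x₀ - y) j + t ^ 2)
            (2 * (x₀ - y) j + 2 * t) t := by
          have := ((((hasDerivAt_id t).const_mul 2).mul_const ((x₀ - y) j)).const_add
            (‖x₀ - y‖ ^ 2)).fun_add (hasDerivAt_pow 2 t)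
          simpa using this
        exact h3.const_mul η
      have := (hasDerivAt_line hFd x₀ j t).add h2
      refine this.congr_of_eventuallyEq (Eventually.of_forall fun r => ?_)
      simp only [hg, hG, Pi.add_apply]
      rw [hnorm r]
    have hg2 : deriv g = fun t => pd j F (x₀ + t • e j) + η * (2 * (x₀ - y) j + 2 * t) :=
      funext fun t => (hg1 t).deriv
    have hg3 : HasDerivAt (deriv g) (pd j (pd j F) x₀ + 2 * η) 0 := by
      rw [hg2]
      have hd : Differentiable ℝ (pd j F) := (contDiff_pd hF j).differentiable (by simp)
      have h1 := hasDerivAt_line hd x₀ j 0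
      have h2 : HasDerivAt (fun t : ℝ => η * (2 * (x₀ - y) j + 2 * t)) (2 * η) 0 := by
        have := (((hasDerivAt_id (0 : ℝ)).const_mul 2).const_add (2 * (x₀ - y) j)).const_mul η
        simpa [mul_comm] using this
      simpa using h1.fun_add h2
    have hlg : IsLocalMax g 0 := by
      have hcont : ContinuousAt (fun t : ℝ => x₀ + t • e j) 0 := by fun_prop
      have : Tendsto (fun t : ℝ => x₀ + t • e j) (𝓝 0) (𝓝 x₀) := by
        simpa [ContinuousAt] using hcont
      have := this.eventually hloc
      filter_upwards [this] with t ht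
      simpa [hg] using ht
    have := deriv_deriv_nonpos_of_isLocalMax hlg (hg1 0).continuousAt
    rwa [hg3.deriv] at this
  have hsum := Finset.sum_le_sum fun j (_ : j ∈ Finset.univ) => key j
  rw [Finset.sum_add_distrib] at hsum
  have h1 : lap F x₀ = ∑ j, pd j (pd j F) x₀ := rfl
  rw [← h1, hlap] at hsum
  simp at hsum
  have : 0 ≤ lam * F x₀ := by positivity
  linarith

/-! ### Mollification of square integrable functions. -/

section Convolution

open scoped Convolution

/-- Convolution of a square integrable function with a test function. -/
def conv (a φ : E3 → ℝ) : E3 → ℝ := a ⋆[ContinuousLinearMap.mul ℝ ℝ, volume] φ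

theorem conv_apply (a φ : E3 → ℝ) (x : E3) : conv a φ x = ∫ y, a y * φ (x - y) := rfl

theorem contDiff_conv {a φ : E3 → ℝ} (ha : LocallyIntegrable a) (hφ : IsTestFn φ) :
    ContDiff ℝ ∞ (conv a φ) :=
  hφ.cpt.contDiff_convolution_right _ ha hφ.smooth

theorem pd_conv {a φ : E3 → ℝ} (ha : LocallyIntegrable a) (hφ : IsTestFn φ) (j : Fin 3) :
    pd j (conv a φ) = conv a (pd j φ) := by
  funext x
  have h := hφ.cpt.hasFDerivAt_convolution_right (ContinuousLinearMap.mul ℝ ℝ) ha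
    (hφ.smooth.of_le (by norm_cast)) x
  rw [pd, conv, h.fderiv, convolution_precompR_apply _ ha (hφ.cpt.fderiv ℝ)
    (hφ.smooth.continuous_fderiv (by simp))]
  rfl

theorem lap_conv {a φ : E3 → ℝ} (ha : LocallyIntegrable a) (hφ : IsTestFn φ) (x : E3) :
    lap (conv a φ) x = ∫ y, a y * lap φ (x - y) := by
  have : lap (conv a φ) x = ∑ j, conv a (pd j (pd j φ)) x := by
    simp only [lap]
    refine Finset.sum_congr rfl fun j _ => ?_
    rw [pd_conv ha hφ, pd_conv ha (hφ.pd j)]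
  rw [this]
  simp only [conv_apply, lap, Finset.mul_sum]
  rw [integral_finsetSum]
  intro j _
  have h := (((hφ.pd j).pd j).cpt.convolutionExists_right (ContinuousLinearMap.mul ℝ ℝ) ha
    ((hφ.pd j).pd j).continuous) x
  exact h

theorem abs_integral_mul_le {f g : E3 → ℝ} (hf : MemLp f 2 (volume : Measure E3))
    (hg : MemLp g 2 (volume : Measure E3)) :
    |∫ x, f x * g x| ≤ (eLpNorm f 2 volume).toReal * (eLpNorm g 2 volume).toReal := by
  have h := abs_real_inner_le_norm (hf.toLp f) (hg.toLp g)
  rw [L2.inner_def, Lp.norm_toLp, Lp.norm_toLp] at h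
  convert h using 2
  refine integral_congr_ae ?_
  filter_upwards [hf.coeFn_toLp, hg.coeFn_toLp] with x h1 h2
  rw [h1, h2]; simp [mul_comm]

/-- Approximate `a` in `L²` by a test function `b`. The convolution `b ⋆ φ` has compact support, and
by Cauchy–Schwarz `(a - b) ⋆ φ` is small uniformly in space. -/
theorem tendsto_conv_cocompact {a φ : E3 → ℝ} (ha : MemLp a 2 (volume : Measure E3))
    (hφ : IsTestFn φ) : Tendsto (conv a φ) (cocompact E3) (𝓝 0) := by
  rw [Metric.tendsto_nhds]
  intro r hr
  set N := (eLpNorm φ 2 (volume : Measure E3)).toReal with hN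
  have hN0 : 0 ≤ N := ENNReal.toReal_nonneg
  have hδ : 0 < r / (N + 1) := by positivity
  obtain ⟨b, hbc, hbs, hb⟩ := ha.exist_eLpNorm_sub_le (by norm_num) (by norm_num) hδ
  have hbt : IsTestFn b := ⟨hbs, hbc⟩
  have hcpt : HasCompactSupport (conv b φ) :=
    HasCompactSupport.convolution _ hbc hφ.cpt
  have hev : ∀ᶠ x in cocompact E3, conv b φ x = 0 := by
    refine mem_cocompact.2 ⟨_, hcpt, fun x hx => ?_⟩
    exact image_eq_zero_of_notMem_tsupport hx
  filter_upwards [hev] with x hx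
  have hφx : IsTestFn (fun y => φ (x - y)) := hφ.comp_const_sub x
  have hsub : conv a φ x = ∫ y, (a - b) y * φ (x - y) := by
    have h1 : conv a φ x - conv b φ x = ∫ y, (a - b) y * φ (x - y) := by
      have h := integral_sub (ha.integrable_mul (hφx.memLp 2))
        ((hbt.memLp 2).integrable_mul (hφx.memLp 2))
      simp only [Pi.mul_apply] at h
      rw [conv_apply, conv_apply, ← h]
      simp [sub_mul]
    rw [← h1, hx, sub_zero]
  have h2 := abs_integral_mul_le (ha.sub (hbt.memLp 2)) (hφx.memLp 2)
  have h3 : eLpNorm (fun y => φ (x - y)) 2 (volume : Measure E3) = eLpNorm φ 2 volume :=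
    eLpNorm_comp_measurePreserving hφ.continuous.aestronglyMeasurable
      (Measure.measurePreserving_sub_left volume x)
  rw [h3, ← hsub, ← hN] at h2
  have h4 : (eLpNorm (a - b) 2 (volume : Measure E3)).toReal ≤ r / (N + 1) :=
    ENNReal.toReal_le_of_le_ofReal hδ.le hb
  rw [Real.dist_eq, sub_zero]
  calc |conv a φ x| ≤ r / (N + 1) * N := h2.trans (by gcongr)
    _ < r := by
      rw [div_mul_eq_mul_div, div_lt_iff₀ (by positivity)]
      nlinarith

end Convolution

/-- Each mollification `a ⋆ φ` is smooth, solves the same equation and vanishes at infinity, so the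
maximum principle gives `a ⋆ φ ≤ 0`. Replacing `φ` by `-φ` gives equality, and the value at the
origin is the pairing of `a` with the reflected test function. -/
theorem eq_zero_of_weak_lap_eq {a : E3 → ℝ} (ha : MemLp a 2 (volume : Measure E3)) {lam : ℝ}
    (hl : 0 ≤ lam)
    (h : ∀ φ : E3 → ℝ, IsTestFn φ → ∫ x, a x * lap φ x = lam * ∫ x, a x * φ x) :
    a =ᵐ[volume] 0 := by
  have hloc : LocallyIntegrable a := ha.locallyIntegrable (by norm_num)
  have key : ∀ φ, IsTestFn φ → conv a φ 0 ≤ 0 := by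
    intro φ hφ
    refine nonpos_of_lap_eq (contDiff_conv hloc hφ) hl (fun x => ?_)
      (tendsto_conv_cocompact ha hφ) 0
    rw [lap_conv hloc hφ, conv_apply]
    simp_rw [← lap_comp_const_sub hφ]
    exact h _ (hφ.comp_const_sub x)
  refine ae_eq_zero_of_integral_contDiff_smul_eq_zero hloc fun g hg hgc => ?_
  have hψ : IsTestFn (fun x => g (0 - x)) := (IsTestFn.mk hg hgc).comp_const_sub 0
  have h1 := key _ hψ
  have h2 := key _ hψ.neg
  simp only [conv_apply, zero_sub, neg_neg, mul_neg, integral_neg] at h1 h2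
  simp only [smul_eq_mul, mul_comm (g _)]
  linarith

/-! ### Density of test functions in `H¹(ℝ³)` -/

section TestLp

variable {F : Type*} [NormedAddCommGroup F]

/-- The class in `L²` of a test function. -/
def testLp [NormedSpace ℝ F] {φ : E3 → F} (h : IsTestFn φ) : Lp F 2 (volume : Measure E3) :=
  (h.memLp 2).toLp φ

theorem testLp_coe [NormedSpace ℝ F] {φ : E3 → F} (h : IsTestFn φ) : testLp h =ᵐ[volume] φ :=
  (h.memLp 2).coeFn_toLp

theorem testLp_congr [NormedSpace ℝ F] {φ ψ : E3 → F} (h : IsTestFn φ) (h' : IsTestFn ψ)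
    (H : ∀ x, φ x = ψ x) : testLp h = testLp h' :=
  MemLp.toLp_congr _ _ (Eventually.of_forall H)

theorem testLp_add [NormedSpace ℝ F] {φ ψ : E3 → F} (h : IsTestFn φ) (h' : IsTestFn ψ) :
    testLp (h.add h') = testLp h + testLp h' :=
  MemLp.toLp_add (h.memLp 2) (h'.memLp 2)

theorem testLp_smul [NormedSpace ℝ F] {φ : E3 → F} (h : IsTestFn φ) (c : ℝ) :
    testLp (h.const_smul c) = c • testLp h :=
  MemLp.toLp_const_smul c (h.memLp 2)

theorem testLp_zero [NormedSpace ℝ F] : testLp (F := F) IsTestFn.zero = 0 :=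
  MemLp.toLp_zero _

theorem pd_add [NormedSpace ℝ F] {φ ψ : E3 → F} (h : Differentiable ℝ φ)
    (h' : Differentiable ℝ ψ) (j : Fin 3) (x : E3) :
    pd j (fun x => φ x + ψ x) x = pd j φ x + pd j ψ x := by
  simp only [pd]
  rw [fderiv_fun_add (h x) (h' x)]
  rfl

theorem pd_sub [NormedSpace ℝ F] {φ ψ : E3 → F} (h : Differentiable ℝ φ)
    (h' : Differentiable ℝ ψ) (j : Fin 3) (x : E3) :
    pd j (fun x => φ x - ψ x) x = pd j φ x - pd j ψ x := by
  simp only [pd]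
  rw [fderiv_fun_sub (h x) (h' x)]
  rfl

theorem pd_const_smul [NormedSpace ℝ F] {φ : E3 → F} (h : Differentiable ℝ φ) (c : ℝ)
    (j : Fin 3) (x : E3) : pd j (fun x => c • φ x) x = c • pd j φ x := by
  simp only [pd]
  rw [fderiv_fun_const_smul (h x)]
  rfl

theorem inner_testLp [InnerProductSpace ℝ F] {φ : E3 → F} (h : IsTestFn φ)
    (f : Lp F 2 (volume : Measure E3)) :
    inner ℝ f (testLp h) = ∫ x, inner ℝ (f x) (φ x) := by
  rw [L2.inner_def]
  refine integral_congr_ae ?_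
  filter_upwards [testLp_coe h] with x hx
  rw [hx]

theorem inner_testLp_real {φ : E3 → ℝ} (h : IsTestFn φ) (f : L2S) :
    inner ℝ f (testLp h) = ∫ x, φ x * f x := by
  rw [inner_testLp]
  simp

end TestLp

/-- In this form a weak derivative is a family of closed linear conditions on the pair `(f, g)` in
`L²`. -/
theorem isWeakPartial_iff {j : Fin 3} {f g : L2S} :
    IsWeakPartial j f g ↔ ∀ (φ : E3 → ℝ) (h : IsTestFn φ),
      inner ℝ f (testLp (h.pd j)) = - inner ℝ g (testLp h) := by
  constructor
  · intro H φ h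
    rw [inner_testLp_real, inner_testLp_real]
    exact H φ h.smooth h.cpt
  · intro H φ h h'
    have := H φ ⟨h, h'⟩
    rw [inner_testLp_real, inner_testLp_real] at this
    exact this

theorem integral_pd_mul {φ ψ : E3 → ℝ} (hφ : IsTestFn φ) (hψ : IsTestFn ψ) (j : Fin 3) :
    ∫ x, pd j φ x * ψ x = - ∫ x, φ x * pd j ψ x := by
  have h := integral_mul_fderiv_eq_neg_fderiv_mul_of_integrable (μ := (volume : Measure E3))
    (f := φ) (g := ψ) (v := e j)
    (((hφ.pd j).memLp 2).integrable_mul (hψ.memLp 2))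
    ((hφ.memLp 2).integrable_mul ((hψ.pd j).memLp 2))
    ((hφ.memLp 2).integrable_mul (hψ.memLp 2))
    (fun x _ => hφ.differentiable x) (fun x _ => hψ.differentiable x)
  simp only [pd]
  rw [h, neg_neg]

theorem isWeakPartial_testLp {φ : E3 → ℝ} (h : IsTestFn φ) (j : Fin 3) :
    IsWeakPartial j (testLp h) (testLp (h.pd j)) := by
  intro ψ hψ hc
  have hψ' : IsTestFn ψ := ⟨hψ, hc⟩
  have h1 : ∫ x, fderiv ℝ ψ x (e j) • testLp h x = ∫ x, pd j ψ x * φ x := by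
    refine integral_congr_ae ?_
    filter_upwards [testLp_coe h] with x hx
    rw [hx]; rfl
  have h2 : ∫ x, ψ x • testLp (h.pd j) x = ∫ x, ψ x * pd j φ x := by
    refine integral_congr_ae ?_
    filter_upwards [testLp_coe (h.pd j)] with x hx
    rw [hx]; rfl
  rw [h1, h2, integral_pd_mul hψ' h]

/-- The Hilbert space of candidates `(f, ∂₁f, ∂₂f, ∂₃f)`. -/
abbrev JetSpace : Type := PiLp 2 (fun _ : Option (Fin 3) => L2S)

/-- The pair of a function and its gradient, as an element of the jet space. -/
def mkJet (f : L2S) (g : Fin 3 → L2S) : JetSpace :=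
  WithLp.toLp 2 (fun o => o.elim f g)

theorem inner_mkJet (w : JetSpace) (f : L2S) (g : Fin 3 → L2S) :
    inner ℝ w (mkJet f g) = inner ℝ (w none) f + ∑ j, inner ℝ (w (some j)) (g j) := by
  rw [PiLp.inner_apply, Fintype.sum_option]
  rfl

theorem mkJet_add (f f' : L2S) (g g' : Fin 3 → L2S) :
    mkJet f g + mkJet f' g' = mkJet (f + f') (fun j => g j + g' j) := by
  refine PiLp.ext fun o => ?_
  cases o <;> rfl

theorem mkJet_smul (c : ℝ) (f : L2S) (g : Fin 3 → L2S) :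
    c • mkJet f g = mkJet (c • f) (fun j => c • g j) := by
  refine PiLp.ext fun o => ?_
  cases o <;> rfl

theorem mkJet_zero : mkJet 0 (fun _ => 0) = 0 := by
  refine PiLp.ext fun o => ?_
  cases o <;> rfl

/-- The jets of test functions. -/
def testJets : Submodule ℝ JetSpace where
  carrier := {w | ∃ (φ : E3 → ℝ) (h : IsTestFn φ),
    w = mkJet (testLp h) (fun j => testLp (h.pd j))}
  add_mem' := by
    rintro _ _ ⟨φ, h, rfl⟩ ⟨ψ, h', rfl⟩
    refine ⟨_, h.add h', ?_⟩
    rw [testLp_add]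
    have : ∀ j, testLp ((h.add h').pd j) = testLp (h.pd j) + testLp (h'.pd j) := fun j => by
      rw [← testLp_add]
      exact testLp_congr _ _ (pd_add h.differentiable h'.differentiable j)
    simp_rw [this]
    exact mkJet_add _ _ _ _
  zero_mem' := by
    refine ⟨_, IsTestFn.zero, ?_⟩
    have : ∀ j, testLp ((IsTestFn.zero (F := ℝ)).pd j) = 0 := fun j => by
      rw [← testLp_zero]
      exact testLp_congr _ _ fun x => by simp [pd]
    simp_rw [this, testLp_zero]
    exact mkJet_zero.symm
  smul_mem' := by
    rintro c _ ⟨φ, h, rfl⟩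
    refine ⟨_, h.const_smul c, ?_⟩
    rw [testLp_smul]
    have : ∀ j, testLp ((h.const_smul c).pd j) = c • testLp (h.pd j) := fun j => by
      rw [← testLp_smul]
      exact testLp_congr _ _ (pd_const_smul h.differentiable c j)
    simp_rw [this]
    exact mkJet_smul _ _ _

theorem isWeakPartial_of_mem_closure {w : JetSpace} (hw : w ∈ testJets.topologicalClosure)
    (j : Fin 3) : IsWeakPartial j (w none) (w (some j)) := by
  rw [isWeakPartial_iff]
  intro φ h
  have hcl : IsClosed {w : JetSpace |
      inner ℝ (w none) (testLp (h.pd j)) = - inner ℝ (w (some j)) (testLp h)} := by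
    apply isClosed_eq
    · exact (PiLp.continuous_apply 2 _ none).inner continuous_const
    · exact ((PiLp.continuous_apply 2 _ (some j)).inner continuous_const).neg
  have hsub : (testJets : Set JetSpace) ⊆ {w : JetSpace |
      inner ℝ (w none) (testLp (h.pd j)) = - inner ℝ (w (some j)) (testLp h)} := by
    rintro _ ⟨ψ, hψ, rfl⟩
    exact isWeakPartial_iff.1 (isWeakPartial_testLp hψ j) φ h
  exact closure_minimal hsub hcl hw

theorem ae_eq_zero_of_inner_testLp {a : L2S}
    (h : ∀ (φ : E3 → ℝ) (hφ : IsTestFn φ), inner ℝ a (testLp hφ) = 0) : a = 0 := by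
  rw [Lp.eq_zero_iff_ae_eq_zero]
  refine ae_eq_zero_of_integral_contDiff_smul_eq_zero
    ((Lp.memLp a).locallyIntegrable (by norm_num)) fun g hg hgc => ?_
  have := h g ⟨hg, hgc⟩
  rwa [inner_testLp_real] at this

/-- Project the jet orthogonally onto the closure of the test jets. The residual is again a jet of
weak derivatives, and orthogonality to test jets says that its function component satisfies `a = Δa`
weakly. So `a = 0` by the Liouville theorem with `λ = 1`, and the weak derivatives of `0` vanish
too. -/
theorem mkJet_mem_closure {f : L2S} {g : Fin 3 → L2S} (h : ∀ j, IsWeakPartial j f (g j)) :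
    mkJet f g ∈ testJets.topologicalClosure := by
  set G := testJets.topologicalClosure with hG
  have : CompleteSpace G := (Submodule.isClosed_topologicalClosure _).completeSpace_coe
  set w := mkJet f g with hw
  set v := w - G.starProjection w with hv
  have hperp : ∀ z ∈ G, inner ℝ v z = 0 := fun z hz =>
    Submodule.starProjection_inner_eq_zero w z hz
  have hweak : ∀ j (φ : E3 → ℝ) (hφ : IsTestFn φ),
      inner ℝ (v none) (testLp (hφ.pd j)) = - inner ℝ (v (some j)) (testLp hφ) := by
    intro j φ hφ
    have h1 := isWeakPartial_iff.1 (h j) φ hφ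
    have h2 := isWeakPartial_iff.1 (isWeakPartial_of_mem_closure
      (Submodule.starProjection_apply_mem G w) j) φ hφ
    have e1 : v none = f - (G.starProjection w) none := rfl
    have e2 : v (some j) = g j - (G.starProjection w) (some j) := rfl
    rw [e1, e2, inner_sub_left, inner_sub_left, h1, h2]
    ring
  have horth : ∀ (φ : E3 → ℝ) (hφ : IsTestFn φ),
      inner ℝ (v none) (testLp hφ)
        = ∑ j, inner ℝ (v none) (testLp ((hφ.pd j).pd j)) := by
    intro φ hφ
    have h0 := hperp _ (Submodule.le_topologicalClosure _
      (show mkJet (testLp hφ) (fun j => testLp (hφ.pd j)) ∈ testJets from ⟨φ, hφ, rfl⟩))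
    rw [inner_mkJet] at h0
    simp_rw [hweak _ _ (hφ.pd _)]
    rw [Finset.sum_neg_distrib]
    linarith
  have hzero : v none = 0 := by
    rw [Lp.eq_zero_iff_ae_eq_zero]
    refine eq_zero_of_weak_lap_eq (lam := 1) (Lp.memLp (v none)) zero_le_one fun φ hφ => ?_
    have h0 := horth φ hφ
    simp_rw [inner_testLp_real] at h0
    rw [one_mul]
    simp only [lap, Finset.mul_sum]
    rw [integral_finsetSum]
    · simp_rw [mul_comm ((v none : L2S) _)]
      exact h0.symm
    · intro j _
      exact (Lp.memLp (v none)).integrable_mul (((hφ.pd j).pd j).memLp 2)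
  have hv0 : v = 0 := by
    ext1 o
    cases o with
    | none => exact hzero
    | some j =>
      refine ae_eq_zero_of_inner_testLp fun φ hφ => ?_
      have := hweak j φ hφ
      rw [hzero, inner_zero_left] at this
      linarith
  have : w = G.starProjection w := sub_eq_zero.1 hv0
  rw [this]
  exact Submodule.starProjection_apply_mem G w

/-- Test functions are dense in `H¹(ℝ³)`. -/
theorem exists_test_tendsto {f : L2S} {g : Fin 3 → L2S} (h : ∀ j, IsWeakPartial j f (g j)) :
    ∃ (φ : ℕ → E3 → ℝ) (hφ : ∀ n, IsTestFn (φ n)),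
      Tendsto (fun n => testLp (hφ n)) atTop (𝓝 f) ∧
      ∀ j, Tendsto (fun n => testLp ((hφ n).pd j)) atTop (𝓝 (g j)) := by
  obtain ⟨w, hw, hlim⟩ := mem_closure_iff_seq_limit.1 (mkJet_mem_closure h)
  choose φ hφ hw using hw
  refine ⟨φ, hφ, ?_, fun j => ?_⟩
  · have := ((PiLp.continuous_apply 2 (fun _ : Option (Fin 3) => L2S) none).tendsto _).comp hlim
    refine (this.congr fun n => ?_)
    simp only [Function.comp, hw n]; rfl
  · have := ((PiLp.continuous_apply 2 (fun _ : Option (Fin 3) => L2S)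
      (some j)).tendsto _).comp hlim
    refine (this.congr fun n => ?_)
    simp only [Function.comp, hw n]; rfl

/-- Integration by parts in `H¹(ℝ³)`. -/
theorem inner_weakPartial {f f' : L2S} {g : L2S} {g' : Fin 3 → L2S} {j : Fin 3}
    (hf : IsWeakPartial j f f') (hg : ∀ i, IsWeakPartial i g (g' i)) :
    inner ℝ f (g' j) = - inner ℝ f' g := by
  obtain ⟨φ, hφ, h1, h2⟩ := exists_test_tendsto hg
  have e1 := (tendsto_const_nhds (x := f)).inner (𝕜 := ℝ) (h2 j)
  have e2 := ((tendsto_const_nhds (x := f')).inner (𝕜 := ℝ) h1).neg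
  refine tendsto_nhds_unique e1 (e2.congr fun n => ?_)
  exact (isWeakPartial_iff.1 hf _ (hφ n)).symm

/-! ### The embedding `H¹ ⊂ L⁴` and the convection term -/

instance : Fact ((1 : ℝ≥0∞) ≤ 4) := ⟨by norm_num⟩

instance : ENNReal.HolderTriple 4 4 2 := ⟨by
  rw [← two_mul, show (4 : ℝ≥0∞) = 2 * 2 by norm_num,
    ENNReal.mul_inv (by norm_num) (by norm_num), ← mul_assoc,
    ENNReal.mul_inv_cancel (by norm_num) (by norm_num), one_mul]⟩

/-- The class in `L⁴` of a test function. -/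
def testLp4 {φ : E3 → ℝ} (h : IsTestFn φ) : Lp ℝ 4 (volume : Measure E3) :=
  (h.memLp 4).toLp φ

theorem testLp4_coe {φ : E3 → ℝ} (h : IsTestFn φ) : testLp4 h =ᵐ[volume] φ :=
  (h.memLp 4).coeFn_toLp

theorem norm_testLp_eq {φ : E3 → ℝ} (h : IsTestFn φ) :
    ENNReal.ofReal ‖testLp h‖ = eLpNorm φ 2 volume := by
  rw [testLp, Lp.norm_toLp, ENNReal.ofReal_toReal (h.memLp 2).eLpNorm_ne_top]

theorem norm_testLp4_eq {φ : E3 → ℝ} (h : IsTestFn φ) :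
    ENNReal.ofReal ‖testLp4 h‖ = eLpNorm φ 4 volume := by
  rw [testLp4, Lp.norm_toLp, ENNReal.ofReal_toReal (h.memLp 4).eLpNorm_ne_top]

theorem vec_eq_sum (v : E3) : v = ∑ j, v j • e j := by
  have := (EuclideanSpace.basisFun (Fin 3) ℝ).sum_repr v
  simpa [e] using this.symm

theorem norm_fderiv_le {F : Type*} [NormedAddCommGroup F] [NormedSpace ℝ F] (φ : E3 → F)
    (x : E3) : ‖fderiv ℝ φ x‖ ≤ ∑ j, ‖pd j φ x‖ := by
  refine ContinuousLinearMap.opNorm_le_bound _ (by positivity) fun v => ?_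
  conv_lhs => rw [vec_eq_sum v]
  rw [map_sum, Finset.sum_mul]
  refine (norm_sum_le _ _).trans (Finset.sum_le_sum fun j _ => ?_)
  rw [map_smul, norm_smul, mul_comm]
  gcongr
  · exact le_rfl
  · exact PiLp.norm_apply_le v j

/-- Pointwise `|φ|⁴ ≤ |φ|² + |φ|⁶`, and the sixth power is controlled by the Sobolev inequality `Ḣ¹
⊂ L⁶`. The bound is not homogeneous, but it suffices to turn Cauchy sequences in `H¹` into Cauchy
sequences in `L⁴`. -/
theorem exists_testLp4_bound : ∃ C : ℝ, 0 ≤ C ∧ ∀ (φ : E3 → ℝ) (h : IsTestFn φ),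
    ‖testLp4 h‖ ^ 4 ≤ ‖testLp h‖ ^ 2 + (C * ∑ j, ‖testLp (h.pd j)‖) ^ 6 := by
  set C := SNormLESNormFDerivOfEqConst ℝ (volume : Measure E3) ((2 : NNReal) : ℝ) with hC
  refine ⟨C, C.2, fun φ h => ?_⟩
  have hS : 0 ≤ ∑ j, ‖testLp (h.pd j)‖ := by positivity
  have hC0 : (0 : ℝ) ≤ (C : ℝ) := C.2
  have h1 : eLpNorm φ 6 volume ≤ C * eLpNorm (fderiv ℝ φ) 2 volume :=
    eLpNorm_le_eLpNorm_fderiv_of_eq (μ := (volume : Measure E3)) (p := 2) (p' := 6)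
      (h.smooth.of_le (by norm_cast)) h.cpt (by norm_num) (by simp) (by simp; norm_num)
  have h2 : eLpNorm (fderiv ℝ φ) 2 volume ≤ ENNReal.ofReal (∑ j, ‖testLp (h.pd j)‖) := by
    calc eLpNorm (fderiv ℝ φ) 2 volume ≤ eLpNorm (fun x => ∑ j, ‖pd j φ x‖) 2 volume := by
          refine eLpNorm_mono fun x => (norm_fderiv_le φ x).trans (le_abs_self _)
      _ ≤ ∑ j, eLpNorm (fun x => ‖pd j φ x‖) 2 volume := by
          have := eLpNorm_sum_le (μ := (volume : Measure E3)) (p := 2) (s := Finset.univ)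
            (f := fun j x => ‖pd j φ x‖)
            (fun j _ => ((h.pd j).continuous.norm).aestronglyMeasurable) (by norm_num)
          convert this using 2
          ext x; simp
      _ = ENNReal.ofReal (∑ j, ‖testLp (h.pd j)‖) := by
          rw [ENNReal.ofReal_sum_of_nonneg (fun _ _ => norm_nonneg _)]
          simp_rw [norm_testLp_eq, eLpNorm_norm]
  have h3 : eLpNorm φ 6 volume ≤ ENNReal.ofReal (C * ∑ j, ‖testLp (h.pd j)‖) := by
    rw [ENNReal.ofReal_mul hC0, ENNReal.ofReal_coe_nnreal]
    exact h1.trans (by gcongr)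
  have hpow : ∀ (n : ℕ) (hn : n ≠ 0),
      eLpNorm φ (n : ℝ≥0∞) volume ^ n = ∫⁻ x, ‖φ x‖ₑ ^ n := by
    intro n hn
    have := eLpNorm_nnreal_pow_eq_lintegral (f := φ) (μ := (volume : Measure E3))
      (p := (n : NNReal)) (by exact_mod_cast hn)
    simpa using this
  have h4 : eLpNorm φ 4 volume ^ 4 ≤ eLpNorm φ 2 volume ^ 2 + eLpNorm φ 6 volume ^ 6 := by
    have e4 := hpow 4 (by norm_num)
    have e2 := hpow 2 (by norm_num)
    have e6 := hpow 6 (by norm_num)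
    norm_num at e2 e4 e6
    rw [e2, e4, e6, ← lintegral_add_left' (by
      exact (h.continuous.measurable.enorm.pow_const 2).aemeasurable)]
    refine lintegral_mono fun x => ?_
    rcases le_total ‖φ x‖ₑ 1 with hx | hx
    · exact le_add_right (pow_le_pow_right_of_le_one' hx (by norm_num))
    · exact le_add_left (pow_le_pow_right' hx (by norm_num))
  rw [← norm_testLp4_eq h, ← norm_testLp_eq h] at h4
  have h5 := h4.trans (add_le_add_right (pow_le_pow_left' h3 6) _)
  rw [← ENNReal.ofReal_pow (norm_nonneg _), ← ENNReal.ofReal_pow (norm_nonneg _),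
    ← ENNReal.ofReal_pow (mul_nonneg hC0 hS), ← ENNReal.ofReal_add (by positivity)
    (by positivity)] at h5
  exact (ENNReal.ofReal_le_ofReal_iff (by positivity)).1 h5

theorem testLp_sub {F : Type*} [NormedAddCommGroup F] [NormedSpace ℝ F] {φ ψ : E3 → F}
    (h : IsTestFn φ) (h' : IsTestFn ψ) : testLp (h.sub h') = testLp h - testLp h' :=
  MemLp.toLp_sub (h.memLp 2) (h'.memLp 2)

theorem testLp4_sub {φ ψ : E3 → ℝ} (h : IsTestFn φ) (h' : IsTestFn ψ) :
    testLp4 (h.sub h') = testLp4 h - testLp4 h' :=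
  MemLp.toLp_sub (h.memLp 4) (h'.memLp 4)

/-- Functions in `H¹(ℝ³)` are approximated by test functions in `H¹` and in `L⁴`. -/
theorem exists_test_tendsto_four {f : L2S} {g : Fin 3 → L2S}
    (h : ∀ j, IsWeakPartial j f (g j)) :
    ∃ (φ : ℕ → E3 → ℝ) (hφ : ∀ n, IsTestFn (φ n)) (f4 : Lp ℝ 4 (volume : Measure E3)),
      f4 =ᵐ[volume] f ∧
      Tendsto (fun n => testLp (hφ n)) atTop (𝓝 f) ∧
      (∀ j, Tendsto (fun n => testLp ((hφ n).pd j)) atTop (𝓝 (g j))) ∧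
      Tendsto (fun n => testLp4 (hφ n)) atTop (𝓝 f4) := by
  obtain ⟨φ, hφ, h1, h2⟩ := exists_test_tendsto h
  obtain ⟨C, hC, hb⟩ := exists_testLp4_bound
  have hcau : CauchySeq fun n => testLp4 (hφ n) := by
    rw [cauchySeq_iff_tendsto_dist_atTop_0]
    have d1 := cauchySeq_iff_tendsto_dist_atTop_0.1 h1.cauchySeq
    have d2 := fun j => cauchySeq_iff_tendsto_dist_atTop_0.1 (h2 j).cauchySeq
    -- The nested square roots take the fourth root of the bound for `‖·‖⁴`.
    have hR : Tendsto (fun p : ℕ × ℕ => √(√(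
        dist (testLp (hφ p.1)) (testLp (hφ p.2)) ^ 2
        + (C * ∑ j, dist (testLp ((hφ p.1).pd j)) (testLp ((hφ p.2).pd j))) ^ 6)))
        atTop (𝓝 0) := by
      have := ((d1.pow 2).add (((tendsto_finsetSum Finset.univ fun j _ => d2 j).const_mul
        C).pow 6)).sqrt.sqrt
      simpa using this
    refine squeeze_zero (fun _ => dist_nonneg) (fun p => ?_) hR
    have hp := hb _ ((hφ p.1).sub (hφ p.2))
    have hpd : ∀ j, testLp (((hφ p.1).sub (hφ p.2)).pd j)
        = testLp ((hφ p.1).pd j) - testLp ((hφ p.2).pd j) := fun j => by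
      rw [← testLp_sub]
      exact testLp_congr _ _ (pd_sub (hφ _).differentiable (hφ _).differentiable j)
    simp_rw [hpd] at hp
    rw [testLp_sub, testLp4_sub] at hp
    simp_rw [← dist_eq_norm] at hp
    apply Real.le_sqrt_of_sq_le
    apply Real.le_sqrt_of_sq_le
    rw [← pow_mul]
    exact hp
  obtain ⟨f4, h4⟩ := cauchySeq_tendsto_of_complete hcau
  refine ⟨φ, hφ, f4, ?_, h1, h2, h4⟩
  -- The `L²` and `L⁴` limits agree almost everywhere because both are limits in measure of the same
  -- sequence.
  have m1 := tendstoInMeasure_of_tendsto_Lp h1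
  have m4 := tendstoInMeasure_of_tendsto_Lp h4
  refine tendstoInMeasure_ae_unique m4 (m1.congr_left fun n => ?_)
  exact (testLp_coe (hφ n)).trans (testLp4_coe (hφ n)).symm

/-- The product of two functions in `L⁴`. -/
def mul4 (f g : Lp ℝ 4 (volume : Measure E3)) : L2S :=
  (ContinuousLinearMap.mul ℝ ℝ).holderL volume 4 4 2 f g

theorem mul4_coe (f g : Lp ℝ 4 (volume : Measure E3)) :
    mul4 f g =ᵐ[volume] fun x => f x * g x :=
  (ContinuousLinearMap.mul ℝ ℝ).coeFn_holder f g

theorem tendsto_mul4 {f g : ℕ → Lp ℝ 4 (volume : Measure E3)}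
    {f₀ g₀ : Lp ℝ 4 (volume : Measure E3)} (hf : Tendsto f atTop (𝓝 f₀))
    (hg : Tendsto g atTop (𝓝 g₀)) :
    Tendsto (fun n => mul4 (f n) (g n)) atTop (𝓝 (mul4 f₀ g₀)) := by
  unfold mul4
  generalize (ContinuousLinearMap.mul ℝ ℝ).holderL (volume : Measure E3) 4 4 2 = B
  have h := (isBoundedBilinearMap_apply (𝕜 := ℝ)).continuous.tendsto (B f₀, g₀)
  exact h.comp (((B.continuous.tendsto f₀).comp hf).prodMk_nhds hg)

/-- The pairing `L² × L⁴ × L⁴` is continuous, so it lets trilinear identities with one derivative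
pass from test functions to `H¹`. -/
theorem inner_mul4 {f : L2S} {g h : Lp ℝ 4 (volume : Measure E3)} {f' g' h' : E3 → ℝ}
    (hf : f =ᵐ[volume] f') (hg : g =ᵐ[volume] g') (hh : h =ᵐ[volume] h') :
    Integrable (fun x => f' x * g' x * h' x) ∧
    inner ℝ f (mul4 g h) = ∫ x, f' x * g' x * h' x := by
  have hae : (fun x => inner ℝ (f x) (mul4 g h x)) =ᵐ[volume] fun x => f' x * g' x * h' x := by
    filter_upwards [hf, hg, hh, mul4_coe g h] with x h1 h2 h3 h4
    rw [h1, h4, h2, h3]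
    simp
    ring
  refine ⟨(L2.integrable_inner f (mul4 g h)).congr hae, ?_⟩
  rw [L2.inner_def]
  exact integral_congr_ae hae

theorem pd_mul {φ ψ : E3 → ℝ} (h : Differentiable ℝ φ) (h' : Differentiable ℝ ψ) (j : Fin 3)
    (x : E3) : pd j (fun x => φ x * ψ x) x = φ x * pd j ψ x + pd j φ x * ψ x := by
  simp only [pd]
  rw [fderiv_fun_mul (h x) (h' x)]
  simp [mul_comm]

theorem integral_pd_mul_mul {a b c : E3 → ℝ} (ha : IsTestFn a) (hb : IsTestFn b)
    (hc : IsTestFn c) (j : Fin 3) :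
    (∫ x, pd j a x * b x * c x) + (∫ x, pd j b x * a x * c x)
      + (∫ x, pd j c x * a x * b x) = 0 := by
  have h := integral_pd_mul ha (hb.smul hc) j
  have hI : ∀ {a b c : E3 → ℝ}, IsTestFn a → IsTestFn b → IsTestFn c →
      Integrable (fun x => pd j a x * b x * c x) := fun h1 h2 h3 =>
    (((h1.pd j).smul h2).smul h3).integrable
  simp only [smul_eq_mul] at h
  simp_rw [pd_mul hb.differentiable hc.differentiable] at h
  have e1 : ∫ x, a x * (b x * pd j c x + pd j b x * c x)
      = (∫ x, pd j b x * a x * c x) + ∫ x, pd j c x * a x * b x := by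
    rw [← integral_add (hI hb ha hc) (hI hc ha hb)]
    congr 1; ext x; ring
  rw [e1] at h
  have e2 : ∫ x, pd j a x * b x * c x = ∫ x, pd j a x * (b x * c x) := by
    congr 1; ext x; ring
  rw [e2, h]; ring

/-- The product of three functions in `H¹(ℝ³)` has a partial derivative with integral zero. -/
theorem integral_weakPartial_mul_mul {a b c : L2S} {a' b' c' : Fin 3 → L2S}
    (ha : ∀ j, IsWeakPartial j a (a' j)) (hb : ∀ j, IsWeakPartial j b (b' j))
    (hc : ∀ j, IsWeakPartial j c (c' j)) (j : Fin 3) :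
    Integrable (fun x => a' j x * b x * c x) ∧ Integrable (fun x => b' j x * a x * c x) ∧
    Integrable (fun x => c' j x * a x * b x) ∧
    (∫ x, a' j x * b x * c x) + (∫ x, b' j x * a x * c x)
      + (∫ x, c' j x * a x * b x) = 0 := by
  obtain ⟨φ, hφ, a4, ea, -, da, ta⟩ := exists_test_tendsto_four ha
  obtain ⟨ψ, hψ, b4, eb, -, db, tb⟩ := exists_test_tendsto_four hb
  obtain ⟨χ, hχ, c4, ec, -, dc, tc⟩ := exists_test_tendsto_four hc
  obtain ⟨i1, e1⟩ := inner_mul4 (f := a' j) (EventuallyEq.refl _ _) eb ec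
  obtain ⟨i2, e2⟩ := inner_mul4 (f := b' j) (EventuallyEq.refl _ _) ea ec
  obtain ⟨i3, e3⟩ := inner_mul4 (f := c' j) (EventuallyEq.refl _ _) ea eb
  refine ⟨i1, i2, i3, ?_⟩
  rw [← e1, ← e2, ← e3]
  have l1 := (da j).inner (𝕜 := ℝ) (tendsto_mul4 tb tc)
  have l2 := (db j).inner (𝕜 := ℝ) (tendsto_mul4 ta tc)
  have l3 := (dc j).inner (𝕜 := ℝ) (tendsto_mul4 ta tb)
  refine tendsto_nhds_unique ((l1.add l2).add l3) ?_
  refine tendsto_const_nhds.congr fun n => ?_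
  rw [(inner_mul4 (testLp_coe ((hφ n).pd j)) (testLp4_coe (hψ n)) (testLp4_coe (hχ n))).2,
    (inner_mul4 (testLp_coe ((hψ n).pd j)) (testLp4_coe (hφ n)) (testLp4_coe (hχ n))).2,
    (inner_mul4 (testLp_coe ((hχ n).pd j)) (testLp4_coe (hφ n)) (testLp4_coe (hψ n))).2,
    integral_pd_mul_mul (hφ n) (hψ n) (hχ n)]

/-- The `i`-th component of a square integrable vector field. -/
def comp (i : Fin 3) : L2V →L[ℝ] L2S :=
  (EuclideanSpace.proj i : E3 →L[ℝ] ℝ).compLpL 2 volume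

theorem comp_coe (i : Fin 3) (u : L2V) : comp i u =ᵐ[volume] fun x => u x i :=
  ContinuousLinearMap.coeFn_compLpL _ u

theorem IsWeakPartial.clm_comp {F G : Type*} [NormedAddCommGroup F] [NormedSpace ℝ F]
    [NormedAddCommGroup G] [NormedSpace ℝ G] [CompleteSpace F] [CompleteSpace G] {j : Fin 3} {f g : Lp F 2 (volume : Measure E3)}
    (h : IsWeakPartial j f g) (L : F →L[ℝ] G) :
    IsWeakPartial j (fun x => L (f x)) (fun x => L (g x)) := by
  intro φ hφ hc
  have hφ' : IsTestFn φ := ⟨hφ, hc⟩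
  have h1 : Integrable (fun x => pd j φ x • f x) :=
    memLp_one_iff_integrable.1 ((Lp.memLp f).smul ((hφ'.pd j).memLp 2))
  have h2 : Integrable (fun x => φ x • g x) :=
    memLp_one_iff_integrable.1 ((Lp.memLp g).smul (hφ'.memLp 2))
  have := congrArg L (h φ hφ hc)
  rw [map_neg, ← L.integral_comp_comm h2] at this
  have e1 := L.integral_comp_comm h1
  simp only [pd] at e1
  rw [← e1] at this
  simpa using this

theorem IsWeakPartial.congr {F : Type*} [NormedAddCommGroup F] [NormedSpace ℝ F] {j : Fin 3}
    {f f' g g' : E3 → F} (h : IsWeakPartial j f g) (hf : f' =ᵐ[volume] f)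
    (hg : g' =ᵐ[volume] g) : IsWeakPartial j f' g' := by
  intro φ hφ hc
  have e1 : ∫ x, (fderiv ℝ φ x (e j)) • f' x = ∫ x, (fderiv ℝ φ x (e j)) • f x :=
    integral_congr_ae (by filter_upwards [hf] with x hx; rw [hx])
  have e2 : ∫ x, φ x • g' x = ∫ x, φ x • g x :=
    integral_congr_ae (by filter_upwards [hg] with x hx; rw [hx])
  rw [e1, e2, h φ hφ hc]

theorem IsWeakPartial.comp {j : Fin 3} {u v : L2V} (h : IsWeakPartial j u v) (i : Fin 3) :
    IsWeakPartial j (comp i u) (comp i v) :=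
  (IsWeakPartial.clm_comp h (EuclideanSpace.proj i : E3 →L[ℝ] ℝ)).congr (comp_coe i u) (comp_coe i v)

theorem inner_E3 (x y : E3) : inner ℝ x y = ∑ i, x i * y i := by
  rw [PiLp.inner_apply]
  simp [mul_comm]

/-- The convection term is orthogonal to the velocity. -/
theorem integral_inner_convection_self {u : L2V} {Du : Fin 3 → L2V}
    (h : ∀ j, IsWeakPartial j u (Du j)) :
    Integrable (fun x => inner ℝ (convection u Du x) (u x)) ∧
    ∫ x, inner ℝ (convection u Du x) (u x) = 0 := by
  have key := fun i j => integral_weakPartial_mul_mul (fun k => (h k).comp j)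
    (fun k => (h k).comp i) (fun k => (h k).comp i) j
  have hI : ∀ i j, Integrable (fun x => comp j (Du j) x * comp i u x * comp i u x
      + comp i (Du j) x * comp j u x * comp i u x
      + comp i (Du j) x * comp j u x * comp i u x) := fun i j =>
    ((key i j).1.add (key i j).2.1).add (key i j).2.2.1
  have h0 : ∀ i j, ∫ x, (comp j (Du j) x * comp i u x * comp i u x
      + comp i (Du j) x * comp j u x * comp i u x
      + comp i (Du j) x * comp j u x * comp i u x) = 0 := fun i j => by
    have h1 := (key i j).1
    have h2 := (key i j).2.1
    have e1 := integral_add (h1.add h2) h2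
    simp only [Pi.add_apply] at e1
    rw [e1, integral_add h1 h2]
    exact (key i j).2.2.2
  -- The integrand is a pure divergence: `convection · u = ½ ∑ᵢⱼ ∂ⱼ(uⱼ uᵢ uᵢ)`. The term `½(∇·u)u`
  -- replaces incompressibility here.
  have hae : (fun x => inner ℝ (convection u Du x) (u x)) =ᵐ[volume]
      fun x => (1 / 2 : ℝ) * ∑ i, ∑ j, (comp j (Du j) x * comp i u x * comp i u x
      + comp i (Du j) x * comp j u x * comp i u x
      + comp i (Du j) x * comp j u x * comp i u x) := by
    have c1 : ∀ᵐ x, ∀ i, comp i u x = u x i := ae_all_iff.2 fun i => comp_coe i u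
    have c2 : ∀ᵐ x, ∀ i j, comp i (Du j) x = Du j x i :=
      ae_all_iff.2 fun i => ae_all_iff.2 fun j => comp_coe i (Du j)
    filter_upwards [c1, c2] with x h1 h2
    simp only [h1, h2, inner_E3, convection, divOf]
    simp [Fin.sum_univ_three]
    ring
  constructor
  · refine Integrable.congr ?_ hae.symm
    exact (integrable_finsetSum _ fun i _ => integrable_finsetSum _ fun j _ => hI i j).const_mul _
  · rw [integral_congr_ae hae, integral_const_mul, integral_finsetSum _ fun i _ =>
      integrable_finsetSum _ fun j _ => hI i j]
    simp_rw [integral_finsetSum _ fun j _ => hI _ j, h0]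
    simp

/-! ### Energy balance for strong solutions -/

theorem AbsolutelyContinuousOnInterval.of_dist_le {X Y : Type*} [PseudoMetricSpace X]
    [PseudoMetricSpace Y] {f : ℝ → X} {g : ℝ → Y} {a b K : ℝ}
    (hg : AbsolutelyContinuousOnInterval g a b)
    (h : ∀ x ∈ uIcc a b, ∀ y ∈ uIcc a b, dist (f x) (f y) ≤ K * dist (g x) (g y)) :
    AbsolutelyContinuousOnInterval f a b := by
  have hg' := Tendsto.const_mul K hg
  rw [mul_zero] at hg'
  refine squeeze_zero' (Eventually.of_forall fun _ => Finset.sum_nonneg fun _ _ => dist_nonneg)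
    ?_ hg'
  have hmem : ∀ᶠ E in AbsolutelyContinuousOnInterval.totalLengthFilter ⊓
      𝓟 (AbsolutelyContinuousOnInterval.disjWithin a b),
      E ∈ AbsolutelyContinuousOnInterval.disjWithin a b :=
    eventually_inf_principal.2 (by simp)
  filter_upwards [hmem] with E hE
  rw [Finset.mul_sum]
  refine Finset.sum_le_sum fun i hi => ?_
  exact h _ (hE.1 i hi).1 _ (hE.1 i hi).2

/-- Increments of the primitive are dominated by those of the scalar primitive of `‖f‖`, so the
vector-valued case reduces to the real one. -/
theorem absolutelyContinuousOnInterval_primitive {H : Type*} [NormedAddCommGroup H]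
    [NormedSpace ℝ H] {f : ℝ → H} {a b : ℝ} (hf : IntervalIntegrable f volume a b)
    (c : H) : AbsolutelyContinuousOnInterval (fun x => c + ∫ v in a..x, f v) a b := by
  have hg := hf.norm.absolutelyContinuousOnInterval_intervalIntegral (c := a) (by simp)
  refine AbsolutelyContinuousOnInterval.of_dist_le (K := 1) hg fun x hx y hy => ?_
  have hi : ∀ z ∈ uIcc a b, IntervalIntegrable f volume a z := fun z hz =>
    hf.mono_set (uIcc_subset_uIcc left_mem_uIcc hz)
  rw [one_mul, dist_comm, dist_comm (∫ v in a..x, ‖f v‖), dist_eq_norm, dist_eq_norm,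
    add_sub_add_left_eq_sub, intervalIntegral.integral_interval_sub_left (hi y hy) (hi x hx),
    intervalIntegral.integral_interval_sub_left (hi y hy).norm (hi x hx).norm]
  exact intervalIntegral.norm_integral_le_abs_integral_norm

theorem AbsolutelyContinuousOnInterval.norm_sq {H : Type*} [NormedAddCommGroup H]
    [NormedSpace ℝ H] {f : ℝ → H} {a b : ℝ} (hf : AbsolutelyContinuousOnInterval f a b) :
    AbsolutelyContinuousOnInterval (fun x => ‖f x‖ ^ 2) a b := by
  obtain ⟨C, hC⟩ := hf.exists_bound
  refine AbsolutelyContinuousOnInterval.of_dist_le (K := 2 * C) hf fun x hx y hy => ?_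
  have h1 := abs_norm_sub_norm_le (f x) (f y)
  have h2 := hC x hx
  have h3 := hC y hy
  have h4 : 0 ≤ C := (norm_nonneg _).trans h2
  rw [Real.dist_eq, dist_eq_norm, sq_sub_sq, abs_mul, abs_of_nonneg (by positivity)]
  gcongr
  linarith

/-- Energy balance for a pair of absolutely continuous functions with values in Hilbert spaces. -/
theorem energy_balance {H K : Type*} [NormedAddCommGroup H] [InnerProductSpace ℝ H]
    [CompleteSpace H] [NormedAddCommGroup K] [InnerProductSpace ℝ K] [CompleteSpace K]
    {T : ℝ} {f : ℝ → H} {g : ℝ → K} {U : ℝ → H} {Q : ℝ → K} {κ D : ℝ → ℝ}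
    (hf : IntervalIntegrable f volume 0 T) (hg : IntervalIntegrable g volume 0 T) (U₀ : H)
    (Q₀ : K) (hU : ∀ t ∈ Icc 0 T, U t = U₀ + ∫ s in (0 : ℝ)..t, f s)
    (hQ : ∀ t ∈ Icc 0 T, Q t = Q₀ + ∫ s in (0 : ℝ)..t, g s)
    (hκ : ContDiffOn ℝ 1 κ (Icc 0 T))
    (h : ∀ᵐ t ∂timeMeasure T, 2 * inner ℝ (U t) (f t)
      + derivWithin κ (Icc 0 T) t * ‖Q t‖ ^ 2 + κ t * (2 * inner ℝ (Q t) (g t)) = - D t)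
    {t : ℝ} (ht : t ∈ Icc 0 T) :
    ‖U t‖ ^ 2 + κ t * ‖Q t‖ ^ 2 + ∫ s in Icc 0 t, D s = ‖U₀‖ ^ 2 + κ 0 * ‖Q₀‖ ^ 2 := by
  -- `U` and `Q` are known only on `[0,T]`; the primitives `V` and `R` are defined on the whole
  -- line, so they can be differentiated two-sidedly.
  set V : ℝ → H := fun t => U₀ + ∫ s in (0 : ℝ)..t, f s with hV
  set R : ℝ → K := fun t => Q₀ + ∫ s in (0 : ℝ)..t, g s with hR
  have hsub : uIcc 0 t ⊆ uIcc 0 T := by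
    rw [uIcc_of_le ht.1, uIcc_of_le (ht.1.trans ht.2)]
    exact Icc_subset_Icc_right ht.2
  have hsub' : Icc 0 t ⊆ Icc 0 T := Icc_subset_Icc_right ht.2
  have hft := hf.mono_set hsub
  have hgt := hg.mono_set hsub
  have hκ' : ContDiffOn ℝ 1 κ (uIcc 0 t) := by
    rw [uIcc_of_le ht.1]; exact hκ.mono hsub'
  set E : ℝ → ℝ := fun t => ‖V t‖ ^ 2 + κ t * ‖R t‖ ^ 2 with hE
  have hEac : AbsolutelyContinuousOnInterval E 0 t :=
    (AbsolutelyContinuousOnInterval.norm_sq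
      (absolutelyContinuousOnInterval_primitive hft U₀)).add
      (hκ'.absolutelyContinuousOnInterval.mul (AbsolutelyContinuousOnInterval.norm_sq
        (absolutelyContinuousOnInterval_primitive hgt Q₀)))
  have hmain := hEac.integral_deriv_eq_sub
  have hderiv : ∫ s in (0 : ℝ)..t, deriv E s = ∫ s in (0 : ℝ)..t, - D s := by
    refine intervalIntegral.integral_congr_ae ?_
    rw [timeMeasure, ae_restrict_iff' measurableSet_Icc] at h
    have h₀ : ∀ᵐ x : ℝ, x ≠ 0 := by simp [ae_iff, measure_singleton]
    -- At the endpoint `T` the derivative within `[0,T]` need not be a two-sided derivative of `κ`.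
    have h₁ : ∀ᵐ x : ℝ, x ≠ T := by simp [ae_iff, measure_singleton]
    filter_upwards [hft.ae_hasDerivAt_integral, hgt.ae_hasDerivAt_integral, h, h₀, h₁]
      with s hs1 hs2 hs3 hs4 hs5 hs
    rw [uIoc_of_le ht.1] at hs
    have hs' : s ∈ Icc 0 T := hsub' ⟨hs.1.le, hs.2⟩
    have hsu : s ∈ uIcc 0 t := by rw [uIcc_of_le ht.1]; exact ⟨hs.1.le, hs.2⟩
    have d1 : HasDerivAt V (f s) s := (hs1 hsu 0 left_mem_uIcc).const_add U₀
    have d2 : HasDerivAt R (g s) s := (hs2 hsu 0 left_mem_uIcc).const_add Q₀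
    have d3 : HasDerivAt κ (derivWithin κ (Icc 0 T) s) s := by
      have hn : Icc 0 T ∈ 𝓝 s := Icc_mem_nhds hs.1 (lt_of_le_of_ne hs'.2 hs5)
      exact ((hκ.differentiableOn (by simp)) s hs').hasDerivWithinAt.hasDerivAt hn
    have := (d1.norm_sq.add (d3.mul d2.norm_sq)).deriv
    have e : E = (fun x => ‖V x‖ ^ 2) + κ * fun x => ‖R x‖ ^ 2 := rfl
    rw [e, this, ← hs3 hs', hU s hs', hQ s hs']
    ring
  rw [hderiv, intervalIntegral.integral_neg, intervalIntegral.integral_of_le ht.1,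
    ← integral_Icc_eq_integral_Ioc] at hmain
  have e1 : E t = ‖U t‖ ^ 2 + κ t * ‖Q t‖ ^ 2 := by
    simp only [hE]; rw [hU t ht, hQ t ht]
  have e0 : E 0 = ‖U₀‖ ^ 2 + κ 0 * ‖Q₀‖ ^ 2 := by
    simp only [hE, hV, hR, intervalIntegral.integral_same, add_zero]
  rw [e1, e0] at hmain
  linarith

theorem inner_eq_sum_comp (v w : L2V) :
    inner ℝ v w = ∑ i, inner ℝ (comp i v) (comp i w) := by
  simp_rw [L2.inner_def]
  rw [← integral_finsetSum _ fun i _ => L2.integrable_inner (comp i v) (comp i w)]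
  refine integral_congr_ae ?_
  have c1 : ∀ᵐ x, ∀ i, comp i v x = v x i := ae_all_iff.2 fun i => comp_coe i v
  have c2 : ∀ᵐ x, ∀ i, comp i w x = w x i := ae_all_iff.2 fun i => comp_coe i w
  filter_upwards [c1, c2] with x h1 h2
  simp only [h1, h2, inner_E3]
  simp [mul_comm]

/-- The divergence as an element of `L²`. -/
def divLp (Du : Fin 3 → L2V) : L2S := ∑ j, comp j (Du j)

theorem divLp_coe (Du : Fin 3 → L2V) : divLp Du =ᵐ[volume] divOf Du := by
  have c : ∀ᵐ x, ∀ j, comp j (Du j) x = Du j x j := ae_all_iff.2 fun j => comp_coe j (Du j)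
  have h := Lp.coeFn_finsetSum (Finset.univ) (fun j => comp j (Du j))
  filter_upwards [c, h] with x h1 h2
  rw [divLp, h2]
  simp [h1, divOf]

/-- The momentum equation tested with the velocity. -/
theorem inner_momentum {u ut Dp : L2V} {p : L2S} {Du : Fin 3 → L2V} {D2u : Fin 3 → Fin 3 → L2V}
    (hu : ∀ j, IsWeakPartial j u (Du j)) (hDu : ∀ i j, IsWeakPartial i (Du j) (D2u i j))
    (hp : ∀ j, IsWeakPartial j p (fun x => Dp x j))
    (heq : ∀ᵐ x, ut x + convection u Du x + Dp x - ∑ j, D2u j j x = 0) :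
    inner ℝ u ut = inner ℝ p (divLp Du) - ∑ j, ‖Du j‖ ^ 2 := by
  have hw : inner ℝ (ut + Dp - ∑ j, D2u j j) u = 0 := by
    rw [L2.inner_def]
    have hae : (fun x => inner ℝ ((ut + Dp - ∑ j, D2u j j : L2V) x) (u x))
        =ᵐ[volume] fun x => - inner ℝ (convection u Du x) (u x) := by
      filter_upwards [heq, Lp.coeFn_sub (ut + Dp) (∑ j, D2u j j), Lp.coeFn_add ut Dp,
        Lp.coeFn_finsetSum (Finset.univ) (fun j => D2u j j)] with x h1 h2 h3 h4
      rw [h2, Pi.sub_apply, h3, h4, Pi.add_apply, ← inner_neg_left]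
      congr 1
      have h4' : (∑ j, (D2u j j : E3 → E3)) x = ∑ j, D2u j j x := Finset.sum_apply _ _ _
      rw [h4']
      rw [← sub_eq_zero, ← h1]
      abel
    rw [integral_congr_ae hae, integral_neg, (integral_inner_convection_self hu).2, neg_zero]
  have h1 : inner ℝ Dp u = - inner ℝ p (divLp Du) := by
    rw [inner_eq_sum_comp, divLp, inner_sum, ← Finset.sum_neg_distrib]
    refine Finset.sum_congr rfl fun i _ => ?_
    have hpi : IsWeakPartial i p (comp i Dp) := (hp i).congr EventuallyEq.rfl (comp_coe i Dp)
    rw [inner_weakPartial hpi fun j => (hu j).comp i, neg_neg]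
  have h2 : ∀ j, inner ℝ (D2u j j) u = - ‖Du j‖ ^ 2 := fun j => by
    rw [← real_inner_self_eq_norm_sq, inner_eq_sum_comp, inner_eq_sum_comp (Du j),
      ← Finset.sum_neg_distrib]
    refine Finset.sum_congr rfl fun i _ => ?_
    have := inner_weakPartial ((hDu j j).comp i) (fun k => (hu k).comp i) (j := j)
    rw [this, neg_neg]
  rw [inner_sub_left, inner_add_left, sum_inner, h1] at hw
  simp_rw [h2] at hw
  rw [Finset.sum_neg_distrib, real_inner_comm] at hw
  linarith

theorem MemLp.intervalIntegrable {H : Type*} [NormedAddCommGroup H] {T : ℝ} (hT : 0 ≤ T)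
    {f : ℝ → H} (hf : MemLp f 2 (timeMeasure T)) : IntervalIntegrable f volume 0 T := by
  have : IsFiniteMeasure (timeMeasure T) := by unfold timeMeasure; infer_instance
  rw [intervalIntegrable_iff_integrableOn_Icc_of_le hT]
  exact hf.integrable (by norm_num)

/-- The differentiable pressure variable is `π = εp`, and `ε|p|² = ε⁻¹|π|²`. In its time derivative
the contribution `-εₜ|p|²` of `ε⁻¹` cancels against the term `½ εₜ p` of the pressure equation. What
is left is `-2(p, ∇·u)`, which cancels the pressure work in the momentum equation. -/
theorem energy_eq_of_strong {T : ℝ} (hT : 0 < T) {ε : ℝ → ℝ} (hε : ContDiffOn ℝ 1 ε (Icc 0 T))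
    (hpos : ∀ t ∈ Icc 0 T, 0 < ε t) {u₀ : L2V} {p₀ : L2S} {u : ℝ → L2V} {p : ℝ → L2S}
    {Du : ℝ → Fin 3 → L2V} {D2u : ℝ → Fin 3 → Fin 3 → L2V} {ut : ℝ → L2V} {πt : ℝ → L2S}
    {Dp : ℝ → L2V} (hDu : ∀ᵐ t ∂timeMeasure T, ∀ j, IsWeakPartial j (u t) (Du t j))
    (hD2u : ∀ᵐ t ∂timeMeasure T, ∀ i j, IsWeakPartial i (Du t j) (D2u t i j))
    (hDp : ∀ᵐ t ∂timeMeasure T, ∀ j, IsWeakPartial j (p t) (fun x => (Dp t x) j))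
    (hut : MemLp ut 2 (timeMeasure T))
    (hu : ∀ t ∈ Icc 0 T, u t = u₀ + ∫ s in Icc 0 t, ut s)
    (hπt : MemLp πt 2 (timeMeasure T))
    (hp : ∀ t ∈ Icc 0 T, ε t • p t = ε 0 • p₀ + ∫ s in Icc 0 t, πt s)
    (h1 : ∀ᵐ t ∂timeMeasure T, ∀ᵐ x : E3,
      ut t x + convection (u t) (Du t) x + Dp t x - ∑ j, D2u t j j x = 0)
    (h2 : ∀ᵐ t ∂timeMeasure T, ∀ᵐ x : E3,
      πt t x - (1 / 2 : ℝ) * derivWithin ε (Icc 0 T) t * p t x + divOf (Du t) x = 0)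
    {t : ℝ} (ht : t ∈ Icc 0 T) :
    energy (ε t) (u t) (p t) + ∫ s in Icc 0 t, ∑ j, ‖Du s j‖ ^ 2 = energy (ε 0) u₀ p₀ := by
  have hII : ∀ {H : Type} [NormedAddCommGroup H] [NormedSpace ℝ H] (f : ℝ → H),
      ∀ t ∈ Icc 0 T, ∫ s in Icc 0 t, f s = ∫ s in (0 : ℝ)..t, f s := fun f t ht => by
    rw [intervalIntegral.integral_of_le ht.1, integral_Icc_eq_integral_Ioc]
  have hκ : ContDiffOn ℝ 1 (fun t => (ε t)⁻¹) (Icc 0 T) := hε.inv fun t ht => (hpos t ht).ne'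
  have key := energy_balance (U := u) (Q := fun t => ε t • p t) (κ := fun t => (ε t)⁻¹)
    (D := fun t => 2 * ∑ j, ‖Du t j‖ ^ 2) (MemLp.intervalIntegrable hT.le hut)
    (MemLp.intervalIntegrable hT.le hπt) u₀ (ε 0 • p₀)
    (fun t ht => by rw [hu t ht, hII _ t ht]) (fun t ht => by rw [hp t ht, hII _ t ht]) hκ ?_ ht
  · rw [integral_const_mul, norm_smul, norm_smul, mul_pow, mul_pow, Real.norm_eq_abs,
      Real.norm_eq_abs, sq_abs, sq_abs] at key
    have hε0 := hpos 0 ⟨le_rfl, hT.le⟩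
    have hεt := hpos t ht
    have e1 : (ε t)⁻¹ * (ε t ^ 2 * ‖p t‖ ^ 2) = ε t * ‖p t‖ ^ 2 := by field_simp
    have e2 : (ε 0)⁻¹ * (ε 0 ^ 2 * ‖p₀‖ ^ 2) = ε 0 * ‖p₀‖ ^ 2 := by field_simp
    rw [e1, e2] at key
    simp only [energy]
    linarith
  · have hmem : ∀ᵐ t ∂timeMeasure T, t ∈ Icc 0 T := ae_restrict_mem measurableSet_Icc
    filter_upwards [hDu, hD2u, hDp, h1, h2, hmem] with s a1 a2 a3 a4 a5 hs
    have hεs := hpos s hs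
    have m1 := inner_momentum a1 a2 a3 a4
    have m2 : πt s = (1 / 2 * derivWithin ε (Icc 0 T) s) • p s - divLp (Du s) := by
      refine Lp.ext ?_
      filter_upwards [a5, Lp.coeFn_sub ((1 / 2 * derivWithin ε (Icc 0 T) s) • p s)
        (divLp (Du s)), Lp.coeFn_smul (1 / 2 * derivWithin ε (Icc 0 T) s) (p s),
        divLp_coe (Du s)] with x b1 b2 b3 b4
      rw [b2, Pi.sub_apply, b3, b4, Pi.smul_apply, smul_eq_mul]
      linarith
    have m3 : derivWithin (fun t => (ε t)⁻¹) (Icc 0 T) s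
        = - derivWithin ε (Icc 0 T) s / ε s ^ 2 := by
      exact ((((hε.differentiableOn (by simp)) s hs).hasDerivWithinAt).inv hεs.ne').derivWithin
        (uniqueDiffOn_Icc hT s hs)
    rw [m1, m2, m3, inner_sub_right, inner_smul_left, inner_smul_left, inner_smul_right,
      real_inner_self_eq_norm_sq, norm_smul, mul_pow, Real.norm_eq_abs, sq_abs]
    simp only [conj_trivial]
    field_simp
    ring

/-! ### The momentum equation tested with solenoidal fields -/

/-- Solenoidal vector fields among the test functions. -/
structure IsSolenoidalTest (ψ : E3 → E3) : Prop extends IsTestFn ψ where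
  div_eq_zero : ∀ x, ∑ j, pd j ψ x j = 0

/-- The operator `u ↦ u_j ψ` on `L²`, for a test function `ψ`. -/
def mulComp {ψ : E3 → E3} (h : IsTestFn ψ) (j : Fin 3) : L2V →L[ℝ] L2V :=
  (((ContinuousLinearMap.lsmul ℝ ℝ : ℝ →L[ℝ] E3 →L[ℝ] E3).holderL (volume : Measure E3)
    2 ∞ 2).flip ((h.memLp ∞).toLp ψ)).comp (comp j)

theorem mulComp_coe {ψ : E3 → E3} (h : IsTestFn ψ) (j : Fin 3) (u : L2V) :
    mulComp h j u =ᵐ[volume] fun x => u x j • ψ x := by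
  have h1 := (ContinuousLinearMap.lsmul ℝ ℝ : ℝ →L[ℝ] E3 →L[ℝ] E3).coeFn_holder (r := 2)
    (comp j u) ((h.memLp ∞).toLp ψ)
  filter_upwards [h1, (h.memLp ∞).coeFn_toLp, comp_coe j u] with x a b c
  rw [← c, ← b]
  exact a

/-- The momentum flux `∫ convection · ψ + ∑ ∫ ∂_j u · ∂_j ψ`. -/
def momentumFlux {ψ : E3 → E3} (h : IsTestFn ψ) (u : L2V) (Du : Fin 3 → L2V) : ℝ :=
  (∑ j, inner ℝ (Du j) (mulComp h j u) + (1 / 2 : ℝ) * ∑ j, inner ℝ (mulComp h j (Du j)) u)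
    + ∑ j, inner ℝ (Du j) (testLp (h.pd j))

theorem integral_convection {ψ : E3 → E3} (h : IsTestFn ψ) (u : L2V) (Du : Fin 3 → L2V) :
    ∫ x, inner ℝ (convection u Du x) (ψ x)
      = ∑ j, inner ℝ (Du j) (mulComp h j u)
        + (1 / 2 : ℝ) * ∑ j, inner ℝ (mulComp h j (Du j)) u := by
  simp_rw [L2.inner_def]
  rw [← integral_finsetSum _ fun j _ => L2.integrable_inner (Du j) (mulComp h j u),
    ← integral_finsetSum _ fun j _ => L2.integrable_inner (mulComp h j (Du j)) u,
    ← integral_const_mul, ← integral_add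
    (integrable_finsetSum _ fun j _ => L2.integrable_inner (Du j) (mulComp h j u))
    ((integrable_finsetSum _ fun j _ =>
      L2.integrable_inner (mulComp h j (Du j)) u).const_mul _)]
  refine integral_congr_ae ?_
  have c1 : ∀ᵐ x, ∀ j, mulComp h j u x = u x j • ψ x := ae_all_iff.2 fun j => mulComp_coe h j u
  have c2 : ∀ᵐ x, ∀ j, mulComp h j (Du j) x = Du j x j • ψ x :=
    ae_all_iff.2 fun j => mulComp_coe h j (Du j)
  filter_upwards [c1, c2] with x h1 h2
  simp only [h1, h2, convection, divOf, inner_add_left, inner_smul_left, inner_smul_right,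
    sum_inner, conj_trivial, Finset.sum_mul, mul_assoc, Finset.mul_sum,
    real_inner_comm (u x) (ψ x)]

/-- Every term of the flux contains exactly one gradient factor, so after testing with a fixed
bounded `ψ` no Sobolev embedding is needed. This keeps the flux square integrable in time. -/
theorem exists_momentumFlux_bound {ψ : E3 → E3} (h : IsTestFn ψ) :
    ∃ K : ℝ, 0 ≤ K ∧ ∀ (u : L2V) (Du : Fin 3 → L2V),
      |momentumFlux h u Du| ≤ K * (‖u‖ + 1) * ∑ j, ‖Du j‖ := by
  -- The factor `3/2` is `1 + 1/2` from the two parts of the convection; the last sum is the viscous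
  -- part, for which `‖u‖ + 1` is needed in place of `‖u‖`.
  set K : ℝ := (∑ j, ‖mulComp h j‖) * (3 / 2) + ∑ j, ‖testLp (h.pd j)‖ with hK
  have hj : ∀ j, ‖mulComp h j‖ ≤ ∑ j, ‖mulComp h j‖ := fun j =>
    Finset.single_le_sum (f := fun j => ‖mulComp h j‖) (fun _ _ => norm_nonneg _)
      (Finset.mem_univ j)
  have hj' : ∀ j, ‖testLp (h.pd j)‖ ≤ ∑ j, ‖testLp (h.pd j)‖ := fun j =>
    Finset.single_le_sum (f := fun j => ‖testLp (h.pd j)‖) (fun _ _ => norm_nonneg _)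
      (Finset.mem_univ j)
  refine ⟨K, by positivity, fun u Du => ?_⟩
  have hsplit : momentumFlux h u Du = ∑ j, (inner ℝ (Du j) (mulComp h j u)
      + (1 / 2 : ℝ) * inner ℝ (mulComp h j (Du j)) u + inner ℝ (Du j) (testLp (h.pd j))) := by
    rw [momentumFlux, Finset.sum_add_distrib, Finset.sum_add_distrib, Finset.mul_sum]
  rw [hsplit, Finset.mul_sum]
  refine (Finset.abs_sum_le_sum_abs _ _).trans (Finset.sum_le_sum fun j _ => ?_)
  set m := ∑ j, ‖mulComp h j‖
  set q := ∑ j, ‖testLp (h.pd j)‖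
  have b1 : |inner ℝ (Du j) (mulComp h j u)| ≤ ‖Du j‖ * (m * ‖u‖) :=
    (abs_real_inner_le_norm _ _).trans (by
      gcongr; exact ((mulComp h j).le_opNorm u).trans (by gcongr; exact hj j))
  have b2 : |inner ℝ (mulComp h j (Du j)) u| ≤ (m * ‖Du j‖) * ‖u‖ :=
    (abs_real_inner_le_norm _ _).trans (by
      gcongr; exact ((mulComp h j).le_opNorm (Du j)).trans (by gcongr; exact hj j))
  have b3 : |inner ℝ (Du j) (testLp (h.pd j))| ≤ ‖Du j‖ * q :=
    (abs_real_inner_le_norm _ _).trans (by gcongr; exact hj' j)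
  have hm : 0 ≤ m := (norm_nonneg _).trans (hj 0)
  have hq : 0 ≤ q := (norm_nonneg _).trans (hj' 0)
  calc _ ≤ ‖Du j‖ * (m * ‖u‖) + 1 / 2 * ((m * ‖Du j‖) * ‖u‖) + ‖Du j‖ * q := by
        refine (abs_add_le _ _).trans (add_le_add ((abs_add_le _ _).trans
          (add_le_add b1 ?_)) b3)
        rw [abs_mul, abs_of_pos (by norm_num : (0 : ℝ) < 1 / 2)]
        gcongr
    _ ≤ K * (‖u‖ + 1) * ‖Du j‖ := by
        rw [hK]
        have : 0 ≤ m * ‖Du j‖ := by positivity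
        have : 0 ≤ q * ‖u‖ * ‖Du j‖ := by positivity
        nlinarith

theorem IsWeakPartial.inner_testLp_pd {j : Fin 3} {u v : L2V} (h : IsWeakPartial j u v)
    {ψ : E3 → E3} (hψ : IsTestFn ψ) :
    inner ℝ u (testLp (hψ.pd j)) = - inner ℝ v (testLp hψ) := by
  have hc : ∀ i, IsTestFn (fun x => ψ x i) := fun i =>
    hψ.clm_comp (EuclideanSpace.proj i : E3 →L[ℝ] ℝ)
  have e1 : ∀ i, AC.comp i (testLp hψ) = testLp (hc i) := fun i => by
    refine Lp.ext ?_
    filter_upwards [comp_coe i (testLp hψ), testLp_coe hψ, testLp_coe (hc i)] with x a b c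
    rw [a, b, c]
  have e2 : ∀ i, AC.comp i (testLp (hψ.pd j)) = testLp ((hc i).pd j) := fun i => by
    refine Lp.ext ?_
    filter_upwards [comp_coe i (testLp (hψ.pd j)), testLp_coe (hψ.pd j),
      testLp_coe ((hc i).pd j)] with x a b c
    rw [a, b, c]
    have h1 := ((EuclideanSpace.proj i : E3 →L[ℝ] ℝ).hasFDerivAt (x := ψ x)).comp x
      (hψ.differentiable x).hasFDerivAt
    have h2 : HasFDerivAt (fun x => ψ x i)
        ((EuclideanSpace.proj i : E3 →L[ℝ] ℝ).comp (fderiv ℝ ψ x)) x := h1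
    simp only [AC.pd]
    rw [h2.fderiv]
    rfl
  rw [inner_eq_sum_comp, inner_eq_sum_comp, ← Finset.sum_neg_distrib]
  refine Finset.sum_congr rfl fun i _ => ?_
  rw [e1, e2]
  exact isWeakPartial_iff.1 (h.comp i) _ (hc i)

/-- Gradients are orthogonal to solenoidal fields. -/
theorem inner_gradient_solenoidal {p : L2S} {Dp : L2V}
    (h : ∀ j, IsWeakPartial j p (fun x => Dp x j)) {ψ : E3 → E3} (hψ : IsSolenoidalTest ψ) :
    inner ℝ Dp (testLp hψ.toIsTestFn) = 0 := by
  have hc : ∀ i, IsTestFn (fun x => ψ x i) := fun i =>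
    hψ.toIsTestFn.clm_comp (EuclideanSpace.proj i : E3 →L[ℝ] ℝ)
  have hpd : ∀ i x, pd i (fun x => ψ x i) x = pd i ψ x i := fun i x => by
    have h1 := ((EuclideanSpace.proj i : E3 →L[ℝ] ℝ).hasFDerivAt (x := ψ x)).comp x
      (hψ.toIsTestFn.differentiable x).hasFDerivAt
    have h2 : HasFDerivAt (fun x => ψ x i)
        ((EuclideanSpace.proj i : E3 →L[ℝ] ℝ).comp (fderiv ℝ ψ x)) x := h1
    simp only [pd]
    rw [h2.fderiv]
    rfl
  have hI : ∀ i, Integrable fun x => Dp x i * ψ x i := fun i => by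
    have h1 : MemLp (fun x => Dp x i) 2 (volume : Measure E3) :=
      (memLp_congr_ae (comp_coe i Dp)).1 (Lp.memLp _)
    exact h1.integrable_mul ((hc i).memLp 2)
  have hJ : ∀ i, Integrable fun x => pd i (fun x => ψ x i) x * p x := fun i =>
    (((hc i).pd i).memLp 2).integrable_mul (Lp.memLp p)
  rw [inner_testLp]
  simp_rw [inner_E3]
  rw [integral_finsetSum _ fun i _ => hI i]
  have e : ∀ i, ∫ x, Dp x i * ψ x i = - ∫ x, pd i (fun x => ψ x i) x * p x := fun i => by
    have := h i _ (hc i).smooth (hc i).cpt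
    simp only [smul_eq_mul] at this
    simp only [pd]
    rw [this, neg_neg]
    simp_rw [mul_comm]
  simp_rw [e]
  rw [Finset.sum_neg_distrib, ← integral_finsetSum _ fun i _ => hJ i]
  simp_rw [← Finset.sum_mul, hpd, hψ.div_eq_zero]
  simp

theorem inner_eq_neg_momentumFlux {u ut Dp : L2V} {p : L2S} {Du : Fin 3 → L2V}
    {D2u : Fin 3 → Fin 3 → L2V} (hDu : ∀ i j, IsWeakPartial i (Du j) (D2u i j))
    (hp : ∀ j, IsWeakPartial j p (fun x => Dp x j))
    (heq : ∀ᵐ x, ut x + convection u Du x + Dp x - ∑ j, D2u j j x = 0)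
    {ψ : E3 → E3} (hψ : IsSolenoidalTest ψ) :
    inner ℝ ut (testLp hψ.toIsTestFn) = - momentumFlux hψ.toIsTestFn u Du := by
  have hw : inner ℝ (ut + Dp - ∑ j, D2u j j) (testLp hψ.toIsTestFn)
      = - ∫ x, inner ℝ (convection u Du x) (ψ x) := by
    rw [inner_testLp, ← integral_neg]
    refine integral_congr_ae ?_
    filter_upwards [heq, Lp.coeFn_sub (ut + Dp) (∑ j, D2u j j), Lp.coeFn_add ut Dp,
      Lp.coeFn_finsetSum (Finset.univ) (fun j => D2u j j)] with x h1 h2 h3 h4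
    rw [h2, Pi.sub_apply, h3, h4, Pi.add_apply, ← inner_neg_left]
    congr 1
    have h4' : (∑ j, (D2u j j : E3 → E3)) x = ∑ j, D2u j j x := Finset.sum_apply _ _ _
    rw [h4', ← sub_eq_zero, ← h1]
    abel
  have h2 : ∀ j, inner ℝ (D2u j j) (testLp hψ.toIsTestFn)
      = - inner ℝ (Du j) (testLp (hψ.toIsTestFn.pd j)) := fun j => by
    rw [(hDu j j).inner_testLp_pd hψ.toIsTestFn, neg_neg]
  rw [inner_sub_left, inner_add_left, sum_inner, inner_gradient_solenoidal hp hψ,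
    integral_convection hψ.toIsTestFn] at hw
  simp_rw [h2] at hw
  rw [Finset.sum_neg_distrib] at hw
  rw [momentumFlux]
  linarith

theorem integrable_momentumFlux {T : ℝ} {u : ℝ → L2V} {Du : ℝ → Fin 3 → L2V}
    (hu : MemLp u ∞ (timeMeasure T)) (hDu : ∀ j, MemLp (fun t => Du t j) 2 (timeMeasure T))
    {ψ : E3 → E3} (h : IsTestFn ψ) :
    Integrable (fun t => momentumFlux h (u t) (Du t)) (timeMeasure T) := by
  have : IsFiniteMeasure (timeMeasure T) := by unfold timeMeasure; infer_instance
  have hu2 : MemLp u 2 (timeMeasure T) := hu.mono_exponent le_top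
  have hi : ∀ {f g : ℝ → L2V}, MemLp f 2 (timeMeasure T) → MemLp g 2 (timeMeasure T) →
      Integrable (fun t => inner ℝ (f t) (g t)) (timeMeasure T) := fun hf hg => by
    refine (L2.integrable_inner (𝕜 := ℝ) (hf.toLp _) (hg.toLp _)).congr ?_
    filter_upwards [hf.coeFn_toLp, hg.coeFn_toLp] with t h1 h2
    rw [h1, h2]
  refine ((integrable_finsetSum _ fun j _ => ?_).add ((integrable_finsetSum _ fun j _ =>
    ?_).const_mul _)).add (integrable_finsetSum _ fun j _ => ?_)
  · exact hi (hDu j) ((mulComp h j).comp_memLp' hu2)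
  · exact hi ((mulComp h j).comp_memLp' (hDu j)) hu2
  · exact hi (hDu j) (memLp_const _)

theorem inner_eq_of_strong {T : ℝ} (hT : 0 < T) {u₀ : L2V} {u : ℝ → L2V} {p : ℝ → L2S}
    {Du : ℝ → Fin 3 → L2V} {D2u : ℝ → Fin 3 → Fin 3 → L2V} {ut : ℝ → L2V}
    {Dp : ℝ → L2V}
    (hD2u : ∀ᵐ t ∂timeMeasure T, ∀ i j, IsWeakPartial i (Du t j) (D2u t i j))
    (hDp : ∀ᵐ t ∂timeMeasure T, ∀ j, IsWeakPartial j (p t) (fun x => (Dp t x) j))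
    (hut : MemLp ut 2 (timeMeasure T))
    (hu : ∀ t ∈ Icc 0 T, u t = u₀ + ∫ s in Icc 0 t, ut s)
    (h1 : ∀ᵐ t ∂timeMeasure T, ∀ᵐ x : E3,
      ut t x + convection (u t) (Du t) x + Dp t x - ∑ j, D2u t j j x = 0)
    {ψ : E3 → E3} (hψ : IsSolenoidalTest ψ) {t : ℝ} (ht : t ∈ Icc 0 T) :
    inner ℝ (u t) (testLp hψ.toIsTestFn) = inner ℝ u₀ (testLp hψ.toIsTestFn)
      - ∫ s in (0 : ℝ)..t, momentumFlux hψ.toIsTestFn (u s) (Du s) := by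
  have hint : IntegrableOn ut (Icc 0 t) := by
    have := MemLp.intervalIntegrable hT.le hut
    rw [intervalIntegrable_iff_integrableOn_Icc_of_le hT.le] at this
    exact this.mono_set (Icc_subset_Icc_right ht.2)
  have hinner : inner ℝ (∫ s in Icc 0 t, ut s) (testLp hψ.toIsTestFn)
      = ∫ s in Icc 0 t, inner ℝ (ut s) (testLp hψ.toIsTestFn) := by
    rw [real_inner_comm, ← integral_inner hint]
    simp_rw [real_inner_comm]
  rw [hu t ht, inner_add_left, hinner, intervalIntegral.integral_of_le ht.1,
    ← integral_Icc_eq_integral_Ioc, sub_eq_add_neg, ← integral_neg]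
  congr 1
  refine integral_congr_ae ?_
  have hle : (volume : Measure ℝ).restrict (Icc 0 t) ≤ timeMeasure T :=
    Measure.restrict_mono (Icc_subset_Icc_right ht.2) le_rfl
  filter_upwards [ae_mono hle hD2u, ae_mono hle hDp, ae_mono hle h1] with s a b c
  exact inner_eq_neg_momentumFlux a b c hψ

/-! ### Weak solutions: from distributions in time to absolutely continuous functions -/

/-- The primitive based at `T` vanishes near and beyond `T` but in general not at `0`, which is
allowed since the initial time is included in the test class. A cutoff equal to `1` on `[0,T]` makes
its support compact without changing the derivative there. -/
theorem exists_test_primitive {T : ℝ} (hT : 0 < T) {η : ℝ → ℝ} (hη : ContDiff ℝ ∞ η)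
    (hc : HasCompactSupport η) (hs : tsupport η ⊆ Ioo 0 T) :
    ∃ θ : ℝ → ℝ, ContDiff ℝ ∞ θ ∧ HasCompactSupport θ ∧ tsupport θ ⊆ Iio T ∧
      ∀ t ∈ Icc 0 T, deriv θ t = η t := by
  obtain ⟨b, hbT, hb⟩ : ∃ b < T, ∀ t, b ≤ t → η t = 0 := by
    rcases (tsupport η).eq_empty_or_nonempty with h | h
    · refine ⟨0, hT, fun t _ => ?_⟩
      exact image_eq_zero_of_notMem_tsupport (by simp [h])
    · obtain ⟨m, hm, hmax⟩ := hc.exists_isMaxOn h continuous_id.continuousOn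
      refine ⟨(m + T) / 2, by linarith [(hs hm).2], fun t ht => ?_⟩
      refine image_eq_zero_of_notMem_tsupport fun htm => ?_
      have h1 : t ≤ m := hmax htm
      have h2 := (hs hm).2
      linarith
  have hηc : Continuous η := hη.continuous
  set θ₀ : ℝ → ℝ := fun t => ∫ s in T..t, η s with hθ₀
  have hd : ∀ t, HasDerivAt θ₀ (η t) t := fun t =>
    intervalIntegral.integral_hasDerivAt_right (hηc.intervalIntegrable _ _)
      hηc.stronglyMeasurable.stronglyMeasurableAtFilter hηc.continuousAt
  have hθ₀s : ContDiff ℝ ∞ θ₀ := by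
    rw [contDiff_infty_iff_deriv]
    refine ⟨fun t => (hd t).differentiableAt, ?_⟩
    rwa [show deriv θ₀ = η from funext fun t => (hd t).deriv]
  have hθ₀z : ∀ t, b ≤ t → θ₀ t = 0 := fun t ht => by
    refine intervalIntegral.integral_zero_ae (Eventually.of_forall fun s hs => hb s ?_)
    rcases le_total T t with h | h
    · rw [uIoc_of_le h] at hs; linarith [hs.1]
    · rw [uIoc_of_ge h] at hs; linarith [hs.1]
  let χ : ContDiffBump (0 : ℝ) := ⟨T + 1, T + 2, by linarith, by linarith⟩
  refine ⟨fun t => χ t * θ₀ t, χ.contDiff.mul hθ₀s, χ.hasCompactSupport.mul_right, ?_,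
    fun t ht => ?_⟩
  · have : tsupport (fun t => χ t * θ₀ t) ⊆ Iic b := by
      refine closure_minimal (fun t ht => ?_) isClosed_Iic
      by_contra h
      simp only [mem_Iic, not_le] at h
      exact ht (by simp [hθ₀z t h.le])
    exact this.trans fun t ht => lt_of_le_of_lt ht hbT
  · have hev : (fun t => χ t * θ₀ t) =ᶠ[𝓝 t] θ₀ := by
      have hmem : Metric.ball (0 : ℝ) (T + 1) ∈ 𝓝 t := by
        refine Metric.isOpen_ball.mem_nhds ?_
        rw [mem_ball_zero_iff, Real.norm_eq_abs, abs_of_nonneg ht.1]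
        linarith [ht.2]
      filter_upwards [hmem] with s hs
      rw [χ.one_of_mem_closedBall (Metric.ball_subset_closedBall hs), one_mul]
    rw [hev.deriv_eq, (hd t).deriv]

/-- A function whose distributional derivative is integrable is absolutely continuous. -/
theorem ae_eq_primitive_of_weak {T : ℝ} (hT : 0 < T) {g F : ℝ → ℝ} (g₀ : ℝ)
    (hg : Integrable g (timeMeasure T)) (hF : Integrable F (timeMeasure T))
    (h : ∀ θ : ℝ → ℝ, ContDiff ℝ ∞ θ → HasCompactSupport θ → tsupport θ ⊆ Iio T →
      ∫ t, (- (deriv θ t * g t) + θ t * F t) ∂timeMeasure T = θ 0 * g₀) :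
    ∀ᵐ t ∂timeMeasure T, g t = g₀ - ∫ s in (0 : ℝ)..t, F s := by
  have hFi : IntervalIntegrable F volume 0 T := by
    rw [intervalIntegrable_iff_integrableOn_Icc_of_le hT.le]; exact hF
  -- With `G 0 = -g₀`, integration by parts against `θ` absorbs the initial term `θ 0 * g₀`. The
  -- claim becomes `g + G = 0`, and no mean-zero condition on the test function is needed.
  set G : ℝ → ℝ := fun t => -g₀ + ∫ s in (0 : ℝ)..t, F s with hG
  have hGac : AbsolutelyContinuousOnInterval G 0 T :=
    absolutelyContinuousOnInterval_primitive hFi (-g₀)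
  have hGc : ContinuousOn G (Icc 0 T) := by
    have := hGac.continuousOn; rwa [uIcc_of_le hT.le] at this
  have hGi : Integrable G (timeMeasure T) := hGc.integrableOn_Icc
  have hIcc : ∀ f : ℝ → ℝ, ∫ t, f t ∂timeMeasure T = ∫ t in (0 : ℝ)..T, f t := fun f => by
    rw [intervalIntegral.integral_of_le hT.le, ← integral_Icc_eq_integral_Ioc, timeMeasure]
  have hmul : ∀ {θ f : ℝ → ℝ}, Continuous θ → HasCompactSupport θ →
      Integrable f (timeMeasure T) → Integrable (fun t => θ t * f t) (timeMeasure T) := by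
    intro θ f hθ hc hf
    obtain ⟨C, hC⟩ := hc.exists_bound_of_continuous hθ
    exact hf.bdd_mul hθ.aestronglyMeasurable (Eventually.of_forall hC)
  have hkey : ∀ θ : ℝ → ℝ, ContDiff ℝ ∞ θ → HasCompactSupport θ → tsupport θ ⊆ Iio T →
      ∫ t, deriv θ t * (g t + G t) ∂timeMeasure T = 0 := by
    intro θ hθ hc hs
    have hθd : Continuous (deriv θ) := hθ.continuous_deriv (by simp)
    have i1 := hmul hθd hc.deriv hg
    have i2 := hmul hθ.continuous hc hF
    have i3 := hmul hθd hc.deriv hGi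
    have h1 := h θ hθ hc hs
    rw [show (fun t => -(deriv θ t * g t) + θ t * F t) = (fun t => θ t * F t - deriv θ t * g t) by
      ext t; ring, integral_sub i2 i1] at h1
    have hθac : AbsolutelyContinuousOnInterval θ 0 T :=
      (hθ.of_le (by norm_cast)).contDiffOn.absolutelyContinuousOnInterval
    have h2 := hθac.integral_mul_deriv_eq_deriv_mul hGac
    have hθT : θ T = 0 := by
      refine image_eq_zero_of_notMem_tsupport fun hmem => ?_
      exact lt_irrefl T (hs hmem)
    have h3 : ∫ t in (0 : ℝ)..T, θ t * deriv G t = ∫ t in (0 : ℝ)..T, θ t * F t := by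
      refine intervalIntegral.integral_congr_ae ?_
      filter_upwards [hFi.ae_hasDerivAt_integral] with t ht hmem
      have := ((ht (uIoc_subset_uIcc hmem) 0 left_mem_uIcc).const_add (-g₀)).deriv
      rw [← this]
    rw [h3, hθT, ← hIcc, ← hIcc] at h2
    simp only [hG, intervalIntegral.integral_same] at h2
    simp_rw [mul_add]
    rw [integral_add i1 i3]
    simp only [hG]
    linarith
  have hz : ∀ᵐ t ∂(volume : Measure ℝ), t ∈ Ioo 0 T → g t + G t = 0 := by
    refine isOpen_Ioo.ae_eq_zero_of_integral_contDiff_smul_eq_zero ?_ fun η hη hc hs => ?_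
    · have : IntegrableOn (fun t => g t + G t) (Icc 0 T) := hg.add hGi
      exact (this.mono_set Ioo_subset_Icc_self).locallyIntegrableOn
    · obtain ⟨θ, a1, a2, a3, a4⟩ := exists_test_primitive hT hη hc hs
      have h1 := hkey θ a1 a2 a3
      have h2 : ∫ t, deriv θ t * (g t + G t) ∂timeMeasure T
          = ∫ t in Icc 0 T, η t • (g t + G t) :=
        setIntegral_congr_fun measurableSet_Icc fun t ht => by
          simp only [a4 t ht, smul_eq_mul]
      rw [h2] at h1
      rw [← h1]
      symm
      refine setIntegral_eq_integral_of_forall_compl_eq_zero fun t ht => ?_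
      have : η t = 0 := image_eq_zero_of_notMem_tsupport fun hm =>
        ht (Ioo_subset_Icc_self (hs hm))
      simp [this]
  rw [timeMeasure, ← Measure.restrict_congr_set Ioo_ae_eq_Icc, ae_restrict_iff' measurableSet_Ioo]
  filter_upwards [hz] with t ht hmem
  have := ht hmem
  simp only [hG] at this
  linarith

section Product

variable {θ : ℝ → ℝ} {ψ : E3 → E3}

theorem hasFDerivAt_product (hθ : Differentiable ℝ θ) (hψ : Differentiable ℝ ψ) (t : ℝ)
    (x : E3) : HasFDerivAt (fun z : ℝ × E3 => θ z.1 • ψ z.2)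
      (θ t • (fderiv ℝ ψ x).comp (ContinuousLinearMap.snd ℝ ℝ E3)
        + ((fderiv ℝ θ t).comp (ContinuousLinearMap.fst ℝ ℝ E3)).smulRight (ψ x)) (t, x) := by
  have h1 : HasFDerivAt (fun z : ℝ × E3 => θ z.1)
      ((fderiv ℝ θ t).comp (ContinuousLinearMap.fst ℝ ℝ E3)) (t, x) :=
    HasFDerivAt.comp (t, x) (f := Prod.fst) (hθ t).hasFDerivAt hasFDerivAt_fst
  have h2 : HasFDerivAt (fun z : ℝ × E3 => ψ z.2)
      ((fderiv ℝ ψ x).comp (ContinuousLinearMap.snd ℝ ℝ E3)) (t, x) :=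
    HasFDerivAt.comp (t, x) (f := Prod.snd) (hψ x).hasFDerivAt hasFDerivAt_snd
  exact h1.smul h2

theorem dt_product (hθ : Differentiable ℝ θ) (hψ : Differentiable ℝ ψ) (t : ℝ) (x : E3) :
    dt (fun z : ℝ × E3 => θ z.1 • ψ z.2) t x = deriv θ t • ψ x := by
  rw [dt, (hasFDerivAt_product hθ hψ t x).fderiv]
  simp

theorem dx_product (hθ : Differentiable ℝ θ) (hψ : Differentiable ℝ ψ) (j : Fin 3) (t : ℝ)
    (x : E3) : dx j (fun z : ℝ × E3 => θ z.1 • ψ z.2) t x = θ t • pd j ψ x := by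
  rw [dx, (hasFDerivAt_product hθ hψ t x).fderiv]
  simp [pd]

theorem isTest_product {T : ℝ} (hθ : ContDiff ℝ ∞ θ) (hc : HasCompactSupport θ)
    (hs : tsupport θ ⊆ Iio T) (hψ : IsTestFn ψ) :
    IsTest T (fun z : ℝ × E3 => θ z.1 • ψ z.2) := by
  have hsub : tsupport (fun z : ℝ × E3 => θ z.1 • ψ z.2) ⊆ tsupport θ ×ˢ tsupport ψ := by
    refine closure_minimal (fun z hz => ?_)
      ((isClosed_tsupport θ).prod (isClosed_tsupport ψ))
    rw [Function.mem_support, smul_ne_zero_iff] at hz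
    exact ⟨subset_tsupport _ hz.1, subset_tsupport _ hz.2⟩
  refine ⟨(hθ.comp contDiff_fst).smul (hψ.smooth.comp contDiff_snd), ?_, fun z hz => ?_⟩
  · exact (hc.isCompact.prod hψ.cpt.isCompact).of_isClosed_subset (isClosed_tsupport _) hsub
  · exact ⟨hs (hsub hz).1, mem_univ _⟩

end Product

/-- Testing with products `θ(t)ψ(x)` removes the pressure because `∇·ψ = 0`, and leaves a scalar
distributional equation in time for the moment of `u` against `ψ`. -/
theorem inner_eq_of_weak {T : ℝ} (hT : 0 < T) {u₀ : L2V} {u : ℝ → L2V} {p : ℝ → L2S}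
    {Du : ℝ → Fin 3 → L2V} (hE : InEnergyClass T u p Du) (hm : WeakMomentum T u₀ u p Du)
    {ψ : E3 → E3} (hψ : IsSolenoidalTest ψ) :
    ∀ᵐ t ∂timeMeasure T, inner ℝ (u t) (testLp hψ.toIsTestFn)
      = inner ℝ u₀ (testLp hψ.toIsTestFn)
        - ∫ s in (0 : ℝ)..t, momentumFlux hψ.toIsTestFn (u s) (Du s) := by
  have : IsFiniteMeasure (timeMeasure T) := by unfold timeMeasure; infer_instance
  refine ae_eq_primitive_of_weak hT _ ?_
    (integrable_momentumFlux hE.u_bdd hE.grad_mem hψ.toIsTestFn) fun θ hθ hc hs => ?_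
  · exact (hE.u_bdd.integrable le_top).inner_const _
  · have hθd : Differentiable ℝ θ := hθ.differentiable (by simp)
    have hψd := hψ.toIsTestFn.differentiable
    have key := hm _ (isTest_product hθ hc hs hψ.toIsTestFn)
    simp only [dt_product hθd hψd, dx_product hθd hψd, inner_smul_right, integral_const_mul]
      at key
    rw [inner_testLp, ← key]
    congr 1
    ext t
    have h0 : ∀ x, ∑ j, (θ t • pd j ψ x) j = 0 := fun x => by
      have := hψ.div_eq_zero x
      simp only [PiLp.smul_apply, smul_eq_mul, ← Finset.mul_sum, this, mul_zero]
    simp only [h0, mul_zero, integral_zero, sub_zero]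
    rw [integral_convection hψ.toIsTestFn, inner_testLp, momentumFlux]
    simp_rw [inner_testLp]
    rw [← Finset.mul_sum]
    ring

/-! ### Uniform bounds for solutions -/

/-- The energy inequality is known only for almost every time. The primitive is continuous, so a
violation at `T` would persist on an interval `(a, T)` of positive measure. -/
theorem setIntegral_le_of_ae_le {T : ℝ} (hT : 0 < T) {f : ℝ → ℝ} {E : ℝ}
    (hf : Integrable f (timeMeasure T))
    (h : ∀ᵐ t ∂timeMeasure T, ∫ s in Icc 0 t, f s ≤ E) : ∫ s in Icc 0 T, f s ≤ E := by
  by_contra hlt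
  push Not at hlt
  have hc : ContinuousOn (fun t => ∫ s in Icc 0 t, f s) (Icc 0 T) :=
    intervalIntegral.continuousOn_primitive_Icc hf
  have hev : ∀ᶠ t in 𝓝[Icc 0 T] T, E < ∫ s in Icc 0 t, f s :=
    (hc T ⟨hT.le, le_rfl⟩).eventually_const_lt hlt
  have hev' : ∀ᶠ t in 𝓝[<] T, t ∈ Icc 0 T ∧ E < ∫ s in Icc 0 t, f s := by
    have h1 : Ioo 0 T ∈ 𝓝[<] T := Ioo_mem_nhdsLT hT
    have h2 : ∀ᶠ t in 𝓝[Ioo 0 T] T, E < ∫ s in Icc 0 t, f s :=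
      hev.filter_mono (nhdsWithin_mono _ Ioo_subset_Icc_self)
    rw [nhdsWithin_Ioo_eq_nhdsLT hT] at h2
    filter_upwards [h1, h2] with t a b using ⟨Ioo_subset_Icc_self a, b⟩
  obtain ⟨a, haT, ha⟩ := (mem_nhdsLT_iff_exists_Ioo_subset).1 hev'
  rw [timeMeasure, ae_restrict_iff' measurableSet_Icc] at h
  have hnull : volume (Ioo a T) = 0 := by
    refine measure_mono_null (fun t ht => ?_) h
    have := ha ht
    simp only [mem_compl_iff, mem_ofPred_eq, not_forall, not_le]
    exact ⟨this.1, this.2⟩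
  rw [Real.volume_Ioo, ENNReal.ofReal_eq_zero] at hnull
  have : a < T := haT
  linarith

/-- The estimates that are uniform in the relaxation parameter. -/
theorem exists_bounds_of_isSolution {T : ℝ} (hT : 0 < T) {ε : ℝ → ℝ}
    (hε : ContDiffOn ℝ 1 ε (Icc 0 T)) (hpos : ∀ t ∈ Icc 0 T, 0 < ε t) {u₀ : L2V} {p₀ : L2S}
    {u : ℝ → L2V} {p : ℝ → L2S} (hsol : IsSolution T ε u₀ p₀ u p) :
    ∃ Du : ℝ → Fin 3 → L2V, InEnergyClass T u p Du ∧
      (∀ᵐ t ∂timeMeasure T, ‖u t‖ ^ 2 ≤ 2 * energy (ε 0) u₀ p₀) ∧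
      (∫ s in Icc 0 T, ∑ j, ‖Du s j‖ ^ 2) ≤ energy (ε 0) u₀ p₀ ∧
      ∀ (ψ : E3 → E3) (hψ : IsSolenoidalTest ψ), ∀ᵐ t ∂timeMeasure T,
        inner ℝ (u t) (testLp hψ.toIsTestFn) = inner ℝ u₀ (testLp hψ.toIsTestFn)
          - ∫ s in (0 : ℝ)..t, momentumFlux hψ.toIsTestFn (u s) (Du s) := by
  have hmem : ∀ᵐ t ∂timeMeasure T, t ∈ Icc 0 T := ae_restrict_mem measurableSet_Icc
  -- Both notions of solution are reduced to the energy inequality and the moment identity. The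
  -- bounds follow because the pressure energy and the dissipation are nonnegative.
  suffices H : ∃ Du : ℝ → Fin 3 → L2V, InEnergyClass T u p Du ∧
      (∀ᵐ t ∂timeMeasure T, energy (ε t) (u t) (p t) + (∫ s in Icc 0 t, ∑ j, ‖Du s j‖ ^ 2)
        ≤ energy (ε 0) u₀ p₀) ∧
      ∀ (ψ : E3 → E3) (hψ : IsSolenoidalTest ψ), ∀ᵐ t ∂timeMeasure T,
        inner ℝ (u t) (testLp hψ.toIsTestFn) = inner ℝ u₀ (testLp hψ.toIsTestFn)
          - ∫ s in (0 : ℝ)..t, momentumFlux hψ.toIsTestFn (u s) (Du s) by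
    obtain ⟨Du, hE, hen, hid⟩ := H
    refine ⟨Du, hE, ?_, ?_, hid⟩
    · filter_upwards [hen, hmem] with t ht hm
      have h1 : 0 ≤ ∫ s in Icc 0 t, ∑ j, ‖Du s j‖ ^ 2 := integral_nonneg fun s => by positivity
      have h2 : 0 ≤ ε t * ‖p t‖ ^ 2 := mul_nonneg (hpos t hm).le (by positivity)
      simp only [energy] at ht ⊢
      linarith
    · refine setIntegral_le_of_ae_le hT ?_ ?_
      · exact integrable_finsetSum _ fun j _ => (hE.grad_mem j).integrable_norm_pow (by norm_num)
      · filter_upwards [hen, hmem] with t ht hm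
        have h2 : 0 ≤ ε t * ‖p t‖ ^ 2 := mul_nonneg (hpos t hm).le (by positivity)
        have h3 : 0 ≤ energy (ε t) (u t) (p t) := by simp only [energy]; positivity
        linarith
  rcases hsol with ⟨Du, D2u, ut, πt, Dp, hE, -, hD2, -, hDp, hut, hu, hπ, hp, e1, e2⟩ |
    ⟨Du, hE, hm, -, hen⟩
  · refine ⟨Du, hE, ?_, fun ψ hψ => ?_⟩
    · filter_upwards [hmem] with t ht
      exact (energy_eq_of_strong hT hε hpos hE.grad_eq hD2 hDp hut hu hπ hp e1 e2 ht).le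
    · filter_upwards [hmem] with t ht
      exact inner_eq_of_strong hT hD2 hDp hut hu e1 hψ ht
  · exact ⟨Du, hE, hen, fun ψ hψ => inner_eq_of_weak hT hE hm hψ⟩

/-! ### Solenoidal test functions are dense in the range of the Leray projection -/

theorem pd_comm {F : Type*} [NormedAddCommGroup F] [NormedSpace ℝ F] {φ : E3 → F}
    (h : ContDiff ℝ ∞ φ) (i j : Fin 3) : pd i (pd j φ) = pd j (pd i φ) := by
  funext x
  have hd : DifferentiableAt ℝ (fderiv ℝ φ) x :=
    ((h.fderiv_right (m := ∞) (by simp)).differentiable (by simp)) x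
  have e1 : ∀ i j : Fin 3, pd i (pd j φ) x = fderiv ℝ (fderiv ℝ φ) x (e i) (e j) := by
    intro i j
    have h1 : HasFDerivAt (pd j φ)
        ((ContinuousLinearMap.apply ℝ F (e j)).comp (fderiv ℝ (fderiv ℝ φ) x)) x :=
      ((ContinuousLinearMap.apply ℝ F (e j)).hasFDerivAt).comp x hd.hasFDerivAt
    rw [pd, h1.fderiv]
    rfl
  rw [e1, e1]
  have hs : IsSymmSndFDerivAt ℝ φ x := (h.contDiffAt).isSymmSndFDerivAt (by simp; norm_cast)
  exact hs.eq (e i) (e j)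

theorem pd_finsetSum {F ι : Type*} [NormedAddCommGroup F] [NormedSpace ℝ F] (s : Finset ι)
    {φ : ι → E3 → F} (h : ∀ i, Differentiable ℝ (φ i)) (j : Fin 3) (x : E3) :
    pd j (fun x => ∑ i ∈ s, φ i x) x = ∑ i ∈ s, pd j (φ i) x := by
  simp only [pd]
  rw [fderiv_fun_sum fun i _ => h i x]
  simp

theorem pd_smul_const {F : Type*} [NormedAddCommGroup F] [NormedSpace ℝ F] {φ : E3 → ℝ}
    (h : Differentiable ℝ φ) (v : F) (j : Fin 3) (x : E3) :
    pd j (fun x => φ x • v) x = pd j φ x • v := by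
  simp only [pd]
  rw [fderiv_smul_const (h x)]
  simp

theorem IsTestFn.smul_const {F : Type*} [NormedAddCommGroup F] [NormedSpace ℝ F] {φ : E3 → ℝ}
    (h : IsTestFn φ) (v : F) : IsTestFn (fun x => φ x • v) :=
  h.clm_comp (ContinuousLinearMap.toSpanSingleton ℝ v)

/-- The gradient of a scalar function, in coordinates. -/
def gradVec (χ : E3 → ℝ) (x : E3) : E3 := ∑ j, pd j χ x • e j

theorem gradient_eq (χ : E3 → ℝ) (x : E3) : gradient χ x = gradVec χ x := by
  rw [vec_eq_sum (gradient χ x), gradVec]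
  refine Finset.sum_congr rfl fun j _ => ?_
  congr 1
  rw [← inner_e, gradient, InnerProductSpace.toDual_symm_apply, pd]

theorem IsTestFn.gradVec {χ : E3 → ℝ} (h : IsTestFn χ) : IsTestFn (gradVec χ) :=
  IsTestFn.sum _ fun j => (h.pd j).smul_const (e j)

theorem IsTestFn.lap {χ : E3 → ℝ} (h : IsTestFn χ) : IsTestFn (lap χ) :=
  IsTestFn.sum _ fun j => (h.pd j).pd j

theorem e_apply (i j : Fin 3) : e j i = if i = j then 1 else 0 := by
  simp [e]

theorem gradVec_apply (χ : E3 → ℝ) (x : E3) (i : Fin 3) : gradVec χ x i = pd i χ x := by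
  simp [gradVec, e_apply]

/-- `Δχ e_k - ∇∂_kχ`, that is minus the double curl of `χ e_k`. -/
theorem isSolenoidalTest_lap_sub_grad {χ : E3 → ℝ} (h : IsTestFn χ) (k : Fin 3) :
    IsSolenoidalTest (fun x => lap χ x • e k - gradVec (pd k χ) x) := by
  refine ⟨(h.lap.smul_const (e k)).sub (h.pd k).gradVec, fun x => ?_⟩
  have e1 : ∀ j, pd j (fun x => lap χ x • e k - gradVec (pd k χ) x) x j
      = (if j = k then pd k (lap χ) x else 0) - pd j (pd j (pd k χ)) x := fun j => by
    rw [pd_sub (h.lap.smul_const (e k)).differentiable (h.pd k).gradVec.differentiable,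
      pd_smul_const h.lap.differentiable]
    have e2 : pd j (gradVec (pd k χ)) x = gradVec (pd j (pd k χ)) x := by
      have := pd_finsetSum Finset.univ (φ := fun i x => pd i (pd k χ) x • e i)
        (fun i => (((h.pd k).pd i).smul_const (e i)).differentiable) j x
      refine this.trans ?_
      rw [gradVec]
      refine Finset.sum_congr rfl fun i _ => ?_
      rw [pd_smul_const ((h.pd k).pd i).differentiable, pd_comm (h.pd k).smooth]
    rw [e2, PiLp.sub_apply, gradVec_apply, PiLp.smul_apply, e_apply]
    by_cases hj : j = k
    · simp [hj]
    · simp [hj]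
  simp_rw [e1]
  rw [Finset.sum_sub_distrib, Finset.sum_ite_eq' Finset.univ k]
  simp only [Finset.mem_univ, if_true]
  have e3 : pd k (lap χ) x = ∑ j, pd k (pd j (pd j χ)) x :=
    pd_finsetSum Finset.univ (φ := fun j => pd j (pd j χ))
      (fun j => ((h.pd j).pd j).differentiable) k x
  rw [e3, sub_eq_zero]
  refine Finset.sum_congr rfl fun j _ => ?_
  rw [pd_comm (h.pd j).smooth k j, pd_comm h.smooth k j]

theorem inner_gradient_test_solenoidal {g : L2V} {q : E3 → ℝ} (hq : IsTestFn q)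
    (hg : g =ᵐ[volume] fun x => gradient q x) {ψ : E3 → E3} (hψ : IsSolenoidalTest ψ) :
    inner ℝ g (testLp hψ.toIsTestFn) = 0 := by
  refine inner_gradient_solenoidal (p := testLp hq) (fun j => ?_) hψ
  refine (isWeakPartial_testLp hq j).congr EventuallyEq.rfl ?_
  filter_upwards [hg, testLp_coe (hq.pd j)] with x h1 h2
  rw [h1, h2, gradient_eq, gradVec_apply]

theorem inner_gradientSpace_solenoidal {g : L2V} (hg : g ∈ gradientSpace) {ψ : E3 → E3}
    (hψ : IsSolenoidalTest ψ) : inner ℝ g (testLp hψ.toIsTestFn) = 0 := by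
  have hcl : IsClosed {g : L2V | inner ℝ g (testLp hψ.toIsTestFn) = 0} :=
    isClosed_eq (continuous_id.inner continuous_const) continuous_const
  refine closure_minimal (fun g hg => ?_) hcl hg
  induction hg using Submodule.span_induction with
  | mem g hg =>
    obtain ⟨q, h1, h2, h3⟩ := hg
    exact inner_gradient_test_solenoidal ⟨h1, h2⟩ h3 hψ
  | zero => exact inner_zero_left _
  | add a b _ _ ha hb =>
    change inner ℝ (a + b) _ = 0
    rw [inner_add_left, show inner ℝ a _ = (0 : ℝ) from ha, show inner ℝ b _ = (0 : ℝ) from hb,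
      add_zero]
  | smul c a _ ha =>
    change inner ℝ (c • a) _ = 0
    rw [inner_smul_left, show inner ℝ a _ = (0 : ℝ) from ha, mul_zero]

/-- The classes of solenoidal test functions. -/
def solenoidalTests : Submodule ℝ L2V where
  carrier := {w | ∃ (ψ : E3 → E3) (h : IsSolenoidalTest ψ), w = testLp h.toIsTestFn}
  add_mem' := by
    rintro _ _ ⟨φ, h, rfl⟩ ⟨ψ, h', rfl⟩
    refine ⟨_, ⟨h.toIsTestFn.add h'.toIsTestFn, fun x => ?_⟩, (testLp_add _ _).symm⟩
    simp_rw [pd_add h.toIsTestFn.differentiable h'.toIsTestFn.differentiable, PiLp.add_apply,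
      Finset.sum_add_distrib, h.div_eq_zero, h'.div_eq_zero, add_zero]
  zero_mem' := ⟨_, ⟨IsTestFn.zero, fun x => by simp [pd]⟩, testLp_zero.symm⟩
  smul_mem' := by
    rintro c _ ⟨φ, h, rfl⟩
    refine ⟨_, ⟨h.toIsTestFn.const_smul c, fun x => ?_⟩, (testLp_smul _ _).symm⟩
    simp_rw [pd_const_smul h.toIsTestFn.differentiable, PiLp.smul_apply, smul_eq_mul,
      ← Finset.mul_sum, h.div_eq_zero, mul_zero]

/-- A field orthogonal to gradients and to solenoidal test functions vanishes. -/
theorem eq_zero_of_orthogonal {h : L2V} (hg : ∀ g ∈ gradientSpace, inner ℝ h g = 0)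
    (hs : ∀ (ψ : E3 → E3) (hψ : IsSolenoidalTest ψ), inner ℝ h (testLp hψ.toIsTestFn) = 0) :
    h = 0 := by
  have hc : ∀ k, comp k h = 0 := fun k => by
    rw [Lp.eq_zero_iff_ae_eq_zero]
    refine eq_zero_of_weak_lap_eq (Lp.memLp (comp k h)) le_rfl fun χ hχ => ?_
    rw [zero_mul]
    -- Since `h` is orthogonal to both `Δχ e_k - ∇∂_kχ` and the gradient `∇∂_kχ`, it is orthogonal
    -- to `Δχ e_k`. So each component of `h` is weakly harmonic in `L²`, and the Liouville theorem
    -- applies with `λ = 0`.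
    have hsol := isSolenoidalTest_lap_sub_grad hχ k
    have h1 := hs _ hsol
    have h2 : inner ℝ h (testLp (hχ.pd k).gradVec) = 0 := by
      refine hg _ (Submodule.le_topologicalClosure _ (Submodule.subset_span
        ⟨pd k χ, (hχ.pd k).smooth, (hχ.pd k).cpt, ?_⟩))
      filter_upwards [testLp_coe (hχ.pd k).gradVec] with x hx
      rw [hx, gradient_eq]
    have h3 := testLp_sub (hχ.lap.smul_const (e k)) (hχ.pd k).gradVec
    rw [h3, inner_sub_right, h2, sub_zero, inner_testLp] at h1
    rw [← h1]
    refine integral_congr_ae ?_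
    filter_upwards [comp_coe k h] with x hx
    rw [hx, inner_smul_right, inner_e, mul_comm]
  refine Lp.ext ?_
  have c : ∀ᵐ x, ∀ k, comp k h x = h x k := ae_all_iff.2 fun k => comp_coe k h
  filter_upwards [c, Lp.coeFn_zero E3 2 (volume : Measure E3), Lp.coeFn_zero ℝ 2
    (volume : Measure E3)] with x h1 h2 h3
  rw [h2]
  refine PiLp.ext fun k => ?_
  rw [← h1 k, hc k, h3]
  rfl

theorem lerayP_apply (u : L2V) : lerayP u = u - lerayQ u := rfl

theorem inner_lerayP_gradient (u : L2V) {g : L2V} (hg : g ∈ gradientSpace) :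
    inner ℝ (lerayP u) g = 0 :=
  Submodule.starProjection_inner_eq_zero u g hg

theorem inner_lerayP_left (u v : L2V) : inner ℝ (lerayP u) v = inner ℝ u (lerayP v) := by
  have h1 := inner_lerayP_gradient u (lerayQ_mem v)
  have h2 := inner_lerayP_gradient v (lerayQ_mem u)
  have e1 : v = lerayP v + lerayQ v := by rw [lerayP_apply]; abel
  have e2 : u = lerayP u + lerayQ u := by rw [lerayP_apply]; abel
  calc inner ℝ (lerayP u) v = inner ℝ (lerayP u) (lerayP v) := by
        conv_lhs => rw [e1]
        rw [inner_add_right, h1, add_zero]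
    _ = inner ℝ u (lerayP v) := by
        conv_rhs => rw [e2]
        rw [inner_add_left, real_inner_comm _ (lerayQ u), h2, add_zero]

theorem norm_lerayP_le (u : L2V) : ‖lerayP u‖ ≤ ‖u‖ := by
  have h1 := inner_lerayP_gradient u (lerayQ_mem u)
  have e2 : u = lerayP u + lerayQ u := by rw [lerayP_apply]; abel
  have h3 := norm_add_sq_real (lerayP u) (lerayQ u)
  rw [h1, ← e2] at h3
  nlinarith [norm_nonneg u, norm_nonneg (lerayP u), sq_nonneg ‖lerayQ u‖]

/-- The closure of the solenoidal tests is orthogonal to gradients, and so is `ℙz`. The residual of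
the projection of `ℙz` onto this closure is therefore orthogonal to gradients and to solenoidal
tests, hence zero. -/
theorem lerayP_mem_closure (z : L2V) : lerayP z ∈ solenoidalTests.topologicalClosure := by
  set S := solenoidalTests.topologicalClosure
  have : CompleteSpace S := (Submodule.isClosed_topologicalClosure _).completeSpace_coe
  set w := lerayP z
  have hS : ∀ v ∈ S, ∀ g ∈ gradientSpace, inner ℝ v g = 0 := by
    intro v hv g hg
    have hcl : IsClosed {v : L2V | inner ℝ v g = 0} :=
      isClosed_eq (continuous_id.inner continuous_const) continuous_const
    refine closure_minimal (fun v hv => ?_) hcl hv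
    obtain ⟨ψ, hψ, rfl⟩ := hv
    change inner ℝ _ g = 0
    rw [real_inner_comm, inner_gradientSpace_solenoidal hg hψ]
  have h0 : w - S.starProjection w = 0 := by
    refine eq_zero_of_orthogonal (fun g hg => ?_) fun ψ hψ => ?_
    · rw [inner_sub_left, inner_lerayP_gradient z hg,
        hS _ (Submodule.starProjection_apply_mem S w) g hg, sub_zero]
    · exact Submodule.starProjection_inner_eq_zero w _
        (Submodule.le_topologicalClosure _ ⟨ψ, hψ, rfl⟩)
  rw [sub_eq_zero.1 h0]
  exact Submodule.starProjection_apply_mem S w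

theorem exists_solenoidal_approx (z : L2V) {η : ℝ} (hη : 0 < η) :
    ∃ (ψ : E3 → E3) (h : IsSolenoidalTest ψ), ‖lerayP z - testLp h.toIsTestFn‖ < η := by
  obtain ⟨w, ⟨ψ, h, rfl⟩, hw⟩ := Metric.mem_closure_iff.1 (lerayP_mem_closure z) η hη
  exact ⟨ψ, h, by rwa [← dist_eq_norm]⟩

/-! ### Translations -/

/-- Translation by `a` on `L²`. -/
def shift (a : E3) (u : L2V) : L2V :=
  Lp.compMeasurePreserving (fun x => x + a) (measurePreserving_add_right volume a) u

theorem shift_coe (a : E3) (u : L2V) : shift a u =ᵐ[volume] fun x => u (x + a) :=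
  Lp.coeFn_compMeasurePreserving u (measurePreserving_add_right volume a)

theorem shift_add (a : E3) (u v : L2V) : shift a (u + v) = shift a u + shift a v :=
  map_add _ u v

theorem shift_sub (a : E3) (u v : L2V) : shift a (u - v) = shift a u - shift a v :=
  map_sub _ u v

theorem shift_smul (a : E3) (c : ℝ) (u : L2V) : shift a (c • u) = c • shift a u := by
  refine Lp.ext ?_
  have h1 := (measurePreserving_add_right (volume : Measure E3) a).quasiMeasurePreserving.ae
    (Lp.coeFn_smul c u)
  filter_upwards [shift_coe a (c • u), shift_coe a u, Lp.coeFn_smul c (shift a u), h1]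
    with x a1 a2 a3 a4
  rw [a1, a4, a3, Pi.smul_apply, Pi.smul_apply, a2]

theorem continuous_shift (a : E3) : Continuous (shift a) :=
  (Lp.isometry_compMeasurePreserving (measurePreserving_add_right volume a)).continuous

theorem inner_shift (a : E3) (u v : L2V) : inner ℝ (shift a u) v = inner ℝ u (shift (-a) v) := by
  rw [L2.inner_def, L2.inner_def]
  have h1 : ∫ x, inner ℝ (shift a u x) (v x) = ∫ x, inner ℝ (u (x + a)) (v x) := by
    refine integral_congr_ae ?_
    filter_upwards [shift_coe a u] with x hx
    rw [hx]
  have h2 : ∫ x, inner ℝ (u x) (shift (-a) v x) = ∫ x, inner ℝ (u x) (v (x + -a)) := by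
    refine integral_congr_ae ?_
    filter_upwards [shift_coe (-a) v] with x hx
    rw [hx]
  rw [h1, h2, ← integral_add_right_eq_self (fun x => inner ℝ (u x) (v (x + -a))) a]
  simp

theorem shift_mem_gradientSpace (a : E3) {g : L2V} (hg : g ∈ gradientSpace) :
    shift a g ∈ gradientSpace := by
  have hcl : IsClosed {g : L2V | shift a g ∈ gradientSpace} :=
    (Submodule.isClosed_topologicalClosure _).preimage (continuous_shift a)
  refine closure_minimal (fun g hg => ?_) hcl hg
  induction hg using Submodule.span_induction with
  | mem g hg =>
    obtain ⟨q, h1, h2, h3⟩ := hg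
    have hq : IsTestFn (fun x => q (x + a)) := by
      have := (IsTestFn.mk h1 h2).comp_sub (-a)
      simpa using this
    refine Submodule.le_topologicalClosure _ (Submodule.subset_span
      ⟨_, hq.smooth, hq.cpt, ?_⟩)
    have h4 := (measurePreserving_add_right (volume : Measure E3) a).quasiMeasurePreserving.ae h3
    filter_upwards [shift_coe a g, h4] with x b1 b2
    rw [b1, b2]
    simp only [gradient]
    rw [fderiv_comp_add_right]
  | zero =>
    have : shift a 0 = 0 := map_zero _
    change shift a 0 ∈ gradientSpace
    rw [this]; exact Submodule.zero_mem _
  | add u v _ _ hu hv =>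
    change shift a (u + v) ∈ gradientSpace
    rw [shift_add]; exact Submodule.add_mem _ hu hv
  | smul c u _ hu =>
    change shift a (c • u) ∈ gradientSpace
    rw [shift_smul]; exact Submodule.smul_mem _ c hu

/-- The gradient space is invariant under all translations and the adjoint of a translation is its
inverse, so the orthogonal projection commutes with them. -/
theorem lerayP_shift (a : E3) (u : L2V) : lerayP (shift a u) = shift a (lerayP u) := by
  have h1 : lerayQ (shift a u) = shift a (lerayQ u) := by
    refine Submodule.eq_starProjection_of_mem_of_inner_eq_zero
      (shift_mem_gradientSpace a (lerayQ_mem u)) fun g hg => ?_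
    rw [← shift_sub, inner_shift]
    exact inner_lerayP_gradient u (shift_mem_gradientSpace (-a) hg)
  rw [lerayP_apply, h1, lerayP_apply, shift_sub]

/-! ### The translation estimate in `H¹(ℝ³)` -/

theorem norm_sq_eq_sum_comp (v : L2V) : ‖v‖ ^ 2 = ∑ i, ‖comp i v‖ ^ 2 := by
  rw [← real_inner_self_eq_norm_sq, inner_eq_sum_comp]
  simp_rw [real_inner_self_eq_norm_sq]

theorem norm_comp_le (i : Fin 3) (v : L2V) : ‖comp i v‖ ≤ ‖v‖ := by
  have h := norm_sq_eq_sum_comp v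
  have h1 : ‖comp i v‖ ^ 2 ≤ ∑ i, ‖comp i v‖ ^ 2 :=
    Finset.single_le_sum (f := fun i => ‖comp i v‖ ^ 2) (fun _ _ => by positivity)
      (Finset.mem_univ i)
  rw [← h] at h1
  exact le_of_sq_le_sq h1 (norm_nonneg v)

/-- The derivative falls on `f`: `∂ⱼ(f ⋆ φ) = gⱼ ⋆ φ`, which Cauchy–Schwarz bounds uniformly. The
mean value inequality does the rest. -/
theorem abs_conv_sub_le {f : L2S} {g : Fin 3 → L2S} (h : ∀ j, IsWeakPartial j f (g j))
    {φ : E3 → ℝ} (hφ : IsTestFn φ) (a : E3) :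
    |conv f φ a - conv f φ 0| ≤ (∑ j, ‖g j‖) * ‖testLp hφ‖ * ‖a‖ := by
  have hloc : LocallyIntegrable f := (Lp.memLp f).locallyIntegrable (by norm_num)
  have hd : Differentiable ℝ (conv f φ) := (contDiff_conv hloc hφ).differentiable (by simp)
  have hb : ∀ x, ‖fderiv ℝ (conv f φ) x‖ ≤ (∑ j, ‖g j‖) * ‖testLp hφ‖ := by
    intro x
    refine (norm_fderiv_le _ x).trans ?_
    rw [Finset.sum_mul]
    refine Finset.sum_le_sum fun j _ => ?_
    have hφx := hφ.comp_const_sub x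
    have h1 : pd j (conv f φ) x = ∫ y, g j y * φ (x - y) := by
      rw [pd_conv hloc hφ, conv_apply]
      have h2 := h j _ hφx.smooth hφx.cpt
      have h3 : ∀ y, fderiv ℝ (fun y => φ (x - y)) y (e j) = - pd j φ (x - y) := fun y =>
        congrFun (pd_comp_const_sub hφ.differentiable x j) y
      simp_rw [h3, smul_eq_mul, neg_mul, integral_neg, neg_inj] at h2
      simp_rw [mul_comm]
      exact h2
    rw [h1, Real.norm_eq_abs]
    have h4 := abs_integral_mul_le (Lp.memLp (g j)) (hφx.memLp 2)
    have h5 : eLpNorm (fun y => φ (x - y)) 2 (volume : Measure E3) = eLpNorm φ 2 volume :=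
      eLpNorm_comp_measurePreserving hφ.continuous.aestronglyMeasurable
        (Measure.measurePreserving_sub_left volume x)
    rw [h5] at h4
    rwa [Lp.norm_def, testLp, Lp.norm_toLp]
  have := Convex.norm_image_sub_le_of_norm_fderiv_le (𝕜 := ℝ) (f := conv f φ)
    (fun x _ => hd x) (fun x _ => hb x) convex_univ (mem_univ 0) (mem_univ a)
  simpa using this

/-- As a function of `a`, the pairing of the translate with `ψ` is a sum of convolutions with
reflected components of `ψ`, evaluated at `a`. The factor `3` counts the components. -/
theorem abs_inner_shift_sub_le {u : L2V} {Du : Fin 3 → L2V} (h : ∀ j, IsWeakPartial j u (Du j))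
    (a : E3) {ψ : E3 → E3} (hψ : IsTestFn ψ) :
    |inner ℝ (shift a u - u) (testLp hψ)| ≤ 3 * ‖a‖ * (∑ j, ‖Du j‖) * ‖testLp hψ‖ := by
  have hc : ∀ i, IsTestFn (fun x => ψ x i) := fun i =>
    hψ.clm_comp (EuclideanSpace.proj i : E3 →L[ℝ] ℝ)
  have hr : ∀ i, IsTestFn (fun x => ψ (-x) i) := fun i => by
    simpa using (hc i).comp_const_sub 0
  have e1 : ∀ i, comp i (testLp hψ) = testLp (hc i) := fun i => by
    refine Lp.ext ?_
    filter_upwards [comp_coe i (testLp hψ), testLp_coe hψ, testLp_coe (hc i)] with x a b c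
    rw [a, b, c]
  have e2 : ∀ i, ‖testLp (hr i)‖ ≤ ‖testLp hψ‖ := fun i => by
    have : ‖testLp (hr i)‖ = ‖testLp (hc i)‖ := by
      rw [testLp, testLp, Lp.norm_toLp, Lp.norm_toLp]
      congr 1
      exact eLpNorm_comp_measurePreserving (g := fun x => ψ x i)
        (hc i).continuous.aestronglyMeasurable (Measure.measurePreserving_neg volume)
    rw [this, ← e1]
    exact norm_comp_le i _
  have key : inner ℝ (shift a u - u) (testLp hψ) = ∑ i,
      (conv (comp i u) (fun x => ψ (-x) i) a - conv (comp i u) (fun x => ψ (-x) i) 0) := by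
    have k1 : ∀ v : L2V, inner ℝ v (testLp hψ) = ∑ i, ∫ x, comp i v x * ψ x i := fun v => by
      rw [inner_eq_sum_comp]
      refine Finset.sum_congr rfl fun i _ => ?_
      rw [e1, inner_testLp_real]
      simp_rw [mul_comm]
    rw [inner_sub_left, k1, k1, ← Finset.sum_sub_distrib]
    refine Finset.sum_congr rfl fun i _ => ?_
    congr 1
    · rw [conv_apply, ← integral_add_right_eq_self
        (fun y => comp i u y * (fun x => ψ (-x) i) (a - y)) a]
      refine integral_congr_ae ?_
      have h4 := (measurePreserving_add_right (volume : Measure E3)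
        a).quasiMeasurePreserving.ae (comp_coe i u)
      filter_upwards [comp_coe i (shift a u), shift_coe a u, h4] with x b1 b2 b3
      rw [b1, b2, b3]
      simp
    · rw [conv_apply]
      simp
  rw [key]
  calc _ ≤ ∑ i : Fin 3, (∑ j, ‖Du j‖) * ‖testLp hψ‖ * ‖a‖ := by
        refine (Finset.abs_sum_le_sum_abs _ _).trans (Finset.sum_le_sum fun i _ => ?_)
        refine (abs_conv_sub_le (fun j => (h j).comp i) (hr i) a).trans ?_
        gcongr with j
        · exact norm_comp_le i (Du j)
        · exact e2 i
    _ = _ := by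
        simp only [Finset.sum_const, Finset.card_univ, Fintype.card_fin, nsmul_eq_mul]
        push_cast
        ring

theorem norm_le_of_abs_inner_test_le {w : L2V} {K : ℝ} (hK : 0 ≤ K)
    (h : ∀ (ψ : E3 → E3) (hψ : IsTestFn ψ), |inner ℝ w (testLp hψ)| ≤ K * ‖testLp hψ‖) :
    ‖w‖ ≤ K := by
  have hcl : IsClosed {v : L2V | |inner ℝ w v| ≤ K * ‖v‖} :=
    isClosed_le (continuous_const.inner continuous_id).abs (continuous_const.mul continuous_norm)
  have hd := Lp.dense_hasCompactSupport_contDiff (F := E3) (μ := (volume : Measure E3))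
    (p := 2) (by norm_num)
  have hall : |inner ℝ w w| ≤ K * ‖w‖ := by
    refine closure_minimal (fun v hv => ?_) hcl (hd w)
    obtain ⟨g, h1, h2, h3⟩ := hv
    have hg : IsTestFn g := ⟨h3, h2⟩
    have : v = testLp hg := Lp.ext (h1.trans (testLp_coe hg).symm)
    rw [this]
    exact h g hg
  rw [real_inner_self_eq_norm_sq, abs_of_nonneg (by positivity)] at hall
  by_contra hlt
  push Not at hlt
  nlinarith

theorem norm_shift_sub_le {u : L2V} {Du : Fin 3 → L2V} (h : ∀ j, IsWeakPartial j u (Du j))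
    (a : E3) : ‖shift a u - u‖ ≤ 3 * ‖a‖ * ∑ j, ‖Du j‖ :=
  norm_le_of_abs_inner_test_le (by positivity) fun _ hψ => abs_inner_shift_sub_le h a hψ

/-! ### Averages over cubes -/

/-- Half-open cubes of side length `δ`. -/
def cube (δ : ℝ) (κ : Fin 3 → ℤ) : Set E3 :=
  {x | ∀ i, x i ∈ Ico (δ * κ i) (δ * (κ i + 1))}

theorem measurableSet_cube (δ : ℝ) (κ : Fin 3 → ℤ) : MeasurableSet (cube δ κ) := by
  have : cube δ κ = ⋂ i, (fun x : E3 => x i) ⁻¹' Ico (δ * κ i) (δ * (κ i + 1)) := by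
    ext x; simp [cube]
  rw [this]
  refine MeasurableSet.iInter fun i => ?_
  exact measurableSet_Ico.preimage (by fun_prop)

theorem volume_cube {δ : ℝ} (hδ : 0 < δ) (κ : Fin 3 → ℤ) :
    volume (cube δ κ) = ENNReal.ofReal (δ ^ 3) := by
  have h := (EuclideanSpace.volume_preserving_symm_measurableEquiv_toLp (Fin 3)).symm
  have h1 : cube δ κ = (MeasurableEquiv.toLp 2 (Fin 3 → ℝ)).symm ⁻¹'
      (univ.pi fun i => Ico (δ * κ i) (δ * (κ i + 1))) := by
    ext x
    simp [cube]
  rw [h1, (EuclideanSpace.volume_preserving_symm_measurableEquiv_toLp (Fin 3)).measure_preimage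
    (MeasurableSet.univ_pi fun _ => measurableSet_Ico).nullMeasurableSet, Real.volume_pi_Ico]
  have : ∀ i : Fin 3, δ * (κ i + 1) - δ * κ i = δ := fun i => by ring
  simp_rw [this]
  rw [Finset.prod_const, ENNReal.ofReal_pow hδ.le]
  simp

theorem mem_cube_iff {δ : ℝ} (hδ : 0 < δ) (κ : Fin 3 → ℤ) (x : E3) :
    x ∈ cube δ κ ↔ ∀ i, κ i = ⌊x i / δ⌋ := by
  simp only [cube, mem_ofPred_eq, mem_Ico]
  refine forall_congr' fun i => ?_
  rw [eq_comm, Int.floor_eq_iff, le_div_iff₀ hδ, div_lt_iff₀ hδ, mul_comm δ, mul_comm δ]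

theorem pairwise_disjoint_cube {δ : ℝ} (hδ : 0 < δ) : Pairwise (Function.onFun Disjoint (cube δ)) := by
  intro κ κ' hne
  refine Set.disjoint_left.2 fun x h1 h2 => hne ?_
  rw [mem_cube_iff hδ] at h1 h2
  exact funext fun i => (h1 i).trans (h2 i).symm

theorem norm_sub_lt_of_mem_cube {δ : ℝ} (hδ : 0 < δ) {κ : Fin 3 → ℤ} {x y : E3}
    (hx : x ∈ cube δ κ) (hy : y ∈ cube δ κ) : ‖y - x‖ < 2 * δ := by
  have h : ‖y - x‖ ^ 2 ≤ 3 * δ ^ 2 := by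
    rw [EuclideanSpace.norm_sq_eq]
    calc ∑ i, ‖(y - x) i‖ ^ 2 ≤ ∑ i : Fin 3, δ ^ 2 := by
          refine Finset.sum_le_sum fun i _ => ?_
          rw [Real.norm_eq_abs, sq_abs, PiLp.sub_apply]
          have h1 := hx i
          have h2 := hy i
          rw [mem_Ico, mul_add, mul_one] at h1 h2
          exact sq_le_sq' (by linarith) (by linarith)
      _ = 3 * δ ^ 2 := by simp
  by_contra hlt
  push Not at hlt
  nlinarith

theorem lintegral_enorm_sq {α F : Type*} [MeasurableSpace α] [NormedAddCommGroup F]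
    {μ : Measure α} (v : Lp F 2 μ) : ∫⁻ x, ‖v x‖ₑ ^ 2 ∂μ = ‖v‖ₑ ^ 2 := by
  have := eLpNorm_nnreal_pow_eq_lintegral (f := v) (μ := μ) (p := (2 : NNReal)) (by norm_num)
  rw [Lp.enorm_def]
  simpa using this.symm

theorem enorm_integral_sq_le {α F : Type*} [MeasurableSpace α] [NormedAddCommGroup F]
    [NormedSpace ℝ F] {ν : Measure α} [IsProbabilityMeasure ν] {g : α → F}
    (hg : AEStronglyMeasurable g ν) : ‖∫ y, g y ∂ν‖ₑ ^ 2 ≤ ∫⁻ y, ‖g y‖ₑ ^ 2 ∂ν := by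
  have h1 : ‖∫ y, g y ∂ν‖ₑ ≤ eLpNorm g 2 ν := by
    refine (enorm_integral_le_lintegral_enorm g).trans ?_
    rw [← eLpNorm_one_eq_lintegral_enorm]
    exact eLpNorm_le_eLpNorm_of_exponent_le (by norm_num) hg
  have h2 := eLpNorm_nnreal_pow_eq_lintegral (f := g) (μ := ν) (p := (2 : NNReal)) (by norm_num)
  have h3 : eLpNorm g 2 ν ^ 2 = ∫⁻ y, ‖g y‖ₑ ^ 2 ∂ν := by simpa using h2
  rw [← h3]
  exact pow_le_pow_left' h1 2

/-- The average of `v` over a cube. -/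
def cubeAvg (δ : ℝ) (κ : Fin 3 → ℤ) (v : L2V) : E3 := ⨍ y in cube δ κ, v y

/-- Jensen's inequality for the normalised measure on the cube. The cube has diameter at most `√3 δ
< 2δ`, so substituting `y = x + h` bounds the oscillation by an integral of translation increments.
-/
theorem enorm_sub_cubeAvg_sq_le {δ : ℝ} (hδ : 0 < δ) (κ : Fin 3 → ℤ) (v : L2V) {x : E3}
    (hx : x ∈ cube δ κ) :
    ‖v x - cubeAvg δ κ v‖ₑ ^ 2 ≤ (ENNReal.ofReal (δ ^ 3))⁻¹ *
      ∫⁻ h in Metric.ball (0 : E3) (2 * δ), ‖v (x + h) - v x‖ₑ ^ 2 := by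
  have hvol := volume_cube hδ κ
  have h0 : volume (cube δ κ) ≠ 0 := by
    rw [hvol]; simp only [ne_eq, ENNReal.ofReal_eq_zero, not_le]; positivity
  have htop : volume (cube δ κ) ≠ ⊤ := by rw [hvol]; exact ENNReal.ofReal_ne_top
  have hm : Measurable v := (Lp.stronglyMeasurable v).measurable
  set ν := (volume (cube δ κ))⁻¹ • (volume : Measure E3).restrict (cube δ κ) with hν
  have : IsProbabilityMeasure ν := ⟨by
    rw [hν, Measure.smul_apply, Measure.restrict_apply_univ, smul_eq_mul,
      ENNReal.inv_mul_cancel h0 htop]⟩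
  have hint : Integrable v ν := by
    have h1 : IntegrableOn v (cube δ κ) := by
      have : IsFiniteMeasure ((volume : Measure E3).restrict (cube δ κ)) :=
        ⟨by rw [Measure.restrict_apply_univ]; exact htop.lt_top⟩
      exact ((Lp.memLp v).restrict _).integrable (by norm_num)
    exact Integrable.smul_measure h1 (ENNReal.inv_ne_top.2 h0)
  have havg : v x - cubeAvg δ κ v = ∫ y, (v x - v y) ∂ν := by
    rw [integral_sub (integrable_const _) hint, integral_const]
    simp only [probReal_univ, one_smul]
    rw [cubeAvg, average, Measure.restrict_apply_univ]
  rw [havg]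
  refine (enorm_integral_sq_le (aestronglyMeasurable_const.sub hint.aestronglyMeasurable)).trans ?_
  rw [hν, lintegral_smul_measure, hvol, smul_eq_mul]
  gcongr _ * ?_
  rw [← lintegral_indicator (measurableSet_cube δ κ),
    ← lintegral_add_left_eq_self _ x, ← lintegral_indicator measurableSet_ball]
  refine lintegral_mono fun h => ?_
  by_cases hh : x + h ∈ cube δ κ
  · have hb : h ∈ Metric.ball (0 : E3) (2 * δ) := by
      rw [mem_ball_zero_iff]
      have := norm_sub_lt_of_mem_cube hδ hx hh
      rwa [add_sub_cancel_left] at this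
    rw [indicator_of_mem hh, indicator_of_mem hb, Pi.sub_apply, ← enorm_neg, neg_sub]
  · rw [indicator_of_notMem hh]
    exact zero_le

theorem sum_lintegral_sub_cubeAvg_le {δ K : ℝ} (hδ : 0 < δ) (F : Finset (Fin 3 → ℤ)) {v : L2V}
    (hK : ∀ h : E3, ‖shift h v - v‖ ≤ ‖h‖ * K) (hK0 : 0 ≤ K) :
    ∑ κ ∈ F, ∫⁻ x in cube δ κ, ‖v x - cubeAvg δ κ v‖ₑ ^ 2
      ≤ ENNReal.ofReal (32 * (volume (Metric.ball (0 : E3) 1)).toReal * (δ * K) ^ 2) := by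
  have hm : Measurable v := (Lp.stronglyMeasurable v).measurable
  set B := Metric.ball (0 : E3) (2 * δ) with hB
  set c := (ENNReal.ofReal (δ ^ 3))⁻¹ with hc
  have hmeas : Measurable fun z : E3 × E3 => ‖v (z.1 + z.2) - v z.1‖ₑ ^ 2 :=
    (((hm.comp (measurable_fst.add measurable_snd)).sub (hm.comp measurable_fst)).enorm).pow_const 2
  have hin : ∀ h ∈ B, ∫⁻ x, ‖v (x + h) - v x‖ₑ ^ 2 ≤ ENNReal.ofReal (2 * δ * K) ^ 2 := by
    intro h hh
    have e1 : ∫⁻ x, ‖v (x + h) - v x‖ₑ ^ 2 = ‖shift h v - v‖ₑ ^ 2 := by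
      rw [← lintegral_enorm_sq]
      refine lintegral_congr_ae ?_
      filter_upwards [Lp.coeFn_sub (shift h v) v, shift_coe h v] with x a b
      rw [a, Pi.sub_apply, b]
    rw [e1]
    refine pow_le_pow_left' ?_ 2
    rw [← ofReal_norm]
    refine ENNReal.ofReal_le_ofReal ((hK h).trans ?_)
    gcongr
    exact (mem_ball_zero_iff.1 hh).le
  calc ∑ κ ∈ F, ∫⁻ x in cube δ κ, ‖v x - cubeAvg δ κ v‖ₑ ^ 2
      ≤ ∑ κ ∈ F, ∫⁻ x in cube δ κ, c * ∫⁻ h in B, ‖v (x + h) - v x‖ₑ ^ 2 :=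
        Finset.sum_le_sum fun κ _ => setLIntegral_mono' (measurableSet_cube δ κ) fun x hx =>
          enorm_sub_cubeAvg_sq_le hδ κ v hx
    _ = ∫⁻ x in ⋃ κ ∈ F, cube δ κ, c * ∫⁻ h in B, ‖v (x + h) - v x‖ₑ ^ 2 :=
        (lintegral_biUnion_finset (fun κ _ κ' _ hne => pairwise_disjoint_cube hδ hne)
          (fun κ _ => measurableSet_cube δ κ) _).symm
    _ ≤ ∫⁻ x, c * ∫⁻ h in B, ‖v (x + h) - v x‖ₑ ^ 2 := setLIntegral_le_lintegral _ _
    -- After exchanging the integrals the inner one is `‖shift h v - v‖²`, to which the translation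
    -- hypothesis applies.
    _ = c * ∫⁻ h in B, ∫⁻ x, ‖v (x + h) - v x‖ₑ ^ 2 := by
        rw [lintegral_const_mul _ (by
          exact hmeas.lintegral_prod_right'), lintegral_lintegral_swap hmeas.aemeasurable]
    _ ≤ c * ∫⁻ h in B, ENNReal.ofReal (2 * δ * K) ^ 2 := by
        gcongr c * ?_
        exact setLIntegral_mono' measurableSet_ball hin
    -- `32 = 2³ · 2²`: the ball has volume `(2δ)³|B₁|`, the increment is at most `2δK`, and `c =
    -- δ⁻³`.
    _ = ENNReal.ofReal (32 * (volume (Metric.ball (0 : E3) 1)).toReal * (δ * K) ^ 2) := by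
        have hb1 : volume (Metric.ball (0 : E3) 1) ≠ ⊤ := measure_ball_lt_top.ne
        rw [setLIntegral_const, hB, Measure.addHaar_ball _ _ (by positivity), hc,
          ← ENNReal.ofReal_toReal hb1, ← ENNReal.ofReal_pow (by positivity),
          ← ENNReal.ofReal_mul (by positivity), ← ENNReal.ofReal_mul (by positivity),
          ← ENNReal.ofReal_inv_of_pos (by positivity), ← ENNReal.ofReal_mul (by positivity),
          ENNReal.toReal_ofReal ENNReal.toReal_nonneg]
        congr 1
        simp only [finrank_euclideanSpace, Fintype.card_fin]
        field_simp
        ring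

/-! ### Finite rank approximation of localised `H¹` fields -/

/-- Multiplication by a bounded function. -/
def mulBdd {k : E3 → ℝ} (hk : MemLp k ⊤ (volume : Measure E3)) : L2V →L[ℝ] L2V :=
  (ContinuousLinearMap.lsmul ℝ ℝ : ℝ →L[ℝ] E3 →L[ℝ] E3).holderL (volume : Measure E3)
    ∞ 2 2 (hk.toLp k)

theorem mulBdd_coe {k : E3 → ℝ} (hk : MemLp k ⊤ (volume : Measure E3)) (u : L2V) :
    mulBdd hk u =ᵐ[volume] fun x => k x • u x := by
  have h1 := (ContinuousLinearMap.lsmul ℝ ℝ : ℝ →L[ℝ] E3 →L[ℝ] E3).coeFn_holder (r := 2)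
    (hk.toLp k) u
  filter_upwards [h1, hk.coeFn_toLp] with x a b
  rw [← b]
  exact a

theorem one_add_norm_sq_inv_le (x : E3) : (1 + ‖x‖ ^ 2)⁻¹ ≤ 1 :=
  inv_le_one_of_one_le₀ (by nlinarith [sq_nonneg ‖x‖])

theorem memLp_top_weight : MemLp (fun x : E3 => (1 + ‖x‖ ^ 2)⁻¹) ⊤ (volume : Measure E3) :=
  memLp_top_of_bound (C := 1)
    (Measurable.aestronglyMeasurable (by fun_prop))
    (Eventually.of_forall fun x => by
      rw [Real.norm_eq_abs, abs_of_nonneg (by positivity)]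
      exact one_add_norm_sq_inv_le x)

/-- Multiplication by the weight `(1 + |x|²)⁻¹`. -/
def weight : L2V →L[ℝ] L2V := mulBdd memLp_top_weight

theorem weight_coe (u : L2V) : weight u =ᵐ[volume] fun x => (1 + ‖x‖ ^ 2)⁻¹ • u x :=
  mulBdd_coe _ u

theorem volume_cube_ne_top {δ : ℝ} (hδ : 0 < δ) (κ : Fin 3 → ℤ) : volume (cube δ κ) ≠ ⊤ := by
  rw [volume_cube hδ κ]; exact ENNReal.ofReal_ne_top

/-- The vector field `e i` on a cube, extended by zero. -/
def cubeVec {δ : ℝ} (hδ : 0 < δ) (κ : Fin 3 → ℤ) (i : Fin 3) : L2V :=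
  indicatorConstLp 2 (measurableSet_cube δ κ) (volume_cube_ne_top hδ κ) (e i)

theorem cubeVec_coe {δ : ℝ} (hδ : 0 < δ) (κ : Fin 3 → ℤ) (i : Fin 3) :
    cubeVec hδ κ i =ᵐ[volume] (cube δ κ).indicator fun _ => e i :=
  indicatorConstLp_coeFn

theorem cubeAvg_eq {δ : ℝ} (hδ : 0 < δ) (κ : Fin 3 → ℤ) (v : L2V) :
    cubeAvg δ κ v = ∑ i, ((δ ^ 3)⁻¹ * inner ℝ v (cubeVec hδ κ i)) • e i := by
  have hint : IntegrableOn v (cube δ κ) := by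
    have : IsFiniteMeasure ((volume : Measure E3).restrict (cube δ κ)) :=
      ⟨by rw [Measure.restrict_apply_univ]; exact (volume_cube_ne_top hδ κ).lt_top⟩
    exact ((Lp.memLp v).restrict _).integrable (by norm_num)
  rw [vec_eq_sum (cubeAvg δ κ v)]
  refine Finset.sum_congr rfl fun i _ => ?_
  congr 1
  rw [cubeVec, real_inner_comm, L2.inner_indicatorConstLp_eq_inner_setIntegral, real_inner_comm, inner_e,
    cubeAvg, setAverage_eq, PiLp.smul_apply, smul_eq_mul, measureReal_def, volume_cube hδ,
    ENNReal.toReal_ofReal (by positivity)]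

theorem exists_cubes_cover {δ : ℝ} (hδ : 0 < δ) {η : ℝ} (hη : 0 < η) :
    ∃ F : Finset (Fin 3 → ℤ), ∀ x : E3, (∃ κ ∈ F, x ∈ cube δ κ) ∨ (1 + ‖x‖ ^ 2)⁻¹ ≤ η := by
  obtain ⟨N, hN⟩ := exists_nat_ge (1 / (η * δ))
  refine ⟨Finset.Icc (fun _ => -(N : ℤ)) (fun _ => (N : ℤ)), fun x => ?_⟩
  by_cases h : (fun i => ⌊x i / δ⌋) ∈ Finset.Icc (fun _ : Fin 3 => -(N : ℤ)) (fun _ => (N : ℤ))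
  · exact Or.inl ⟨_, h, (mem_cube_iff hδ _ x).2 fun i => rfl⟩
  · right
    rw [Finset.mem_Icc, Pi.le_def, Pi.le_def, ← forall_and] at h
    push Not at h
    obtain ⟨i, hi⟩ := h
    have h1 : (N : ℝ) ≤ |x i / δ| := by
      by_cases h2 : -(N : ℤ) ≤ ⌊x i / δ⌋
      -- A floor above `N` or below `-N` forces `|xᵢ| ≥ Nδ ≥ 1/η`; then `1 + |x|² ≥ |x| ≥ 1/η`.
      · have h3 := hi h2
        have h4 : ((N : ℤ) : ℝ) ≤ x i / δ := Int.le_floor.1 h3.le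
        exact (by exact_mod_cast h4 : (N : ℝ) ≤ x i / δ).trans (le_abs_self _)
      · rw [not_le, Int.floor_lt] at h2
        push_cast at h2
        rw [le_abs]; right; linarith
    have h2 : 1 / η ≤ ‖x‖ := by
      have h5 : |x i| ≤ ‖x‖ := PiLp.norm_apply_le x i
      rw [abs_div, abs_of_pos hδ] at h1
      have h6 := hN.trans h1
      rw [le_div_iff₀ hδ] at h6
      refine le_trans (le_of_eq ?_) (h6.trans h5)
      field_simp
    rw [inv_le_comm₀ (by positivity) hη, ← one_div]
    nlinarith [sq_nonneg (‖x‖ - 1), norm_nonneg x]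

/-- The approximant is the weight times the field of cube averages over finitely many cubes. On
these cubes the translation modulus controls the error; off them the weight itself is at most `η`.
The finite rank data depend on `η` only, not on `v`. -/
theorem exists_finite_rank_approx {η : ℝ} (hη : 0 < η) :
    ∃ (s : Finset ((Fin 3 → ℤ) × Fin 3)) (b z : (Fin 3 → ℤ) × Fin 3 → L2V),
      ∀ (v : L2V) (K : ℝ), 0 ≤ K → (∀ h : E3, ‖shift h v - v‖ ≤ ‖h‖ * K) →
        ‖weight v - ∑ l ∈ s, inner ℝ v (b l) • z l‖ ≤ η * (‖v‖ + K) := by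
  set V := 32 * (volume (Metric.ball (0 : E3) 1)).toReal with hV
  have hV0 : 0 ≤ V := by positivity
  -- This side length makes the squared oscillation error `V(δK)²` at most `(ηK)²`.
  set δ := η / (1 + V) with hδd
  have hδ : 0 < δ := by positivity
  have hVδ : V * δ ^ 2 ≤ η ^ 2 := by
    rw [hδd, div_pow, mul_div_assoc', div_le_iff₀ (by positivity)]
    nlinarith [sq_nonneg η, sq_nonneg V, mul_nonneg (sq_nonneg η) hV0,
      mul_nonneg (sq_nonneg η) (sq_nonneg V)]
  obtain ⟨F, hF⟩ := exists_cubes_cover hδ hη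
  refine ⟨F ×ˢ Finset.univ, fun l => cubeVec hδ l.1 l.2,
    fun l => (δ ^ 3)⁻¹ • weight (cubeVec hδ l.1 l.2), fun v K hK0 hK => ?_⟩
  set P : L2V := ∑ κ ∈ F, ∑ i, ((δ ^ 3)⁻¹ * inner ℝ v (cubeVec hδ κ i)) • cubeVec hδ κ i with hP
  have e1 : weight v - ∑ l ∈ F ×ˢ Finset.univ, inner ℝ v (cubeVec hδ l.1 l.2) •
      (δ ^ 3)⁻¹ • weight (cubeVec hδ l.1 l.2) = weight (v - P) := by
    rw [map_sub, hP, Finset.sum_product, map_sum]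
    congr 1
    refine Finset.sum_congr rfl fun κ _ => ?_
    rw [map_sum]
    refine Finset.sum_congr rfl fun i _ => ?_
    rw [map_smul, smul_smul, mul_comm]
  rw [e1]
  have hPx : ∀ᵐ x, P x = ∑ κ ∈ F, (cube δ κ).indicator (fun _ => cubeAvg δ κ v) x := by
    have c1 : ∀ᵐ x, ∀ κ i, cubeVec hδ κ i x = (cube δ κ).indicator (fun _ => e i) x :=
      ae_all_iff.2 fun κ => ae_all_iff.2 fun i => cubeVec_coe hδ κ i
    have c2 : P =ᵐ[volume] fun x => ∑ κ ∈ F, (∑ i, ((δ ^ 3)⁻¹ * inner ℝ v (cubeVec hδ κ i)) •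
        cubeVec hδ κ i : L2V) x := by
      filter_upwards [Lp.coeFn_finsetSum F fun κ => (∑ i, ((δ ^ 3)⁻¹ *
        inner ℝ v (cubeVec hδ κ i)) • cubeVec hδ κ i : L2V)] with x hx
      rw [hP, hx, Finset.sum_apply]
    have c3 : ∀ᵐ x, ∀ κ, (∑ i, ((δ ^ 3)⁻¹ * inner ℝ v (cubeVec hδ κ i)) •
        cubeVec hδ κ i : L2V) x = ∑ i, (((δ ^ 3)⁻¹ * inner ℝ v (cubeVec hδ κ i)) •
        cubeVec hδ κ i : L2V) x := by
      refine ae_all_iff.2 fun κ => ?_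
      filter_upwards [Lp.coeFn_finsetSum Finset.univ fun i => (((δ ^ 3)⁻¹ *
        inner ℝ v (cubeVec hδ κ i)) • cubeVec hδ κ i : L2V)] with x hx
      rw [hx, Finset.sum_apply]
    have c4 : ∀ᵐ x, ∀ κ i, (((δ ^ 3)⁻¹ * inner ℝ v (cubeVec hδ κ i)) •
        cubeVec hδ κ i : L2V) x = ((δ ^ 3)⁻¹ * inner ℝ v (cubeVec hδ κ i)) •
        cubeVec hδ κ i x := by
      refine ae_all_iff.2 fun κ => ae_all_iff.2 fun i => ?_
      filter_upwards [Lp.coeFn_smul ((δ ^ 3)⁻¹ * inner ℝ v (cubeVec hδ κ i))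
        (cubeVec hδ κ i)] with x hx
      rw [hx, Pi.smul_apply]
    filter_upwards [c1, c2, c3, c4] with x h1 h2 h3 h4
    rw [h2]
    refine Finset.sum_congr rfl fun κ _ => ?_
    rw [h3]
    simp_rw [h4, h1]
    by_cases hx : x ∈ cube δ κ
    · simp_rw [indicator_of_mem hx]
      exact (cubeAvg_eq hδ κ v).symm
    · simp_rw [indicator_of_notMem hx, smul_zero, Finset.sum_const_zero]
  have hpt : ∀ᵐ x, ‖weight (v - P) x‖ₑ ^ 2 ≤
      ∑ κ ∈ F, (cube δ κ).indicator (fun x => ‖v x - cubeAvg δ κ v‖ₑ ^ 2) x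
        + ENNReal.ofReal η ^ 2 * ‖v x‖ₑ ^ 2 := by
    filter_upwards [hPx, weight_coe (v - P), Lp.coeFn_sub v P] with x h1 h2 h3
    rw [h2, h3, Pi.sub_apply, h1, enorm_smul, mul_pow,
      Real.enorm_eq_ofReal (by positivity : (0 : ℝ) ≤ (1 + ‖x‖ ^ 2)⁻¹)]
    by_cases hx : ∃ κ ∈ F, x ∈ cube δ κ
    · obtain ⟨κ, hκ, hxκ⟩ := hx
      have hother : ∀ κ' ∈ F, κ' ≠ κ → x ∉ cube δ κ' := fun κ' _ hne hx' =>
        Set.disjoint_left.1 (pairwise_disjoint_cube hδ hne) hx' hxκ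
      rw [Finset.sum_eq_single κ (fun κ' a b => indicator_of_notMem (hother κ' a b) _)
          (fun h => absurd hκ h), Finset.sum_eq_single κ
          (fun κ' a b => indicator_of_notMem (hother κ' a b) _) (fun h => absurd hκ h),
        indicator_of_mem hxκ, indicator_of_mem hxκ]
      refine le_trans ?_ le_self_add
      have : ENNReal.ofReal (1 + ‖x‖ ^ 2)⁻¹ ≤ 1 :=
        ENNReal.ofReal_le_one.2 (one_add_norm_sq_inv_le x)
      calc _ ≤ 1 ^ 2 * ‖v x - cubeAvg δ κ v‖ₑ ^ 2 := by gcongr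
        _ = _ := by rw [one_pow, one_mul]
    · have hle := (hF x).resolve_left hx
      push Not at hx
      rw [Finset.sum_eq_zero fun κ hκ => indicator_of_notMem (hx κ hκ) _, sub_zero]
      refine le_trans ?_ le_add_self
      gcongr
  have hfin : ‖weight (v - P)‖ₑ ^ 2 ≤ ENNReal.ofReal ((η * (‖v‖ + K)) ^ 2) := by
    have hm : Measurable v := (Lp.stronglyMeasurable v).measurable
    rw [← lintegral_enorm_sq]
    calc _ ≤ ∫⁻ x, (∑ κ ∈ F, (cube δ κ).indicator (fun x => ‖v x - cubeAvg δ κ v‖ₑ ^ 2) x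
        + ENNReal.ofReal η ^ 2 * ‖v x‖ₑ ^ 2) := lintegral_mono_ae hpt
      _ = (∑ κ ∈ F, ∫⁻ x in cube δ κ, ‖v x - cubeAvg δ κ v‖ₑ ^ 2)
          + ENNReal.ofReal η ^ 2 * ‖v‖ₑ ^ 2 := by
        have hme : ∀ κ, Measurable fun x => ‖v x - cubeAvg δ κ v‖ₑ ^ 2 := fun κ =>
          ((hm.sub_const _).enorm).pow_const 2
        rw [lintegral_add_right _ ((hm.enorm.pow_const 2).const_mul _),
          lintegral_const_mul _ (hm.enorm.pow_const 2), lintegral_enorm_sq,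
          lintegral_finsetSum _ fun κ _ => (hme κ).indicator (measurableSet_cube δ κ)]
        simp_rw [lintegral_indicator (measurableSet_cube δ _)]
      _ ≤ ENNReal.ofReal (V * (δ * K) ^ 2) + ENNReal.ofReal η ^ 2 * ‖v‖ₑ ^ 2 := by
        exact add_le_add (sum_lintegral_sub_cubeAvg_le hδ F hK hK0) le_rfl
      _ = ENNReal.ofReal (V * (δ * K) ^ 2 + η ^ 2 * ‖v‖ ^ 2) := by
        rw [← ofReal_norm, ← ENNReal.ofReal_pow hη.le, ← ENNReal.ofReal_pow (norm_nonneg _),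
          ← ENNReal.ofReal_mul (by positivity), ← ENNReal.ofReal_add (by positivity)
          (by positivity)]
      _ ≤ _ := by
        refine ENNReal.ofReal_le_ofReal ?_
        have h1 : V * (δ * K) ^ 2 ≤ η ^ 2 * K ^ 2 := by
          rw [mul_pow, ← mul_assoc]; gcongr
        nlinarith [mul_nonneg (sq_nonneg η) (mul_nonneg (norm_nonneg v) hK0)]
  rw [← ofReal_norm, ← ENNReal.ofReal_pow (norm_nonneg _),
    ENNReal.ofReal_le_ofReal_iff (by positivity)] at hfin
  exact le_of_sq_le_sq hfin (by positivity)

/-- Localised solenoidal parts of `H¹` fields are approximated by finite rank operators which only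
use moments against solenoidal test functions. -/
theorem exists_solenoidal_finite_rank_approx {η : ℝ} (hη : 0 < η) :
    ∃ (s : Finset ((Fin 3 → ℤ) × Fin 3)) (ψ : (Fin 3 → ℤ) × Fin 3 → E3 → E3)
      (hψ : ∀ l, IsSolenoidalTest (ψ l)) (z : (Fin 3 → ℤ) × Fin 3 → L2V),
      ∀ (u : L2V) (Du : Fin 3 → L2V), (∀ j, IsWeakPartial j u (Du j)) →
        ‖weight (lerayP u) - ∑ l ∈ s, inner ℝ u (testLp (hψ l).toIsTestFn) • z l‖
          ≤ η * (‖u‖ + ∑ j, ‖Du j‖) := by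
  -- The translation modulus of `ℙu` carries a factor `3`, so `η/6` leaves half of the error for
  -- replacing the projected `b l` by solenoidal tests. The choice of `ρ` keeps the total cost of
  -- that replacement below `η/2 ‖u‖`.
  obtain ⟨s, b, z, hs⟩ := exists_finite_rank_approx (η := η / 6) (by positivity)
  have hZ : 0 ≤ ∑ l ∈ s, ‖z l‖ := by positivity
  set ρ := η / 2 / (1 + ∑ l ∈ s, ‖z l‖) with hρ
  have hρ0 : 0 < ρ := by positivity
  choose ψ hψ hlt using fun l => exists_solenoidal_approx (b l) hρ0
  refine ⟨s, ψ, hψ, z, fun u Du h => ?_⟩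
  have h1 := hs (lerayP u) (3 * ∑ j, ‖Du j‖) (by positivity) fun a => by
    rw [← lerayP_shift, ← map_sub]
    refine (norm_lerayP_le _).trans ((norm_shift_sub_le h a).trans (le_of_eq ?_))
    ring
  have h2 : ‖∑ l ∈ s, inner ℝ (lerayP u) (b l) • z l
      - ∑ l ∈ s, inner ℝ u (testLp (hψ l).toIsTestFn) • z l‖ ≤ η / 2 * ‖u‖ := by
    rw [← Finset.sum_sub_distrib]
    calc _ ≤ ∑ l ∈ s, ‖u‖ * ρ * ‖z l‖ := by
          refine (norm_sum_le _ _).trans (Finset.sum_le_sum fun l _ => ?_)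
          rw [← sub_smul, inner_lerayP_left, ← inner_sub_right, norm_smul]
          gcongr
          exact (norm_inner_le_norm _ _).trans (by gcongr; exact (hlt l).le)
      _ = ‖u‖ * (ρ * ∑ l ∈ s, ‖z l‖) := by rw [← Finset.mul_sum, mul_assoc]
      _ ≤ ‖u‖ * (η / 2) := by
          gcongr
          rw [hρ, div_mul_eq_mul_div, div_le_iff₀ (by positivity)]
          nlinarith
      _ = _ := mul_comm _ _
  have h3 := norm_lerayP_le u
  have h4 : 0 ≤ ∑ j, ‖Du j‖ := Finset.sum_nonneg fun j _ => norm_nonneg (Du j)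
  generalize weight (lerayP u) = a₁ at h1 ⊢
  generalize ∑ l ∈ s, inner ℝ (lerayP u) (b l) • z l = a₂ at h1 h2
  generalize ∑ l ∈ s, inner ℝ u (testLp (hψ l).toIsTestFn) • z l = a₃ at h2 ⊢
  calc ‖a₁ - a₃‖ ≤ ‖a₁ - a₂‖ + ‖a₂ - a₃‖ := norm_sub_le_norm_sub_add_norm_sub a₁ a₂ a₃
    _ ≤ η / 6 * (‖u‖ + 3 * ∑ j, ‖Du j‖) + η / 2 * ‖u‖ := by
        refine add_le_add (h1.trans ?_) h2
        gcongr
    _ ≤ _ := by nlinarith [norm_nonneg u, mul_nonneg hη.le (norm_nonneg u), mul_nonneg hη.le h4]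

/-! ### Compactness in time -/

instance isFiniteMeasure_timeMeasure (T : ℝ) : IsFiniteMeasure (timeMeasure T) := by
  unfold timeMeasure; infer_instance

theorem totallyBounded_of_approx {α : Type*} [PseudoMetricSpace α] {S : Set α}
    (h : ∀ η > 0, ∃ K : Set α, IsCompact K ∧ ∀ x ∈ S, ∃ y ∈ K, dist x y < η) :
    TotallyBounded S := by
  rw [Metric.totallyBounded_iff]
  intro ε hε
  obtain ⟨K, hK, hS⟩ := h (ε / 2) (half_pos hε)
  obtain ⟨t, ht, hcov⟩ := Metric.totallyBounded_iff.1 hK.totallyBounded (ε / 2) (half_pos hε)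
  refine ⟨t, ht, fun x hx => ?_⟩
  obtain ⟨y, hy, hxy⟩ := hS x hx
  obtain ⟨z, hz, hyz⟩ := mem_iUnion₂.1 (hcov hy)
  refine mem_iUnion₂.2 ⟨z, hz, ?_⟩
  rw [Metric.mem_ball] at hyz ⊢
  linarith [dist_triangle x y z]

/-- A uniformly bounded and equicontinuous family of functions on `[0,T]` is precompact in
`L²(0,T)`. -/
theorem totallyBounded_of_equicontinuous {T : ℝ} (hT : 0 < T) {M K : ℝ} (hK : 0 ≤ K)
    {A : Set (Lp ℝ 2 (timeMeasure T))}
    (hA : ∀ a ∈ A, ∃ c : ℝ → ℝ, a =ᵐ[timeMeasure T] c ∧ (∀ t ∈ Icc 0 T, |c t| ≤ M) ∧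
      ∀ s t r : ℝ, 0 ≤ s → s ≤ t → t ≤ T → 0 < r → |c t - c s| ≤ K * (r + (t - s) / r)) :
    TotallyBounded A := by
  refine totallyBounded_of_approx fun η hη => ?_
  -- `D` is the constant in `‖·‖_{L²} ≤ D ‖·‖_{L^∞}`. Below, cells of length `δ ≤ r²` make the
  -- modulus `K(r + δ/r) ≤ 2Kr ≤ ρ`. The cells number `N + 1` because `t = T` falls into the one
  -- with index `N`.
  set D : ℝ := (measureUnivNNReal (timeMeasure T) : ℝ) ^ ((2 : ℝ≥0∞).toReal⁻¹) with hD
  have hD0 : 0 ≤ D := by positivity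
  set ρ := η / 2 / (D + 1) with hρ
  have hρ0 : 0 < ρ := by positivity
  set r := ρ / 2 / (K + 1) with hr
  have hr0 : 0 < r := by positivity
  obtain ⟨N, hN⟩ := exists_nat_gt (T / r ^ 2)
  have hN0 : (0 : ℝ) < N := lt_trans (by positivity) hN
  set δ := T / N with hδ
  have hδ0 : 0 < δ := by positivity
  have hδr : δ ≤ r ^ 2 := by
    rw [div_lt_iff₀ (by positivity)] at hN
    rw [hδ, div_le_iff₀ hN0]
    linarith
  set cell : ℕ → Set ℝ := fun k => Ico (k * δ) ((k + 1) * δ) with hcell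
  have hmc : ∀ k, MeasurableSet (cell k) := fun k => measurableSet_Ico
  have hmem : ∀ {k : ℕ} {t : ℝ}, 0 ≤ t → (t ∈ cell k ↔ k = ⌊t / δ⌋₊) := fun {k t} ht => by
    rw [eq_comm, Nat.floor_eq_iff (by positivity), le_div_iff₀ hδ0, div_lt_iff₀ hδ0]
    rfl
  set Φ : (ℕ → ℝ) → Lp ℝ 2 (timeMeasure T) := fun x => ∑ k ∈ Finset.range (N + 1),
    x k • indicatorConstLp 2 (hmc k) (measure_ne_top _ _) (1 : ℝ) with hΦ
  have hΦc : Continuous Φ :=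
    continuous_finsetSum _ fun k _ => (continuous_apply k).smul continuous_const
  refine ⟨Φ '' univ.pi fun _ => Icc (-M) M,
    (isCompact_univ_pi fun _ => isCompact_Icc).image hΦc, fun a ha => ?_⟩
  obtain ⟨c, hac, hcM, hcK⟩ := hA a ha
  have hkT : ∀ k : ℕ, min (k * δ) T ∈ Icc 0 T := fun k =>
    ⟨le_min (by positivity) hT.le, min_le_right _ _⟩
  -- The parameter space is a product over all `k`, and `c` is bounded only on `[0,T]`, hence the
  -- truncation at `T`.
  set x : ℕ → ℝ := fun k => c (min (k * δ) T) with hx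
  refine ⟨Φ x, ⟨x, fun k _ => abs_le.1 (hcM _ (hkT k)), rfl⟩, ?_⟩
  have hΦx : ∀ᵐ t ∂timeMeasure T, Φ x t
      = ∑ k ∈ Finset.range (N + 1), x k * (cell k).indicator (fun _ => (1 : ℝ)) t := by
    have c1 : ∀ᵐ t ∂timeMeasure T, ∀ k : ℕ, (x k • indicatorConstLp 2 (hmc k)
        (measure_ne_top (timeMeasure T) _) (1 : ℝ) : Lp ℝ 2 (timeMeasure T)) t
          = x k * (cell k).indicator (fun _ => (1 : ℝ)) t := by
      refine ae_all_iff.2 fun k => ?_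
      filter_upwards [Lp.coeFn_smul (x k) (indicatorConstLp 2 (hmc k)
        (measure_ne_top (timeMeasure T) _) (1 : ℝ)), indicatorConstLp_coeFn (p := 2) (hs := hmc k)
        (hμs := measure_ne_top (timeMeasure T) _) (c := (1 : ℝ))] with t h1 h2
      rw [h1, Pi.smul_apply, h2, smul_eq_mul]
    filter_upwards [c1, Lp.coeFn_finsetSum (Finset.range (N + 1)) fun k => (x k • indicatorConstLp 2
      (hmc k) (measure_ne_top (timeMeasure T) _) (1 : ℝ) : Lp ℝ 2 (timeMeasure T))] with t h1 h2
    rw [hΦ, h2, Finset.sum_apply]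
    exact Finset.sum_congr rfl fun k _ => h1 k
  have hbound : ∀ᵐ t ∂timeMeasure T, ‖(a - Φ x : Lp ℝ 2 (timeMeasure T)) t‖ ≤ ρ := by
    filter_upwards [hac, hΦx, Lp.coeFn_sub a (Φ x),
      (ae_restrict_mem measurableSet_Icc : ∀ᵐ t ∂timeMeasure T, t ∈ Icc 0 T)] with t h1 h2 h3 ht
    have hkN : ⌊t / δ⌋₊ ∈ Finset.range (N + 1) := by
      rw [Finset.mem_range, Nat.lt_succ_iff]
      refine Nat.floor_le_of_le ?_
      rw [div_le_iff₀ hδ0, hδ, mul_div_cancel₀ _ hN0.ne']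
      exact ht.2
    have hin := (hmem (k := ⌊t / δ⌋₊) ht.1).2 rfl
    rw [h3, Pi.sub_apply, h1, h2, Finset.sum_eq_single ⌊t / δ⌋₊
      (fun k _ hne => by rw [indicator_of_notMem fun h => hne ((hmem ht.1).1 h), mul_zero])
      (fun h => absurd hkN h), indicator_of_mem hin, mul_one, Real.norm_eq_abs]
    have h4 : min (⌊t / δ⌋₊ * δ) T = ⌊t / δ⌋₊ * δ := min_eq_left (hin.1.trans ht.2)
    simp only [hx, h4]
    refine (hcK _ t r (by positivity) hin.1 ht.2 hr0).trans ?_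
    have h5 : (t - ⌊t / δ⌋₊ * δ) / r ≤ r := by
      rw [div_le_iff₀ hr0]
      have := hin.2
      nlinarith
    calc _ ≤ K * (r + r) := by gcongr
      _ ≤ (K + 1) * (r + r) := by nlinarith
      _ = ρ := by rw [hr]; field_simp; ring
  rw [dist_eq_norm]
  refine (Lp.norm_le_of_ae_bound hρ0.le hbound).trans_lt ?_
  rw [← hD]
  calc D * ρ ≤ (D + 1) * ρ := by nlinarith
    _ = η / 2 := by rw [hρ]; field_simp
    _ < η := half_lt_self hη

/-- The a priori bounds shared by all solutions under consideration: `u` obeys the energy bound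
`E`, starts in a ball of radius `B`, and solves the momentum equation tested against solenoidal
fields. -/
def IsBoundedFlow (T E B : ℝ) (u : ℝ → L2V) : Prop :=
  ∃ (u₀ : L2V) (p : ℝ → L2S) (Du : ℝ → Fin 3 → L2V), InEnergyClass T u p Du ∧ ‖u₀‖ ≤ B ∧
    (∀ᵐ t ∂timeMeasure T, ‖u t‖ ^ 2 ≤ 2 * E) ∧ (∫ s in Icc 0 T, ∑ j, ‖Du s j‖ ^ 2) ≤ E ∧
    ∀ (ψ : E3 → E3) (hψ : IsSolenoidalTest ψ), ∀ᵐ t ∂timeMeasure T,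
      inner ℝ (u t) (testLp hψ.toIsTestFn) = inner ℝ u₀ (testLp hψ.toIsTestFn)
        - ∫ s in (0 : ℝ)..t, momentumFlux hψ.toIsTestFn (u s) (Du s)

theorem integrable_sum_norm_sq {T : ℝ} {Du : ℝ → Fin 3 → L2V}
    (h : ∀ j, MemLp (fun t => Du t j) 2 (timeMeasure T)) :
    Integrable (fun t => ∑ j, ‖Du t j‖ ^ 2) (timeMeasure T) :=
  integrable_finsetSum _ fun j _ => (h j).integrable_norm_pow (by norm_num)

/-- Young's inequality with a free `r`. Integrated over `[s,t]` it yields `rE + 3(t - s)/r`, which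
serves as a modulus of continuity in place of Cauchy–Schwarz in time. -/
theorem sum_norm_le {G : Fin 3 → L2V} {r : ℝ} (hr : 0 < r) :
    ∑ j, ‖G j‖ ≤ r * ∑ j, ‖G j‖ ^ 2 + 3 / r := by
  have h : ∀ j, ‖G j‖ ≤ r * ‖G j‖ ^ 2 + 1 / r := fun j => by
    have h1 : 0 ≤ (r * ‖G j‖ - 1) ^ 2 := sq_nonneg _
    rw [← sub_nonneg]
    have h2 : r * ‖G j‖ ^ 2 + 1 / r - ‖G j‖
        = ((r * ‖G j‖ - 1) ^ 2 + r * ‖G j‖) / r := by field_simp; ring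
    rw [h2]
    positivity
  calc _ ≤ ∑ j, (r * ‖G j‖ ^ 2 + 1 / r) := Finset.sum_le_sum fun j _ => h j
    _ = _ := by
      rw [Finset.sum_add_distrib, ← Finset.mul_sum]
      simp only [Finset.sum_const, Finset.card_univ, Fintype.card_fin, nsmul_eq_mul]
      push_cast
      ring

/-- The continuous representative `c` of the moment is the primitive of the flux given by the
momentum equation. The flux is at most a constant times `∑ ‖Du j‖`, whose time integrals are
uniformly small on short intervals. -/
theorem exists_moment_bounds {T E B : ℝ} (hT : 0 < T) (hE : 0 ≤ E) {ψ : E3 → E3}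
    (hψ : IsSolenoidalTest ψ) :
    ∃ M K : ℝ, 0 ≤ K ∧ ∀ u : ℝ → L2V, IsBoundedFlow T E B u → ∃ c : ℝ → ℝ,
      (∀ᵐ t ∂timeMeasure T, inner ℝ (u t) (testLp hψ.toIsTestFn) = c t) ∧
      (∀ t ∈ Icc 0 T, |c t| ≤ M) ∧
      ∀ s t r : ℝ, 0 ≤ s → s ≤ t → t ≤ T → 0 < r → |c t - c s| ≤ K * (r + (t - s) / r) := by
  obtain ⟨k, hk0, hk⟩ := exists_momentumFlux_bound hψ.toIsTestFn
  set k' := k * (√(2 * E) + 1) with hk'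
  have hk'0 : 0 ≤ k' := by positivity
  -- Chosen so that `k'(rE + 3τ/r) ≤ K(r + τ/r)`. The bound for `|c|` below takes `r = 1` on
  -- `[0,t]`, starting from the initial moment.
  set K := k' * (E + 3) with hK
  have hK0 : 0 ≤ K := by positivity
  refine ⟨B * ‖testLp hψ.toIsTestFn‖ + K * (1 + T), K, hK0, fun u hu => ?_⟩
  obtain ⟨u₀, p, Du, hcl, hB, huE, hDE, hid⟩ := hu
  set f : ℝ → ℝ := fun s => momentumFlux hψ.toIsTestFn (u s) (Du s) with hf
  have hfi : Integrable f (timeMeasure T) := integrable_momentumFlux hcl.u_bdd hcl.grad_mem _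
  have hgi := integrable_sum_norm_sq hcl.grad_mem
  have hfI : IntervalIntegrable f volume 0 T :=
    (intervalIntegrable_iff_integrableOn_Icc_of_le hT.le).2 hfi
  have hgI : IntervalIntegrable (fun t => ∑ j, ‖Du t j‖ ^ 2) volume 0 T :=
    (intervalIntegrable_iff_integrableOn_Icc_of_le hT.le).2 hgi
  have hsub : ∀ {s t : ℝ}, 0 ≤ s → s ≤ t → t ≤ T → uIcc s t ⊆ uIcc 0 T := fun h0 hst htT => by
    rw [uIcc_of_le hst, uIcc_of_le hT.le]; exact Icc_subset_Icc h0 htT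
  have hflux : ∀ s t r : ℝ, 0 ≤ s → s ≤ t → t ≤ T → 0 < r →
      |∫ x in s..t, f x| ≤ K * (r + (t - s) / r) := by
    intro s t r h0 hst htT hr
    have hgst := hgI.mono_set (hsub h0 hst htT)
    have hb : ∀ᵐ x, x ∈ Ioc s t → ‖f x‖ ≤ k' * (r * ∑ j, ‖Du x j‖ ^ 2 + 3 / r) := by
      have := huE
      rw [timeMeasure, ae_restrict_iff' measurableSet_Icc] at this
      filter_upwards [this] with x hx hxs
      have h1 := hx ⟨h0.trans hxs.1.le, hxs.2.trans htT⟩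
      refine (hk _ _).trans ?_
      have h2 : ‖u x‖ ≤ √(2 * E) := Real.le_sqrt_of_sq_le h1
      have h3 : 0 ≤ ∑ j, ‖Du x j‖ := Finset.sum_nonneg fun j _ => norm_nonneg _
      have h4 := sum_norm_le (G := Du x) hr
      rw [hk']
      gcongr
    have hint : IntervalIntegrable (fun x => k' * (r * ∑ j, ‖Du x j‖ ^ 2 + 3 / r)) volume s t :=
      ((hgst.const_mul r).add intervalIntegrable_const).const_mul k'
    have hle := intervalIntegral.norm_integral_le_of_norm_le hst hb hint
    rw [Real.norm_eq_abs] at hle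
    refine hle.trans ?_
    rw [intervalIntegral.integral_const_mul, intervalIntegral.integral_add (hgst.const_mul r)
      intervalIntegrable_const, intervalIntegral.integral_const_mul,
      intervalIntegral.integral_const, smul_eq_mul]
    have h5 : ∫ x in s..t, ∑ j, ‖Du x j‖ ^ 2 ≤ E := by
      refine le_trans ?_ hDE
      rw [intervalIntegral.integral_of_le hst]
      refine setIntegral_mono_set hgi (Eventually.of_forall fun x => ?_) ?_
      · exact Finset.sum_nonneg fun j _ => sq_nonneg _
      · exact (Ioc_subset_Icc_self.trans (Icc_subset_Icc h0 htT)).eventuallyLE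
    have h6 : 0 ≤ (t - s) / r := div_nonneg (sub_nonneg.2 hst) hr.le
    rw [hK, mul_assoc k' (E + 3)]
    refine mul_le_mul_of_nonneg_left ?_ hk'0
    have h7 : (t - s) * (3 / r) = 3 * ((t - s) / r) := by ring
    rw [h7]
    nlinarith [mul_le_mul_of_nonneg_left h5 hr.le, mul_nonneg hE h6]
  refine ⟨fun t => inner ℝ u₀ (testLp hψ.toIsTestFn) - ∫ s in (0 : ℝ)..t, f s, hid ψ hψ,
    fun t ht => ?_, fun s t r h0 hst htT hr => ?_⟩
  · have h1 := hflux 0 t 1 le_rfl ht.1 ht.2 one_pos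
    have h2 : |inner ℝ u₀ (testLp hψ.toIsTestFn)| ≤ B * ‖testLp hψ.toIsTestFn‖ :=
      (abs_real_inner_le_norm _ _).trans (by gcongr)
    refine (abs_sub _ _).trans (add_le_add h2 (h1.trans ?_))
    rw [sub_zero, div_one]
    gcongr
    exact ht.2
  · have h1 : (∫ x in (0 : ℝ)..t, f x) - ∫ x in (0 : ℝ)..s, f x = ∫ x in s..t, f x :=
      intervalIntegral.integral_interval_sub_left
        (hfI.mono_set (hsub le_rfl (h0.trans hst) htT))
        (hfI.mono_set (hsub le_rfl h0 (hst.trans htT)))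
    rw [sub_sub_sub_cancel_left, abs_sub_comm, h1]
    exact hflux s t r h0 hst htT hr

/-- Localised solenoidal parts of flows with common a priori bounds are precompact in
`L²(0,T; L²)`. -/
theorem totallyBounded_weight_lerayP {T E B : ℝ} (hT : 0 < T) (hE : 0 ≤ E) :
    TotallyBounded {f : Lp L2V 2 (timeMeasure T) | ∃ u, IsBoundedFlow T E B u ∧
      f =ᵐ[timeMeasure T] fun t => weight (lerayP (u t))} := by
  refine totallyBounded_of_approx fun η hη => ?_
  -- `C²` bounds the time integral of `(‖u‖ + ∑ ‖Du j‖)²`: the `4` is Cauchy–Schwarz for four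
  -- summands, `2ET` comes from `‖u‖² ≤ 2E` and `E` from the dissipation.
  set C := √(4 * (2 * E * T + E)) with hC
  set ρ := η / 2 / (C + 1) with hρ
  have hC0 : 0 ≤ C := Real.sqrt_nonneg _
  have hρ0 : 0 < ρ := by positivity
  obtain ⟨s, ψ, hψ, z, hs⟩ := exists_solenoidal_finite_rank_approx hρ0
  set A : (Fin 3 → ℤ) × Fin 3 → Set (Lp ℝ 2 (timeMeasure T)) := fun l =>
    {a | ∃ u, IsBoundedFlow T E B u ∧
      a =ᵐ[timeMeasure T] fun t => inner ℝ (u t) (testLp (hψ l).toIsTestFn)} with hA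
  have hAc : ∀ l, IsCompact (closure (A l)) := fun l => by
    obtain ⟨M, K, hK, h⟩ := exists_moment_bounds (B := B) hT hE (hψ l)
    refine TotallyBounded.isCompact_of_isClosed (TotallyBounded.closure
      (totallyBounded_of_equicontinuous hT (M := M) hK ?_)) isClosed_closure
    rintro a ⟨u, hu, hau⟩
    obtain ⟨c, h1, h2, h3⟩ := h u hu
    exact ⟨c, hau.trans h1, h2, h3⟩
  -- The finite rank reconstruction from the moments. It is continuous, so it maps the product of
  -- the compact sets of moments to the compact set that approximates the family.
  set Φ : ((Fin 3 → ℤ) × Fin 3 → Lp ℝ 2 (timeMeasure T)) → Lp L2V 2 (timeMeasure T) := fun a =>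
    ∑ l ∈ s, (ContinuousLinearMap.toSpanSingleton ℝ (z l)).compLp (a l) with hΦ
  have hΦc : Continuous Φ := continuous_finsetSum _ fun l _ =>
    ((ContinuousLinearMap.toSpanSingleton ℝ (z l)).compLpL 2
      (timeMeasure T)).continuous.comp (continuous_apply l)
  refine ⟨Φ '' univ.pi fun l => closure (A l), (isCompact_univ_pi hAc).image hΦc, ?_⟩
  rintro f ⟨u, hu, hfu⟩
  have hu' := hu
  obtain ⟨u₀, p, Du, hcl, hB, huE, hDE, -⟩ := hu'
  have hu2 : MemLp u 2 (timeMeasure T) := hcl.u_bdd.mono_exponent le_top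
  have ham : ∀ l, MemLp (fun t => inner ℝ (u t) (testLp (hψ l).toIsTestFn)) 2 (timeMeasure T) :=
    fun l => hu2.inner_const _
  set a : (Fin 3 → ℤ) × Fin 3 → Lp ℝ 2 (timeMeasure T) := fun l => (ham l).toLp _ with ha
  refine ⟨Φ a, ⟨a, fun l _ => subset_closure ⟨u, hu, (ham l).coeFn_toLp⟩, rfl⟩, ?_⟩
  have hΦa : ∀ᵐ t ∂timeMeasure T, Φ a t
      = ∑ l ∈ s, inner ℝ (u t) (testLp (hψ l).toIsTestFn) • z l := by
    have c1 : ∀ᵐ t ∂timeMeasure T, ∀ l, (ContinuousLinearMap.toSpanSingleton ℝ (z l)).compLp (a l) t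
        = inner ℝ (u t) (testLp (hψ l).toIsTestFn) • z l := ae_all_iff.2 fun l => by
      filter_upwards [(ContinuousLinearMap.toSpanSingleton ℝ (z l)).coeFn_compLp (a l),
        (ham l).coeFn_toLp] with t h1 h2
      rw [h1, ha, h2, ContinuousLinearMap.toSpanSingleton_apply]
    filter_upwards [c1, Lp.coeFn_finsetSum s fun l =>
      (ContinuousLinearMap.toSpanSingleton ℝ (z l)).compLp (a l)] with t h1 h2
    rw [hΦ, h2, Finset.sum_apply]
    exact Finset.sum_congr rfl fun l _ => h1 l
  have hgi := integrable_sum_norm_sq hcl.grad_mem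
  set g : ℝ → ℝ := fun t => 4 * ρ ^ 2 * (2 * E + ∑ j, ‖Du t j‖ ^ 2) with hg
  have hg0 : ∀ t, 0 ≤ g t := fun t => by
    have : 0 ≤ ∑ j, ‖Du t j‖ ^ 2 := Finset.sum_nonneg fun j _ => sq_nonneg _
    positivity
  have hpt : ∀ᵐ t ∂timeMeasure T, ‖(f - Φ a : Lp L2V 2 (timeMeasure T)) t‖ ^ 2 ≤ g t := by
    filter_upwards [hfu, hΦa, Lp.coeFn_sub f (Φ a), hcl.grad_eq, huE] with t h1 h2 h3 h4 h5
    rw [h3, Pi.sub_apply, h1, h2]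
    have h6 := hs (u t) (Du t) h4
    have h7 : (‖u t‖ + ∑ j, ‖Du t j‖) ^ 2 ≤ 4 * (‖u t‖ ^ 2 + ∑ j, ‖Du t j‖ ^ 2) := by
      rw [Fin.sum_univ_three, Fin.sum_univ_three]
      nlinarith [sq_nonneg (‖u t‖ - ‖Du t 0‖), sq_nonneg (‖u t‖ - ‖Du t 1‖),
        sq_nonneg (‖u t‖ - ‖Du t 2‖), sq_nonneg (‖Du t 0‖ - ‖Du t 1‖),
        sq_nonneg (‖Du t 0‖ - ‖Du t 2‖), sq_nonneg (‖Du t 1‖ - ‖Du t 2‖)]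
    calc _ ≤ (ρ * (‖u t‖ + ∑ j, ‖Du t j‖)) ^ 2 := pow_le_pow_left₀ (norm_nonneg _) h6 2
      _ = ρ ^ 2 * (‖u t‖ + ∑ j, ‖Du t j‖) ^ 2 := mul_pow _ _ _
      _ ≤ ρ ^ 2 * (4 * (‖u t‖ ^ 2 + ∑ j, ‖Du t j‖ ^ 2)) := by gcongr
      _ ≤ ρ ^ 2 * (4 * (2 * E + ∑ j, ‖Du t j‖ ^ 2)) := by gcongr
      _ = g t := by rw [hg]; ring
  have hgint : Integrable g (timeMeasure T) := ((integrable_const _).add hgi).const_mul _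
  have hgle : ∫ t, g t ∂timeMeasure T ≤ (ρ * C) ^ 2 := by
    rw [integral_const_mul, integral_add (integrable_const _) hgi, integral_const, mul_pow, hC,
      Real.sq_sqrt (by positivity)]
    have h1 : (timeMeasure T).real univ = T := by
      rw [measureReal_def, timeMeasure, Measure.restrict_apply_univ, Real.volume_Icc,
        ENNReal.toReal_ofReal (by linarith)]
      ring
    have h2 : ∫ t, ∑ j, ‖Du t j‖ ^ 2 ∂timeMeasure T ≤ E := hDE
    rw [h1, smul_eq_mul]
    nlinarith [mul_le_mul_of_nonneg_left h2 (sq_nonneg ρ)]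
  have hn : ‖f - Φ a‖ₑ ^ 2 ≤ ENNReal.ofReal ((ρ * C) ^ 2) := by
    rw [← lintegral_enorm_sq]
    calc _ ≤ ∫⁻ t, ENNReal.ofReal (g t) ∂timeMeasure T := by
          refine lintegral_mono_ae ?_
          filter_upwards [hpt] with t ht
          rw [← ofReal_norm, ← ENNReal.ofReal_pow (norm_nonneg _)]
          exact ENNReal.ofReal_le_ofReal ht
      _ = ENNReal.ofReal (∫ t, g t ∂timeMeasure T) :=
          (ofReal_integral_eq_lintegral_ofReal hgint (Eventually.of_forall hg0)).symm
      _ ≤ _ := ENNReal.ofReal_le_ofReal hgle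
  rw [← ofReal_norm, ← ENNReal.ofReal_pow (norm_nonneg _),
    ENNReal.ofReal_le_ofReal_iff (by positivity)] at hn
  rw [dist_eq_norm]
  refine (le_of_sq_le_sq hn (by positivity)).trans_lt ?_
  calc ρ * C ≤ ρ * (C + 1) := by nlinarith
    _ = η / 2 := by rw [hρ]; field_simp
    _ < η := half_lt_self hη

/-! ### Convergence in `L²(0,T; L²_loc)` -/

theorem memLp_top_indicator_ball {k : E3 → ℝ} (hk : Continuous k) (R : ℝ) :
    MemLp ((Metric.ball (0 : E3) R).indicator k) ⊤ (volume : Measure E3) := by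
  obtain ⟨C, hC⟩ := (isCompact_closedBall (0 : E3) R).exists_bound_of_continuousOn hk.continuousOn
  refine memLp_top_of_bound (hk.stronglyMeasurable.indicator
    measurableSet_ball).aestronglyMeasurable (max C 0) (Eventually.of_forall fun x => ?_)
  by_cases hx : x ∈ Metric.ball (0 : E3) R
  · rw [indicator_of_mem hx]
    exact (hC x (Metric.ball_subset_closedBall hx)).trans (le_max_left _ _)
  · rw [indicator_of_notMem hx, norm_zero]
    exact le_max_right _ _

/-- Restriction to a ball of the product with a continuous function. -/
def mulRestrict {k : E3 → ℝ} (hk : Continuous k) (R : ℝ) :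
    L2V →L[ℝ] Lp E3 2 ((volume : Measure E3).restrict (Metric.ball 0 R)) :=
  (LpToLpRestrictCLM E3 E3 ℝ volume 2 (Metric.ball 0 R)).comp
    (mulBdd (memLp_top_indicator_ball hk R))

theorem mulRestrict_coe {k : E3 → ℝ} (hk : Continuous k) (R : ℝ) (u : L2V) :
    mulRestrict hk R u =ᵐ[(volume : Measure E3).restrict (Metric.ball 0 R)]
      fun x => k x • u x := by
  have h1 := LpToLpRestrictCLM_coeFn ℝ (Metric.ball (0 : E3) R)
    (mulBdd (memLp_top_indicator_ball hk R) u)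
  have h2 := ae_restrict_of_ae (s := Metric.ball (0 : E3) R)
    (mulBdd_coe (memLp_top_indicator_ball hk R) u)
  filter_upwards [h1, h2, ae_restrict_mem measurableSet_ball] with x a b c
  rw [indicator_of_mem c] at b
  exact a.trans b

theorem memL2L2loc_smul {T : ℝ} {k : E3 → ℝ} (hk : Continuous k) {Z : ℝ → L2V}
    (hZ : MemLp Z 2 (timeMeasure T)) : MemL2L2loc T fun t x => k x • Z t x := fun R _ =>
  ⟨fun t => mulRestrict hk R (Z t), (mulRestrict hk R).comp_memLp' hZ,
    Eventually.of_forall fun t => mulRestrict_coe hk R (Z t)⟩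

theorem memL2L2loc_coe {T : ℝ} {Z : ℝ → L2V} (hZ : MemLp Z 2 (timeMeasure T)) :
    MemL2L2loc T fun t x => Z t x := by
  simpa using memL2L2loc_smul (k := fun _ => 1) continuous_const hZ

/-- Dividing out the weight costs the factor `1 + |x|²`, which is at most `1 + R²` on the ball. -/
theorem lintegral_ball_sub_le (R : ℝ) (v Z : L2V) :
    ∫⁻ x in Metric.ball (0 : E3) R, ‖v x - (1 + ‖x‖ ^ 2) • Z x‖ₑ ^ 2
      ≤ ENNReal.ofReal (1 + R ^ 2) ^ 2 * ‖weight v - Z‖ₑ ^ 2 := by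
  rw [← lintegral_enorm_sq, ← lintegral_const_mul _
    (((Lp.stronglyMeasurable (weight v - Z)).measurable.enorm).pow_const 2)]
  refine (setLIntegral_mono_ae' measurableSet_ball ?_).trans (setLIntegral_le_lintegral _ _)
  filter_upwards [weight_coe v, Lp.coeFn_sub (weight v) Z] with x h1 h2 hx
  have h3 : v x - (1 + ‖x‖ ^ 2) • Z x = (1 + ‖x‖ ^ 2) • (weight v - Z : L2V) x := by
    rw [h2, Pi.sub_apply, h1, smul_sub, smul_smul, mul_inv_cancel₀ (by positivity), one_smul]
  rw [h3, enorm_smul, mul_pow, Real.enorm_eq_ofReal (by positivity)]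
  have h4 : ‖x‖ ≤ R := (mem_ball_zero_iff.1 hx).le
  gcongr

/-- The subsequence is extracted once, in the global space with weight, so a single subsequence and
a single limit `(1+|x|²)Z` serve every radius; no diagonal argument is needed. -/
theorem isPrecompactL2L2loc_of_isBoundedFlow {T E B : ℝ} (hT : 0 < T) (hE : 0 ≤ E)
    {S : Set (ℝ → E3 → E3)}
    (hS : ∀ v ∈ S, ∃ u, IsBoundedFlow T E B u ∧ v = fun t x => (lerayP (u t)) x) :
    IsPrecompactL2L2loc T S := by
  have hmem : ∀ {u}, IsBoundedFlow T E B u → MemLp (fun t => lerayP (u t)) 2 (timeMeasure T) :=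
    fun {u} hu => by
      obtain ⟨u₀, p, Du, hcl, -⟩ := hu
      exact lerayP.comp_memLp' (hcl.u_bdd.mono_exponent le_top)
  refine ⟨fun v hv => ?_, fun v hv => ?_⟩
  · obtain ⟨u, hu, rfl⟩ := hS v hv
    exact memL2L2loc_coe (hmem hu)
  · choose u hu hvu using fun n => hS (v n) (hv n)
    have hX : ∀ n, MemLp (fun t => weight (lerayP (u n t))) 2 (timeMeasure T) := fun n =>
      weight.comp_memLp' (hmem (hu n))
    have hc : IsCompact (closure {f : Lp L2V 2 (timeMeasure T) | ∃ u, IsBoundedFlow T E B u ∧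
        f =ᵐ[timeMeasure T] fun t => weight (lerayP (u t))}) :=
      (totallyBounded_weight_lerayP hT hE).closure.isCompact_of_isClosed isClosed_closure
    obtain ⟨Z, -, k, hk, hlim⟩ := hc.tendsto_subseq (x := fun n => (hX n).toLp _)
      fun n => subset_closure ⟨u n, hu n, (hX n).coeFn_toLp⟩
    refine ⟨k, fun t x => (1 + ‖x‖ ^ 2) • Z t x, hk,
      memL2L2loc_smul (k := fun x => 1 + ‖x‖ ^ 2) (by fun_prop) (Lp.memLp Z), fun R hR => ?_⟩
    have hle : ∀ n, ∫⁻ t, (∫⁻ x in Metric.ball (0 : E3) R,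
        ‖v (k n) t x - (1 + ‖x‖ ^ 2) • Z t x‖ₑ ^ 2) ∂timeMeasure T
        ≤ ENNReal.ofReal (1 + R ^ 2) ^ 2 * ‖(hX (k n)).toLp _ - Z‖ₑ ^ 2 := fun n => by
      rw [← lintegral_enorm_sq, ← lintegral_const_mul _
        (((Lp.stronglyMeasurable ((hX (k n)).toLp _ - Z)).enorm).pow_const 2)]
      refine lintegral_mono_ae ?_
      filter_upwards [Lp.coeFn_sub ((hX (k n)).toLp _) Z, (hX (k n)).coeFn_toLp] with t h1 h2
      rw [h1, Pi.sub_apply, h2, hvu]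
      exact lintegral_ball_sub_le R _ _
    have h0 : Tendsto (fun n => ‖(hX (k n)).toLp _ - Z‖ₑ) atTop (𝓝 0) := by
      have := (tendsto_iff_edist_tendsto_0.1 hlim)
      simpa [edist_eq_enorm_sub] using this
    have h1 : Tendsto (fun n => ENNReal.ofReal (1 + R ^ 2) ^ 2 *
        ‖(hX (k n)).toLp _ - Z‖ₑ ^ 2) atTop (𝓝 0) := by
      have h2 := ENNReal.Tendsto.const_mul (a := ENNReal.ofReal (1 + R ^ 2) ^ 2)
        (ENNReal.Tendsto.pow (n := 2) h0) (Or.inr (ENNReal.pow_ne_top ENNReal.ofReal_ne_top))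
      simpa using h2
    exact tendsto_of_tendsto_of_tendsto_of_le_of_le tendsto_const_nhds h1 (fun _ => zero_le) hle

/-! ### Solutions as bounded flows, and the conclusion. -/

theorem isBoundedFlow_of_isSolution {T : ℝ} (hT : 0 < T) {ε : ℝ → ℝ}
    (hε : ContDiffOn ℝ 1 ε (Icc 0 T)) (hpos : ∀ t ∈ Icc 0 T, 0 < ε t) {u₀ : L2V} {p₀ : L2S}
    {u : ℝ → L2V} {p : ℝ → L2S} (hsol : IsSolution T ε u₀ p₀ u p) {B E : ℝ} (hB : ‖u₀‖ ≤ B)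
    (hE : energy (ε 0) u₀ p₀ ≤ E) : IsBoundedFlow T E B u := by
  obtain ⟨Du, h1, h2, h3, h4⟩ := exists_bounds_of_isSolution hT hε hpos hsol
  refine ⟨u₀, p, Du, h1, hB, ?_, h3.trans hE, h4⟩
  filter_upwards [h2] with t ht
  linarith

theorem energy_le_of_norm_le {ε B D : ℝ} (hε : 0 ≤ ε) {u₀ : L2V} {p₀ : L2S} (hu : ‖u₀‖ ≤ B)
    (hp : ‖√ε • p₀‖ ≤ D) : energy ε u₀ p₀ ≤ (1 / 2 : ℝ) * (B ^ 2 + D ^ 2) := by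
  have h1 : ε * ‖p₀‖ ^ 2 = ‖√ε • p₀‖ ^ 2 := by
    rw [norm_smul, mul_pow, Real.norm_eq_abs, sq_abs, Real.sq_sqrt hε]
  rw [energy, h1]
  gcongr

end AC

end

theorem lemma4p4 (T ϵ₁ c C : ℝ) (hT : 0 < T) (hϵ₁ : 0 < ϵ₁) (hc : 0 < c) (hC : 0 < C)
    -- the relaxation functions `ε(t) = ϵ A_ϵ(t)`, `0 < ϵ < ϵ₁`
    (A : ℝ → ℝ → ℝ)
    (hA : ∀ ϵ ∈ Ioo 0 ϵ₁, ContDiffOn ℝ 2 (A ϵ) (Icc 0 T))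
    (hAbd : ∀ ϵ ∈ Ioo 0 ϵ₁, ∀ t ∈ Icc 0 T, c ≤ A ϵ t ∧ A ϵ t ≤ C)
    (hA1 : ∀ t ∈ Icc 0 T,
      Tendsto (fun ϵ => derivWithin (A ϵ) (Icc 0 T) t / A ϵ t) (𝓝[>] 0) (𝓝 0))
    (hA2 : ∀ t ∈ Icc 0 T,
      Tendsto (fun ϵ => iteratedDerivWithin 2 (A ϵ) (Icc 0 T) t / A ϵ t) (𝓝[>] 0) (𝓝 0))
    -- initial data: `u₀^ϵ → u₀` and `√ε p₀^ϵ → 0` strongly in `L²`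
    (uinit : ℝ → AC.L2V) (pinit : ℝ → AC.L2S) (u₀ : AC.L2V)
    (hu₀ : Tendsto uinit (𝓝[>] 0) (𝓝 u₀))
    (hp₀ : Tendsto (fun ϵ => √(ϵ * A ϵ 0) • pinit ϵ) (𝓝[>] 0) (𝓝 0))
    -- solutions of the Cauchy problem
    (u : ℝ → ℝ → AC.L2V) (p : ℝ → ℝ → AC.L2S)
    (hsol : ∀ ϵ ∈ Ioo 0 ϵ₁,
      AC.IsSolution T (fun t => ϵ * A ϵ t) (uinit ϵ) (pinit ϵ) (u ϵ) (p ϵ)) :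
    ∃ ϵ₀ ∈ Ioc 0 ϵ₁, AC.IsPrecompactL2L2loc T
      {v | ∃ ϵ ∈ Ioo 0 ϵ₀, v = fun t x => (AC.lerayP (u ϵ t)) x} := by
  -- Convergence of the data is needed only for these bounds. They determine `ϵ₀` and give the
  -- common initial energy bound `½((‖u₀‖ + 1)² + 1)`.
  have hev : ∀ᶠ ϵ in 𝓝[>] (0 : ℝ), ‖uinit ϵ‖ ≤ ‖u₀‖ + 1 ∧ ‖√(ϵ * A ϵ 0) • pinit ϵ‖ ≤ 1 := by
    have h1 := hu₀.norm.eventually (eventually_le_nhds (lt_add_one ‖u₀‖))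
    have h2 := hp₀.norm.eventually (eventually_le_nhds (b := 1) (by simp))
    exact h1.and h2
  obtain ⟨ϵ₀, hϵ₀, hsub⟩ := (mem_nhdsGT_iff_exists_mem_Ioc_Ioo_subset hϵ₁).1 hev
  refine ⟨ϵ₀, hϵ₀, AC.isPrecompactL2L2loc_of_isBoundedFlow
    (E := (1 / 2 : ℝ) * ((‖u₀‖ + 1) ^ 2 + 1 ^ 2)) (B := ‖u₀‖ + 1) hT (by positivity) ?_⟩
  rintro v ⟨ϵ, hϵ, rfl⟩
  obtain ⟨hu, hp⟩ := hsub hϵ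
  have hϵ' : ϵ ∈ Ioo 0 ϵ₁ := ⟨hϵ.1, hϵ.2.trans_le hϵ₀.2⟩
  have hpos : ∀ t ∈ Icc 0 T, 0 < ϵ * A ϵ t := fun t ht =>
    mul_pos hϵ.1 (hc.trans_le (hAbd ϵ hϵ' t ht).1)
  exact ⟨u ϵ, AC.isBoundedFlow_of_isSolution hT
    (contDiffOn_const.mul ((hA ϵ hϵ').of_le (by norm_num))) hpos (hsol ϵ hϵ') hu
    (AC.energy_le_of_norm_le (hpos 0 ⟨le_rfl, hT.le⟩).le hu hp), rfl⟩
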